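/- **Alternating Turing machines with output.** Let $\Lambda$ be a finite alphabet, let $\bot,\triangleright\notin\Lambda$ be two further symbols (blank and left marker), and put $\Lambda'=\Lambda\cup\{\bot,\triangleright\}$. An *alternating Turing machine with output* (ATO) over $\Lambda$ is a tuple $M=(S,\Lambda',s_{\rm init},s_{\rm accept},s_{\rm reject},S_\exists,S_\forall,S_L,\delta)$, where $S$ is a finite set of states, $s_{\rm init},s_{\rm accept},s_{\rm reject}\in S$, the sets $S_\exists$ (existential states) and $S_\forall$ (universal states) partition $S\setminus\{s_{\rm accept},s_{\rm reject}\}$, the set $S_L\subseteq S$ of labeling states contains $s_{\rm init}$, and $\delta$ assigns to each $(s,\alpha,\beta)\in(S\setminus\{s_{\rm accept},s_{\rm reject}\})\times\Lambda'\times\Lambda'$ a finite subset of $S\times\{-1,0,+1\}\times\{-1,0,+1\}\times\Lambda'\times\Lambda'^*$. The function $\delta$ is restricted so that a cursor on $\triangleright$ never moves left and $\triangleright$ is neither overwritten by another symbol nor written over another symbol. A configuration is a tuple $(s,x,y,z,h_x,h_y)$: the state, the contents of the read-only input tape, of the working tape and of the labeling tape, and the positions of the cursors on the input and the working tape; beyond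 $x$ and $y$ the input and working tapes are blank. On input $w\in\Lambda^*$ the initial configuration is $(s_{\rm init},\triangleright w,\triangleright,\epsilon,1,1)$. If the cursors of $C=(s,x,y,z,h_x,h_y)$ read $\alpha$ and $\beta$, then each $(s',d,d',\beta',z')\in\delta(s,\alpha,\beta)$ gives a successor of $C$: the state becomes $s'$, $\beta'$ is written in cell $h_y$ of the working tape (so $y$ is extended when this cell lies beyond it), the cursors move by $d$ and $d'$, and the labeling tape becomes $z'$ if $s\in S_L$ and $zz'$ if $s\notin S_L$. A configuration is accepting, rejecting, existential, universal or labeling according to its state. A *computation* of $M$ on $w$ is a finite rooted tree with nodes labeled by configurations, such that the root is labeled with the initial configuration on $w$; each leaf is labeled with an accepting or rejecting configuration; and each non-leaf node is labeled with a configuration with a non-empty set $\{C_1,\dots,C_n\}$ of successors, and has exactly one child, labeled with some $C_i$, if it is existential, and exactly $n$ children, labeled with $C_1,\dots,C_n$, if it is universal. It is *accepting* if all its leaves are accepting. The *output* of a computation is the node-labeled rooted tree whose nodes are the nodes with a labeling configuration, each labeled with the content $z$ of the labeling tape, where there is an edge from $u$ to $v$ if $u$ reaches $v$ by a downward path all of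 whose intermediate nodes are non-labeling. A *valid output* of $M$ on $w$ is the output of an accepting computation of $M$ on $w$; outputs are unordered trees, identified up to isomorphism. Let $\mathsf{span}_M(w)$ be the number of distinct valid outputs of $M$ on $w$. **The class $\mathsf{SpanTL}$.** An ATO $M$ is *well-behaved* if there are a polynomial $\mathrm{pol}$ and integers $c,k\ge 0$ such that for every $w\in\Lambda^*$, with $n=|w|$, and every computation $T$ of $M$ on $w$: $T$ has at most $c\cdot\mathrm{pol}(n)$ nodes; in every configuration $(\cdot,\cdot,y,z,\cdot,\cdot)$ that labels a node of $T$, $|y|,|z|\le c\,(\lfloor\log_2 \max(n,1)\rfloor+1)$; and every downward path in $T$ without labeling nodes contains at most $k$ universal nodes. A function $f:\Lambda^*\to\mathbb N$ (where $0\in\mathbb N$) belongs to $\mathsf{SpanTL}$ if $f=\mathsf{span}_M$ for some well-behaved ATO $M$ over $\Lambda$. **Logspace computable functions.** A function $h:\Lambda_1^*\to\Lambda_2^*$ is *logspace computable* if there is a deterministic Turing machine with a read-only two-way input tape (whose cursor stays on $\triangleright w\bot$), a read-write working tape over some finite alphabet and a write-only one-way output tape, that on every input $w\in\Lambda_1^*$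 halts with $h(w)$ on its output tape and uses at most $c\,(\lfloor\log_2 \max(|w|,1)\rfloor+1)$ cells of its working tape, for a constant $c$. **Proposition.** $\mathsf{SpanTL}$ is closed under logspace reductions: let $\Lambda_1,\Lambda_2$ be finite alphabets, and let $f:\Lambda_1^*\to\mathbb N$, $g:\Lambda_2^*\to\mathbb N$ and $h:\Lambda_1^*\to\Lambda_2^*$ be functions such that $g\in\mathsf{SpanTL}$, $h$ is logspace computable, and $f(w)=g(h(w))$ for all $w\in\Lambda_1^*$. Then $f\in\mathsf{SpanTL}$. -/

import Mathlib

universe u v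

/-! ### Finite node-labelled rooted trees -/

/-- Finite rooted trees with nodes labelled in `L`. The children of a node are kept in a list; the
order of that list is forgotten in `UTree` below. -/
inductive LTree (L : Type u) : Type u
  | node (a : L) (children : List (LTree L)) : LTree L

namespace LTree

variable {L : Type u}

/-- The label of the root. -/
def root : LTree L → L
  | node a _ => a

mutual
/-- The labels of all nodes, one list entry for each node. -/
def nodes : LTree L → List L
  | node a ts => a :: nodesList ts
/-- The labels of all nodes of a forest. -/
def nodesList : List (LTree L) → List L
  | [] => []
  | t :: ts => nodes t ++ nodesList ts
end

/-- The number of nodes. -/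
def size (t : LTree L) : ℕ := t.nodes.length

mutual
/-- The labels of all leaves, one list entry for each leaf. -/
def leaves : LTree L → List L
  | node a [] => [a]
  | node _ (t :: ts) => leaves t ++ leavesList ts
/-- The labels of all leaves of a forest. -/
def leavesList : List (LTree L) → List L
  | [] => []
  | t :: ts => leaves t ++ leavesList ts
end

/-- `RootPath t p`: `p` lists the labels along a non-empty downward path that starts at the root
of `t` (and ends at an arbitrary node). -/
inductive RootPath : LTree L → List L → Prop
  | single (a : L) (ts : List (LTree L)) : RootPath (node a ts) [a]
  | cons (a : L) (ts : List (LTree L)) (t : LTree L) (p : List L) :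
      t ∈ ts → RootPath t p → RootPath (node a ts) (a :: p)

/-- `IsPath t p`: `p` lists the labels along a non-empty downward path in `t` (from an arbitrary
node of `t` to an arbitrary descendant of it). -/
inductive IsPath : LTree L → List L → Prop
  | here (t : LTree L) (p : List L) : RootPath t p → IsPath t p
  | inside (a : L) (ts : List (LTree L)) (t : LTree L) (p : List L) :
      t ∈ ts → IsPath t p → IsPath (node a ts) p

mutual
/-- Isomorphism of node-labelled rooted trees: equal root labels, and the lists of subtrees agree
up to reordering and isomorphism. -/
inductive Iso : LTree L → LTree L → Prop
  | node (a : L) (ts us : List (LTree L)) : IsoList ts us → Iso (node a ts) (node a us)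
/-- Two lists of trees agree up to reordering and isomorphism of the members. -/
inductive IsoList : List (LTree L) → List (LTree L) → Prop
  | nil : IsoList [] []
  | cons (t u : LTree L) (ts us : List (LTree L)) :
      Iso t u → IsoList ts us → IsoList (t :: ts) (u :: us)
  | swap (t u : LTree L) (ts : List (LTree L)) : IsoList (t :: u :: ts) (u :: t :: ts)
  | trans (ts us vs : List (LTree L)) : IsoList ts us → IsoList us vs → IsoList ts vs
end

mutual
theorem Iso.refl : ∀ t : LTree L, Iso t t
  | .node a ts => Iso.node a ts ts (IsoList.refl ts)
theorem IsoList.refl : ∀ ts : List (LTree L), IsoList ts ts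
  | [] => IsoList.nil
  | t :: ts => IsoList.cons t t ts ts (Iso.refl t) (IsoList.refl ts)
end

mutual
theorem Iso.symm : ∀ {t u : LTree L}, Iso t u → Iso u t
  | _, _, .node a ts us h => Iso.node a us ts (IsoList.symm h)
theorem IsoList.symm : ∀ {ts us : List (LTree L)}, IsoList ts us → IsoList us ts
  | _, _, .nil => IsoList.nil
  | _, _, .cons t u ts us h hs => IsoList.cons u t us ts (Iso.symm h) (IsoList.symm hs)
  | _, _, .swap t u ts => IsoList.swap u t ts
  | _, _, .trans ts us vs h k => IsoList.trans vs us ts (IsoList.symm k) (IsoList.symm h)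
end

theorem Iso.trans {t u v : LTree L} (h : Iso t u) (k : Iso u v) : Iso t v := by
  cases h with
  | node a ts us h =>
    cases k with
    | node _ _ vs k => exact Iso.node a ts vs (IsoList.trans ts us vs h k)

/-- Isomorphism as an equivalence relation. -/
def isoSetoid (L : Type u) : Setoid (LTree L) where
  r := Iso
  iseqv := ⟨Iso.refl, Iso.symm, Iso.trans⟩

end LTree

/-- Finite (unordered) node-labelled rooted trees, up to isomorphism. -/
def UTree (L : Type u) : Type u := Quotient (LTree.isoSetoid L)

/-- The isomorphism class of a tree. -/
def LTree.toUTree {L : Type u} (t : LTree L) : UTree L := Quotient.mk (LTree.isoSetoid L) t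

/-! ### Tapes -/

/-- The machine alphabet over the letters `Λ`: the letters, the blank symbol `⊥` and the left
marker `▷`. -/
inductive TapeSym (Λ : Type u) : Type u
  | blank : TapeSym Λ
  | marker : TapeSym Λ
  | letter (a : Λ) : TapeSym Λ

/-- The cursor moves `-1`, `0`, `+1`. -/
inductive Move : Type
  | left
  | stay
  | right

/-- The new cursor position. (Machines never move left of cell `0`, see below.) -/
def Move.apply : Move → ℕ → ℕ
  | left, i => i - 1
  | stay, i => i
  | right, i => i + 1

/-- The symbol in cell `i` (cells are numbered from `0`) of the tape `x ⊥ ⊥ ⋯`. -/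
def tapeRead {Λ : Type u} (x : List (TapeSym Λ)) (i : ℕ) : TapeSym Λ := x.getD i TapeSym.blank

/-- Write `b` into cell `i` of the tape `x ⊥ ⊥ ⋯`; if the cell lies beyond `x`, then `x` is first
extended by blanks, so that the length of a tape counts all the cells ever used. -/
def tapeWrite {Λ : Type u} (x : List (TapeSym Λ)) (i : ℕ) (b : TapeSym Λ) : List (TapeSym Λ) :=
  (x ++ List.replicate (i + 1 - x.length) TapeSym.blank).set i b

/-- The tape contents `▷ w`. -/
def inputTape {Λ : Type u} (w : List Λ) : List (TapeSym Λ) := TapeSym.marker :: w.map TapeSym.letter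

/-- The logarithm used in the `O(log n)` bounds; adding `1` makes the bound meaningful for all `n`,
including `n = 0` and `n = 1`. -/
def logBound (n : ℕ) : ℕ := Nat.log 2 n + 1

/-! ### Alternating Turing machines with output -/

/-- Alternating Turing machines with output (ATO) whose alphabet consists of the letters `Λ`, the
blank and the left marker. A transition `(s, d, d', b, z)` gives the new state, the moves of the
input and the working cursor, the symbol written on the working tape, and the string appended to
the labelling tape. -/
structure ATO (Λ : Type u) where
  State : Type
  finite_state : Finite State
  init : State
  accept : State
  reject : State
  existential : Set State
  universal : Set State
  labeling : Set State
  disjoint : Disjoint existential universal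
  partition : existential ∪ universal = {accept, reject}ᶜ
  init_labeling : init ∈ labeling
  δ : State → TapeSym Λ → TapeSym Λ → Finset (State × Move × Move × TapeSym Λ × List (TapeSym Λ))
  /-- There are no transitions from the accepting and the rejecting state. -/
  δ_accept : ∀ α β, δ accept α β = ∅
  δ_reject : ∀ α β, δ reject α β = ∅
  /-- The input cursor does not move left of the marker. -/
  δ_input : ∀ s β, ∀ t ∈ δ s TapeSym.marker β, t.2.1 ≠ Move.left
  /-- The working cursor does not move left of the marker. -/
  δ_work : ∀ s α, ∀ t ∈ δ s α TapeSym.marker, t.2.2.1 ≠ Move.left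
  /-- The marker is never overwritten, and never written elsewhere. -/
  δ_marker : ∀ s α β, ∀ t ∈ δ s α β, (t.2.2.2.1 = TapeSym.marker ↔ β = TapeSym.marker)

namespace ATO

variable {Λ : Type u} (M : ATO Λ)

/-- Configurations `(s, x, y, z, h_x, h_y)`; the cursor positions are counted from `0`. -/
structure Config where
  state : M.State
  input : List (TapeSym Λ)
  work : List (TapeSym Λ)
  label : List (TapeSym Λ)
  inputPos : ℕ
  workPos : ℕ

/-- The initial configuration on input `w`. -/
def initial (w : List Λ) : M.Config where
  state := M.init
  input := inputTape w
  work := [TapeSym.marker]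
  label := []
  inputPos := 0
  workPos := 0

open Classical in
/-- The configuration entered from `C` by a given transition. The labelling tape is erased when a
labelling state is left. -/
noncomputable def move (C : M.Config)
    (t : M.State × Move × Move × TapeSym Λ × List (TapeSym Λ)) : M.Config where
  state := t.1
  input := C.input
  work := tapeWrite C.work C.workPos t.2.2.2.1
  label := if C.state ∈ M.labeling then t.2.2.2.2 else C.label ++ t.2.2.2.2
  inputPos := t.2.1.apply C.inputPos
  workPos := t.2.2.1.apply C.workPos

/-- The set `{C₁, …, Cₙ}` of the configurations that `M` may enter from `C` in one step. -/
def next (C : M.Config) : Set M.Config :=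
  {C' | ∃ t ∈ M.δ C.state (tapeRead C.input C.inputPos) (tapeRead C.work C.workPos),
    C' = M.move C t}

/-- `M.IsRun T`: every leaf of `T` is an accepting or a rejecting configuration; an existential
node has exactly one child, labelled with one of its successors; a universal node with successors
`C₁, …, Cₙ`, `n > 0`, has exactly `n` children, labelled with `C₁, …, Cₙ`. -/
inductive IsRun : LTree M.Config → Prop
  | halt (C : M.Config) : C.state = M.accept ∨ C.state = M.reject → IsRun (.node C [])
  | existential (C : M.Config) (t : LTree M.Config) :
      C.state ∈ M.existential → t.root ∈ M.next C → IsRun t → IsRun (.node C [t])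
  | universal (C : M.Config) (ts : List (LTree M.Config)) :
      C.state ∈ M.universal → ts ≠ [] → (ts.map LTree.root).Nodup →
      (∀ C', C' ∈ ts.map LTree.root ↔ C' ∈ M.next C) → (∀ t ∈ ts, IsRun t) →
      IsRun (.node C ts)

/-- `T` is a computation of `M` on input `w`. -/
def IsComputation (w : List Λ) (T : LTree M.Config) : Prop :=
  T.root = M.initial w ∧ M.IsRun T

/-- All leaves are labelled with accepting configurations. -/
def IsAccepting (T : LTree M.Config) : Prop :=
  ∀ C ∈ T.leaves, C.state = M.accept

open Classical in
mutual
/-- Keep the nodes of a tree with a labelling configuration, labelled with the contents of the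
labelling tape; `v` becomes a child of `u` if `u` reaches `v` through non-labelling nodes only. The
result is a single tree if the root is labelling. -/
noncomputable def outputForest : LTree M.Config → List (LTree (List (TapeSym Λ)))
  | .node C ts =>
      if C.state ∈ M.labeling then [.node C.label (outputForestList ts)] else outputForestList ts
/-- The same for a forest. -/
noncomputable def outputForestList : List (LTree M.Config) → List (LTree (List (TapeSym Λ)))
  | [] => []
  | t :: ts => outputForest t ++ outputForestList ts
end

/-- The valid outputs of `M` on input `w`, i.e. the outputs of the accepting computations of `M` on
`w`, as trees up to isomorphism. -/
def validOutputs (w : List Λ) : Set (UTree (List (TapeSym Λ))) :=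
  {O | ∃ T : LTree M.Config, M.IsComputation w T ∧ M.IsAccepting T ∧
    ∃ O' : LTree (List (TapeSym Λ)), M.outputForest T = [O'] ∧ O = O'.toUTree}

/-- The number of distinct valid outputs of `M` on `w` (a priori possibly infinite). -/
noncomputable def span (w : List Λ) : ℕ∞ := (M.validOutputs w).encard

open Classical in
/-- Well-behaved ATOs: computations have polynomial size, the working and the labelling tape use
logarithmic space, and the number of universal nodes on labelled-free paths is bounded. -/
def WellBehaved : Prop :=
  ∃ (pol : Polynomial ℕ) (c k : ℕ), ∀ (w : List Λ) (T : LTree M.Config), M.IsComputation w T →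
    T.size ≤ c * pol.eval w.length ∧
    (∀ C ∈ T.nodes, C.work.length ≤ c * logBound w.length ∧
      C.label.length ≤ c * logBound w.length) ∧
    (∀ p : List M.Config, T.IsPath p → (∀ C ∈ p, C.state ∉ M.labeling) →
      p.countP (fun C => decide (C.state ∈ M.universal)) ≤ k)

end ATO

/-- The class `SpanTL`, restricted to the functions on the strings over the alphabet `Λ`. -/
def SpanTL (Λ : Type u) : Set (List Λ → ℕ) :=
  {f | ∃ M : ATO Λ, M.WellBehaved ∧ ∀ w, M.span w = (f w : ℕ∞)}

/-! ### Logspace computable functions -/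

/-- Deterministic Turing machines with a read-only two-way input tape, a read-write working tape
over the letters `Work`, the blank and the left marker, and a write-only one-way output tape. A
transition gives the new state, the moves of the input and the working cursor, the symbol written on
the working tape and at most one letter to append to the output; the machine halts where
there is no transition. The input cursor stays between the marker and the first blank. -/
structure Transducer (Λ₁ : Type u) (Λ₂ : Type v) where
  State : Type
  finite_state : Finite State
  Work : Type
  finite_work : Finite Work
  init : State
  δ : State → TapeSym Λ₁ → TapeSym Work → Option (State × Move × Move × TapeSym Work × Option Λ₂)
  δ_input_left : ∀ s β, ∀ t ∈ δ s TapeSym.marker β, t.2.1 ≠ Move.left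
  δ_input_right : ∀ s β, ∀ t ∈ δ s TapeSym.blank β, t.2.1 ≠ Move.right
  δ_work : ∀ s α, ∀ t ∈ δ s α TapeSym.marker, t.2.2.1 ≠ Move.left
  δ_marker : ∀ s α β, ∀ t ∈ δ s α β, (t.2.2.2.1 = TapeSym.marker ↔ β = TapeSym.marker)

namespace Transducer

variable {Λ₁ : Type u} {Λ₂ : Type v} (N : Transducer Λ₁ Λ₂)

/-- Configurations (without the input, which does not change). -/
structure Config where
  state : N.State
  work : List (TapeSym N.Work)
  output : List Λ₂
  inputPos : ℕ
  workPos : ℕ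

/-- The initial configuration. -/
def initial : N.Config where
  state := N.init
  work := [TapeSym.marker]
  output := []
  inputPos := 0
  workPos := 0

/-- One step on input `w`; `none` if the machine has halted. -/
def step (w : List Λ₁) (C : N.Config) : Option N.Config :=
  (N.δ C.state (tapeRead (inputTape w) C.inputPos) (tapeRead C.work C.workPos)).map fun t =>
    { state := t.1
      work := tapeWrite C.work C.workPos t.2.2.2.1
      output := C.output ++ t.2.2.2.2.toList
      inputPos := t.2.1.apply C.inputPos
      workPos := t.2.2.1.apply C.workPos }

/-- `C` is reached in finitely many steps on input `w`. -/
def Reaches (w : List Λ₁) (C : N.Config) : Prop :=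
  Relation.ReflTransGen (fun C₁ C₂ => N.step w C₁ = some C₂) N.initial C

end Transducer

/-- `h` is logspace computable: some deterministic machine halts on every input `w` with output
`h w`, and uses `O(log |w|)` cells of its working tape. -/
def LogspaceComputable {Λ₁ : Type u} {Λ₂ : Type v} (h : List Λ₁ → List Λ₂) : Prop :=
  ∃ N : Transducer Λ₁ Λ₂,
    (∀ w, ∃ C, N.Reaches w C ∧ N.step w C = none ∧ C.output = h w) ∧
    ∃ c : ℕ, ∀ w C, N.Reaches w C → C.work.length ≤ c * logBound w.length

/-!
The composed machine runs `M` on the output `h w` of the transducer `N` without ever storing `h w`: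
it keeps the position of the input cursor of `M`, and whenever `M` scans its input, it runs `N` from
the beginning up to the letter in question. This is deterministic and takes place in existential
states that are not labelling, so that the computations are those of `M` with paths inserted into
the edges, and these paths leave no trace in the output. A path in logarithmic space is polynomially
long, since it cannot repeat a configuration.

The working tape of the composed machine has only the letters of `Λ₁`, of which there may be just
one, whereas the tapes of `M` and `N` have alphabets of their own. Tapes are therefore kept as
numbers, whose digits are the symbols before the cursor and from the cursor on, in binary counters
that use a single letter. Labels of `M` are encoded symbol by symbol by blocks of a fixed length;
the code is injective, so that distinct outputs remain distinct. The remaining cases, where `Λ₁` is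
empty or `M` halts at once, concern constant functions.
-/

/-! ### Relabelling trees -/

namespace LTree

variable {L : Type u} {L' : Type v}

theorem nodesList_eq_flatMap (ts : List (LTree L)) : nodesList ts = ts.flatMap nodes := by
  induction ts with
  | nil => rfl
  | cons t ts ih => rw [nodesList, ih, List.flatMap_cons]

theorem leavesList_eq_flatMap (ts : List (LTree L)) : leavesList ts = ts.flatMap leaves := by
  induction ts with
  | nil => rfl
  | cons t ts ih => rw [leavesList, ih, List.flatMap_cons]

theorem nodes_node (a : L) (ts : List (LTree L)) : (node a ts).nodes = a :: ts.flatMap nodes := by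
  rw [nodes, nodesList_eq_flatMap]

theorem leaves_node (a : L) {ts : List (LTree L)} (h : ts ≠ []) :
    (node a ts).leaves = ts.flatMap leaves := by
  obtain ⟨t, ts, rfl⟩ := List.exists_cons_of_ne_nil h
  rw [leaves, leavesList_eq_flatMap, List.flatMap_cons]

theorem size_node (a : L) (ts : List (LTree L)) :
    (node a ts).size = 1 + (ts.map size).sum := by
  rw [size, nodes_node, List.length_cons, List.length_flatMap, add_comm]
  rfl

theorem root_mem_nodes : ∀ t : LTree L, t.root ∈ t.nodes
  | node _ _ => List.mem_cons_self

mutual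
/-- The tree obtained by applying `f` to all labels. -/
def map (f : L → L') : LTree L → LTree L'
  | node a ts => node (f a) (mapList f ts)
/-- The forest obtained by applying `f` to all labels. -/
def mapList (f : L → L') : List (LTree L) → List (LTree L')
  | [] => []
  | t :: ts => map f t :: mapList f ts
end

theorem mapList_eq_map (f : L → L') (ts : List (LTree L)) : mapList f ts = ts.map (map f) := by
  induction ts with
  | nil => rfl
  | cons t ts ih => rw [mapList, ih, List.map_cons]

mutual
theorem Iso.map (f : L → L') : ∀ {t u : LTree L}, Iso t u → Iso (t.map f) (u.map f)
  | _, _, .node a _ _ h => .node (f a) _ _ (h.map f)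
theorem IsoList.map (f : L → L') :
    ∀ {ts us : List (LTree L)}, IsoList ts us → IsoList (mapList f ts) (mapList f us)
  | _, _, .nil => .nil
  | _, _, .cons _ _ _ _ h hs => .cons _ _ _ _ (h.map f) (hs.map f)
  | _, _, .swap _ _ _ => .swap _ _ _
  | _, _, .trans _ _ _ h k => .trans _ _ _ (h.map f) (k.map f)
end

mutual
theorem leftInverse_map {f : L → L'} {g : L' → L} (h : Function.LeftInverse g f) :
    ∀ t : LTree L, (t.map f).map g = t
  | .node a ts => by rw [map, map, h a, leftInverse_mapList h ts]
theorem leftInverse_mapList {f : L → L'} {g : L' → L} (h : Function.LeftInverse g f) :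
    ∀ ts : List (LTree L), mapList g (mapList f ts) = ts
  | [] => rfl
  | t :: ts => by rw [mapList, mapList, leftInverse_map h t, leftInverse_mapList h ts]
end

mutual
theorem Iso.nodes_perm : ∀ {t u : LTree L}, Iso t u → t.nodes.Perm u.nodes
  | _, _, .node a _ _ h => h.nodes_perm.cons a
theorem IsoList.nodes_perm :
    ∀ {ts us : List (LTree L)}, IsoList ts us → (nodesList ts).Perm (nodesList us)
  | _, _, .nil => .refl _
  | _, _, .cons _ _ _ _ h hs => h.nodes_perm.append hs.nodes_perm
  | _, _, .swap t u ts => by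
    simp only [nodesList, ← List.append_assoc]
    exact List.perm_append_comm.append_right _
  | _, _, .trans _ _ _ h k => h.nodes_perm.trans k.nodes_perm
end

end LTree

namespace UTree

variable {L : Type u} {L' : Type v}

/-- The isomorphism class obtained by applying `f` to all labels. -/
def map (f : L → L') : UTree L → UTree L' :=
  Quotient.map' (LTree.map f) fun _ _ h => LTree.Iso.map f h

theorem map_injective {f : L → L'} (hf : Function.Injective f) : Function.Injective (map f) := by
  rintro ⟨t⟩ ⟨u⟩ h
  have : Nonempty L := ⟨t.root⟩
  have h_iso : ((t.map f).map (Function.invFun f)).Iso ((u.map f).map (Function.invFun f)) :=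
    (Quotient.exact h : LTree.Iso (t.map f) (u.map f)).map _
  rw [LTree.leftInverse_map (Function.leftInverse_invFun hf),
    LTree.leftInverse_map (Function.leftInverse_invFun hf)] at h_iso
  exact Quotient.sound h_iso

end UTree

/-! ### Constant functions -/

namespace ATO

variable {Λ : Type u} (M : ATO Λ)

theorem outputForestList_eq_flatMap (ts : List (LTree M.Config)) :
    M.outputForestList ts = ts.flatMap M.outputForest := by
  induction ts with
  | nil => rfl
  | cons t ts ih => rw [outputForestList, ih, List.flatMap_cons]

variable {M}

theorem outputForest_of_labeling {C : M.Config} (h : C.state ∈ M.labeling)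
    (ts : List (LTree M.Config)) :
    M.outputForest (.node C ts) = [.node C.label (ts.flatMap M.outputForest)] := by
  rw [outputForest, if_pos h, outputForestList_eq_flatMap]

theorem outputForest_of_not_labeling {C : M.Config} (h : C.state ∉ M.labeling)
    (ts : List (LTree M.Config)) :
    M.outputForest (.node C ts) = ts.flatMap M.outputForest := by
  rw [outputForest, if_neg h, outputForestList_eq_flatMap]

theorem mem_existential_or_universal_iff {s : M.State} :
    s ∈ M.existential ∨ s ∈ M.universal ↔ s ≠ M.accept ∧ s ≠ M.reject := by
  rw [← Set.mem_union, M.partition]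
  simp

theorem not_halting_of_existential {s : M.State} (h : s ∈ M.existential) :
    ¬(s = M.accept ∨ s = M.reject) :=
  not_or.2 (mem_existential_or_universal_iff.1 (.inl h))

theorem not_halting_of_universal {s : M.State} (h : s ∈ M.universal) :
    ¬(s = M.accept ∨ s = M.reject) :=
  not_or.2 (mem_existential_or_universal_iff.1 (.inr h))

/-- The `i`-th transition of the machine `chooser` below: halt, and output `i` blanks. -/
def chooserTransition (β : TapeSym Λ) : ℕ ↪ Bool × Move × Move × TapeSym Λ × List (TapeSym Λ) where
  toFun i := (true, .stay, .stay, β, List.replicate i .blank)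
  inj' i j h := by simpa using h

@[simp]
theorem chooserTransition_apply (β : TapeSym Λ) (i : ℕ) :
    chooserTransition β i = (true, .stay, .stay, β, List.replicate i .blank) := rfl

theorem exists_eq_chooserTransition {β : TapeSym Λ} {m : ℕ} {b : Bool}
    {t : Bool × Move × Move × TapeSym Λ × List (TapeSym Λ)}
    (h : t ∈ if b then ∅ else (Finset.range m).map (chooserTransition β)) :
    ∃ i, chooserTransition β i = t := by
  cases b
  · obtain ⟨i, -, hi⟩ := Finset.mem_map.1 h
    exact ⟨i, hi⟩
  · simp at h

/-- The machine that chooses one of `m` labels in a single existential step: it has exactly `m`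
valid outputs on every input. -/
noncomputable def chooser (Λ : Type u) (m : ℕ) : ATO Λ where
  State := Bool
  finite_state := inferInstance
  init := false
  accept := true
  reject := true
  existential := {false}
  universal := ∅
  labeling := Set.univ
  disjoint := by simp
  partition := by ext b; cases b <;> simp
  init_labeling := trivial
  δ s _ β := if s then ∅ else (Finset.range m).map (chooserTransition β)
  δ_accept := by simp
  δ_reject := by simp
  δ_input _ _ _ h := by obtain ⟨i, rfl⟩ := exists_eq_chooserTransition h; simp
  δ_work _ _ _ h := by obtain ⟨i, rfl⟩ := exists_eq_chooserTransition h; simp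
  δ_marker _ _ _ _ h := by
    obtain ⟨i, rfl⟩ := exists_eq_chooserTransition h; simp

section Chooser

variable (m : ℕ) (w : List Λ)

/-- The configuration of `chooser` after choosing the `i`-th label. -/
noncomputable def chosen (i : ℕ) : (chooser Λ m).Config :=
  (chooser Λ m).move ((chooser Λ m).initial w) (chooserTransition .marker i)

/-- The computation of `chooser` that chooses the `i`-th label. -/
noncomputable def chooserTree (i : ℕ) : LTree (chooser Λ m).Config :=
  .node ((chooser Λ m).initial w) [.node (chosen m w i) []]

theorem mem_next_initial_chooser {C : (chooser Λ m).Config} :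
    C ∈ (chooser Λ m).next ((chooser Λ m).initial w) ↔ ∃ i < m, C = chosen m w i := by
  constructor
  · rintro ⟨t, ht, rfl⟩
    obtain ⟨i, hi, rfl⟩ := Finset.mem_map.1 ht
    exact ⟨i, Finset.mem_range.1 hi, rfl⟩
  · rintro ⟨i, hi, rfl⟩
    exact ⟨_, Finset.mem_map_of_mem _ (Finset.mem_range.2 hi), rfl⟩

theorem isComputation_chooser_iff {T : LTree (chooser Λ m).Config} :
    (chooser Λ m).IsComputation w T ↔ ∃ i < m, T = chooserTree m w i := by
  constructor
  · rintro ⟨hroot, hrun⟩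
    cases hrun with
    | halt C h =>
      obtain rfl : C = _ := hroot
      simp [chooser, initial] at h
    | universal C ts h => exact h.elim
    | existential C t _ ht hrun =>
      obtain rfl : C = _ := hroot
      obtain ⟨i, hi, hchild⟩ := (mem_next_initial_chooser m w).1 ht
      refine ⟨i, hi, ?_⟩
      cases hrun with
      | halt C' => rw [chooserTree, ← hchild]; rfl
      | universal C' ts h => exact h.elim
      | existential C' t h =>
        obtain rfl : C' = _ := hchild
        exact Bool.noConfusion (show true = false from h)
  · rintro ⟨i, hi, rfl⟩
    exact ⟨rfl, .existential _ _ rfl ((mem_next_initial_chooser m w).2 ⟨i, hi, rfl⟩)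
      (.halt _ (.inl rfl))⟩

theorem outputForest_chooserTree (i : ℕ) :
    (chooser Λ m).outputForest (chooserTree m w i) =
      [.node [] [.node (List.replicate i .blank) []]] := by
  have hlab (s : (chooser Λ m).State) : s ∈ (chooser Λ m).labeling := trivial
  rw [chooserTree, outputForest_of_labeling (hlab _), List.flatMap_cons,
    outputForest_of_labeling (hlab _)]
  simp [chosen, move, hlab, initial]

theorem validOutputs_chooser :
    (chooser Λ m).validOutputs w = (fun i : ℕ => (LTree.node ([] : List (TapeSym Λ))
      [LTree.node (List.replicate i TapeSym.blank) []]).toUTree) '' (Finset.range m : Set ℕ) := by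
  ext O
  constructor
  · rintro ⟨T, hT, -, O', hO', rfl⟩
    obtain ⟨i, hi, rfl⟩ := (isComputation_chooser_iff m w).1 hT
    rw [outputForest_chooserTree, List.singleton_inj] at hO'
    exact ⟨i, by simpa using hi, by rw [← hO']⟩
  · rintro ⟨i, hi, rfl⟩
    refine ⟨_, (isComputation_chooser_iff m w).2 ⟨i, by simpa using hi, rfl⟩, ?_, _,
      outputForest_chooserTree m w i, rfl⟩
    intro C hC
    obtain rfl : C = chosen m w i := by
      simpa [chooserTree, LTree.leaves, LTree.leavesList] using hC
    rfl

theorem span_chooser : (chooser Λ m).span w = m := by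
  rw [span, validOutputs_chooser, Function.Injective.encard_image,
    Set.encard_coe_eq_coe_finsetCard, Finset.card_range]
  intro i j h
  simpa [LTree.nodes, LTree.nodesList] using (Quotient.exact h : LTree.Iso _ _).nodes_perm

end Chooser

theorem wellBehaved_chooser (m : ℕ) : (chooser Λ m).WellBehaved := by
  refine ⟨1, m + 2, 0, fun w T hT => ?_⟩
  obtain ⟨i, hi, rfl⟩ := (isComputation_chooser_iff m w).1 hT
  refine ⟨?_, fun C hC => ?_, fun p _ _ => ?_⟩
  · simp [chooserTree, LTree.size, LTree.nodes, LTree.nodesList]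
  · have hle : m + 2 ≤ (m + 2) * logBound w.length := Nat.le_mul_of_pos_right _ (by simp [logBound])
    have hlab (s : (chooser Λ m).State) : s ∈ (chooser Λ m).labeling := trivial
    simp only [chooserTree, LTree.nodes, LTree.nodesList, List.append_nil, List.mem_cons,
      List.not_mem_nil, or_false] at hC
    rcases hC with rfl | rfl
    · simp only [initial, List.length_cons, List.length_nil]
      lia
    · simp only [chosen, move, hlab, if_true, chooserTransition_apply, initial, tapeWrite,
        List.length_set, List.length_append, List.length_replicate,
        List.length_cons, List.length_nil]
      lia
  · refine (List.countP_eq_zero.2 fun C _ h => ?_).le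
    exact (@of_decide_eq_true _ (_) h : C.state ∈ (chooser Λ m).universal)

end ATO

theorem const_mem_SpanTL {Λ : Type u} (m : ℕ) : (fun _ => m) ∈ SpanTL Λ :=
  ⟨ATO.chooser Λ m, ATO.wellBehaved_chooser m, ATO.span_chooser m⟩

/-! ### Deterministic programs on one working tape -/

theorem tapeRead_inputTape_zero {Λ : Type u} (w : List Λ) :
    tapeRead (inputTape w) 0 = .marker := rfl

theorem tapeRead_inputTape_succ {Λ : Type u} (w : List Λ) (i : ℕ) :
    tapeRead (inputTape w) (i + 1) = (w[i]?.map TapeSym.letter).getD .blank := by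
  simp [tapeRead, inputTape]

theorem tapeRead_inputTape_eq_marker_iff {Λ : Type u} {w : List Λ} {i : ℕ} :
    tapeRead (inputTape w) i = .marker ↔ i = 0 := by
  cases i with
  | zero => simp [tapeRead_inputTape_zero]
  | succ i => rw [tapeRead_inputTape_succ]; cases w[i]? <;> simp

theorem tapeRead_inputTape_eq_blank_iff {Λ : Type u} {w : List Λ} {i : ℕ} :
    tapeRead (inputTape w) i = .blank ↔ w.length < i := by
  cases i with
  | zero => simp [tapeRead_inputTape_zero]
  | succ i =>
    rw [tapeRead_inputTape_succ, Nat.lt_succ_iff, ← List.getElem?_eq_none_iff]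
    cases w[i]? <;> simp

/-- The cursor moves and the written symbol in `r` are permitted when `α` and `β` are scanned on
the input and the working tape. Besides the restrictions on the marker, the input cursor may not
move right of the first blank, so that it takes only `|w| + 2` positions. -/
def LegalAction {Λ : Type u} (α β : TapeSym Λ) (r : Move × Move × TapeSym Λ) : Prop :=
  (α = .marker → r.1 ≠ .left) ∧ (α = .blank → r.1 ≠ .right) ∧ (β = .marker → r.2.1 ≠ .left) ∧
    (r.2.2 = .marker ↔ β = .marker)

theorem legalAction_stay {Λ : Type u} (α β : TapeSym Λ) :
    LegalAction α β (.stay, .stay, β) := by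
  simp [LegalAction]

/-- A deterministic program with a finite control set `Loc`. A step reads the scanned symbols of
the input and the working tape, and either goes to another control location or exits with a value
in `ε`. -/
structure Prog (Λ : Type u) (ε : Type) where
  Loc : Type
  finite_loc : Finite Loc
  entry : Loc
  step : Loc → TapeSym Λ → TapeSym Λ → (Loc ⊕ ε) × Move × Move × TapeSym Λ
  legal : ∀ l α β, LegalAction α β (step l α β).2

/-- The memory of a program: the contents of the working tape, and the positions of the input and
the working cursor. -/
structure Mem (Λ : Type u) where
  tape : ℕ → TapeSym Λ
  inputPos : ℕ
  workPos : ℕ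

/-- The memory after writing `r.2.2` and moving the cursors by `r.1` and `r.2.1`. -/
def Mem.update {Λ : Type u} (m : Mem Λ) (r : Move × Move × TapeSym Λ) : Mem Λ where
  tape := Function.update m.tape m.workPos r.2.2
  inputPos := r.1.apply m.inputPos
  workPos := r.2.1.apply m.workPos

namespace Prog

variable {Λ : Type u} {ε δ : Type}

open Classical in
/-- The program with a single step; an illegal action is replaced by doing nothing. -/
noncomputable def act (f : TapeSym Λ → TapeSym Λ → ε × Move × Move × TapeSym Λ) : Prog Λ ε where
  Loc := Unit
  finite_loc := inferInstance
  entry := ()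
  step _ α β := (.inr (f α β).1,
    if LegalAction α β (f α β).2 then (f α β).2 else (.stay, .stay, β))
  legal _ α β := by
    dsimp only
    split_ifs with h
    exacts [h, legalAction_stay α β]

/-- Sequential composition: `p`, followed by `f e` if `p` exits with the value `e`. -/
def bind [Finite ε] (p : Prog Λ ε) (f : ε → Prog Λ δ) : Prog Λ δ where
  Loc := p.Loc ⊕ (Σ e, (f e).Loc)
  finite_loc := by
    have := p.finite_loc
    have := fun e => (f e).finite_loc
    infer_instance
  entry := .inl p.entry
  step
    | .inl l, α, β => ((p.step l α β).1.elim (fun l' => .inl (.inl l'))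
        (fun e => .inl (.inr ⟨e, (f e).entry⟩)), (p.step l α β).2)
    | .inr ⟨e, l⟩, α, β => (((f e).step l α β).1.elim (fun l' => .inl (.inr ⟨e, l'⟩)) .inr,
        ((f e).step l α β).2)
  legal
    | .inl l => p.legal l
    | .inr ⟨e, l⟩ => (f e).legal l

/-- Iteration: `body e` is repeated with a new value of `e` as long as it exits on the left. -/
def iter [Finite ε] (body : ε → Prog Λ (ε ⊕ δ)) (e₀ : ε) : Prog Λ δ where
  Loc := Σ e, (body e).Loc
  finite_loc := by
    have := fun e => (body e).finite_loc
    infer_instance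
  entry := ⟨e₀, (body e₀).entry⟩
  step := fun ⟨e, l⟩ α β => (((body e).step l α β).1.elim (fun l' => .inl ⟨e, l'⟩)
    (fun r => r.elim (fun e' => .inl ⟨e', (body e').entry⟩) .inr), ((body e).step l α β).2)
  legal := fun ⟨e, l⟩ => (body e).legal l

/-- One step on input `w`, from a memory whose working cursor is at most at position `S`. -/
def Step (w : List Λ) (S : ℕ) (p : Prog Λ ε) (a b : (p.Loc ⊕ ε) × Mem Λ) : Prop :=
  a.2.workPos ≤ S ∧ ∃ l, a.1 = .inl l ∧
    b = ((p.step l (tapeRead (inputTape w) a.2.inputPos) (a.2.tape a.2.workPos)).1,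
      a.2.update (p.step l (tapeRead (inputTape w) a.2.inputPos) (a.2.tape a.2.workPos)).2)

/-- Started with memory `m` on input `w`, the program exits with value `e` and memory `m'`; before
that the working cursor is at most at position `S`. -/
def Exec (w : List Λ) (S : ℕ) (p : Prog Λ ε) (m : Mem Λ) (e : ε) (m' : Mem Λ) : Prop :=
  Relation.ReflTransGen (Step w S p) (.inl p.entry, m) (.inr e, m')

variable {w : List Λ} {S : ℕ} {m m' m'' : Mem Λ} {e e' : ε} {d : δ}

theorem Exec.bind [Finite ε] {p : Prog Λ ε} {f : ε → Prog Λ δ}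
    (hp : Exec w S p m e m') (hf : Exec w S (f e) m' d m'') : Exec w S (p.bind f) m d m'' := by
  have hp' := hp.lift (p := Step w S (p.bind f))
    (fun a => (a.1.elim (fun l' => .inl (.inl l'))
        (fun e => .inl (.inr ⟨e, (f e).entry⟩)), a.2)) (by
      rintro ⟨_, ma⟩ b ⟨hS, l, rfl, rfl⟩
      exact ⟨hS, .inl l, rfl, rfl⟩)
  have hf' := hf.lift (p := Step w S (p.bind f))
    (fun a => (a.1.elim (fun l' => .inl (.inr ⟨e, l'⟩)) .inr, a.2)) (by
      rintro ⟨_, ma⟩ b ⟨hS, l, rfl, rfl⟩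
      exact ⟨hS, .inr ⟨e, l⟩, rfl, rfl⟩)
  exact hp'.trans hf'

section Iter

variable [Finite ε] {body : ε → Prog Λ (ε ⊕ δ)}

theorem Exec.reflTransGen_iter (e₀ : ε) {r : ε ⊕ δ} (h : Exec w S (body e) m r m') :
    Relation.ReflTransGen (Step w S (iter body e₀)) (.inl ⟨e, (body e).entry⟩, m)
      (r.elim (fun e' => .inl ⟨e', (body e').entry⟩) .inr, m') :=
  h.lift (p := Step w S (iter body e₀))
    (fun a => (a.1.elim (fun l' => .inl ⟨e, l'⟩)
      (fun r => r.elim (fun e' => .inl ⟨e', (body e').entry⟩) .inr), a.2)) (by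
        rintro ⟨_, ma⟩ b ⟨hS, l, rfl, rfl⟩
        exact ⟨hS, ⟨e, l⟩, rfl, rfl⟩)

theorem Exec.iter_exit (h : Exec w S (body e) m (.inr d) m') : Exec w S (iter body e) m d m' :=
  h.reflTransGen_iter e

theorem Exec.iter_next (h : Exec w S (body e) m (.inl e') m')
    (h' : Exec w S (iter body e') m' d m'') : Exec w S (iter body e) m d m'' :=
  (h.reflTransGen_iter e).trans h'

end Iter

section Act

variable {f : TapeSym Λ → TapeSym Λ → ε × Move × Move × TapeSym Λ}

theorem exec_act {r : Move × Move × TapeSym Λ} (hS : m.workPos ≤ S)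
    (hf : f (tapeRead (inputTape w) m.inputPos) (m.tape m.workPos) = (e, r))
    (hr : LegalAction (tapeRead (inputTape w) m.inputPos) (m.tape m.workPos) r) :
    Exec w S (act f) m e (m.update r) := by
  refine .single ⟨hS, (), rfl, ?_⟩
  simp only [act]
  rw [hf, if_pos hr]

theorem exec_act_of_scan (d d' : Move) (hS : m.workPos ≤ S)
    (hf : f (tapeRead (inputTape w) m.inputPos) (m.tape m.workPos) =
      (e, d, d', m.tape m.workPos))
    (hleft : m.inputPos = 0 → d ≠ .left) (hright : w.length < m.inputPos → d ≠ .right)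
    (hwork : m.tape m.workPos = .marker → d' ≠ .left) :
    Exec w S (act f) m e ⟨m.tape, d.apply m.inputPos, d'.apply m.workPos⟩ := by
  have := exec_act hS hf ⟨fun h => hleft (tapeRead_inputTape_eq_marker_iff.1 h),
    fun h => hright (tapeRead_inputTape_eq_blank_iff.1 h), hwork, Iff.rfl⟩
  rwa [Mem.update, Function.update_eq_self] at this

end Act

/-- The program that exits with value `e`, in one step that changes nothing. -/
noncomputable def ret (e : ε) : Prog Λ ε := act fun _ β => (e, .stay, .stay, β)

theorem exec_ret (hS : m.workPos ≤ S) : Exec w S (ret e) m e m :=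
  exec_act_of_scan .stay .stay hS rfl nofun nofun nofun

/-- Move the working cursor `n` cells to the right. -/
noncomputable def right : ℕ → Prog Λ Unit
  | 0 => ret ()
  | n + 1 => bind (act fun _ β => ((), .stay, .right, β)) fun _ => right n

theorem exec_right (n : ℕ) {t : ℕ → TapeSym Λ} {i j : ℕ} (hS : j + n ≤ S) :
    Exec w S (right n) ⟨t, i, j⟩ () ⟨t, i, j + n⟩ := by
  induction n generalizing j with
  | zero => exact exec_ret hS
  | succ n ih =>
    refine (exec_act_of_scan .stay .right (Nat.le_of_add_right_le hS) rfl nofun nofun nofun).bind ?_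
    rw [← Nat.add_assoc, Nat.add_right_comm]
    exact ih (j := j + 1) (by lia)

/-- Move the working cursor `n` cells to the left. -/
noncomputable def left : ℕ → Prog Λ Unit
  | 0 => ret ()
  | n + 1 => bind (act fun _ β => ((), .stay, .left, β)) fun _ => left n

theorem exec_left (n : ℕ) {t : ℕ → TapeSym Λ} {i j : ℕ} (hS : j + n ≤ S)
    (ht : ∀ j, t j = .marker ↔ j = 0) :
    Exec w S (left n) ⟨t, i, j + n⟩ () ⟨t, i, j⟩ := by
  induction n generalizing j with
  | zero => exact exec_ret hS
  | succ n ih =>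
    exact (exec_act_of_scan .stay .left hS rfl nofun nofun (by simp [ht])).bind (ih (by lia))

open Classical in
/-- Move the working cursor back to the marker. -/
noncomputable def rewind : Prog Λ Unit :=
  iter (fun _ : Unit => act fun _ β =>
    if β = .marker then (.inr (), .stay, .stay, β) else (.inl (), .stay, .left, β)) ()

theorem exec_rewind {t : ℕ → TapeSym Λ} {i j : ℕ} (hS : j ≤ S)
    (ht : ∀ j, t j = .marker ↔ j = 0) : Exec w S rewind ⟨t, i, j⟩ () ⟨t, i, 0⟩ := by
  induction j with
  | zero =>
    exact .iter_exit (exec_act_of_scan .stay .stay hS (if_pos ((ht 0).2 rfl)) nofun nofun nofun)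
  | succ j ih =>
    refine .iter_next (exec_act_of_scan .stay .left hS (if_neg ?_) nofun nofun ?_) (ih (by lia)) <;>
      simp [ht]

open Classical in
/-- Move the input cursor back to the marker. -/
noncomputable def rewindInput : Prog Λ Unit :=
  iter (fun _ : Unit => act fun α β =>
    if α = .marker then (.inr (), .stay, .stay, β) else (.inl (), .left, .stay, β)) ()

theorem exec_rewindInput {t : ℕ → TapeSym Λ} {i j : ℕ} (hS : j ≤ S) :
    Exec w S rewindInput ⟨t, i, j⟩ () ⟨t, 0, j⟩ := by
  induction i with
  | zero => exact .iter_exit (exec_act_of_scan .stay .stay hS (if_pos rfl) nofun nofun nofun)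
  | succ i ih =>
    refine .iter_next (exec_act_of_scan .left .stay hS (if_neg ?_) ?_ nofun nofun) ih
    · simp [tapeRead_inputTape_eq_marker_iff]
    · nofun

/-- Exit with the value of `f` at the scanned input symbol. -/
noncomputable def readInput (f : TapeSym Λ → ε) : Prog Λ ε :=
  act fun α β => (f α, .stay, .stay, β)

theorem exec_readInput {f : TapeSym Λ → ε} (hS : m.workPos ≤ S) :
    Exec w S (readInput f) m (f (tapeRead (inputTape w) m.inputPos)) m :=
  exec_act_of_scan .stay .stay hS rfl nofun nofun nofun

/-- Move the input cursor. -/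
noncomputable def moveInput (d : Move) : Prog Λ Unit :=
  act fun _ β => ((), d, .stay, β)

theorem exec_moveInput {d : Move} (hS : m.workPos ≤ S) (hleft : m.inputPos = 0 → d ≠ .left)
    (hright : w.length < m.inputPos → d ≠ .right) :
    Exec w S (moveInput d) m () ⟨m.tape, d.apply m.inputPos, m.workPos⟩ :=
  exec_act_of_scan d .stay hS rfl hleft hright nofun

end Prog

/-! ### Binary counters -/

theorem exists_succ_eq_xor (x : ℕ) :
    ∃ j, (∀ i < j, x.testBit i = true) ∧ x.testBit j = false ∧ x + 1 = x ^^^ (2 ^ (j + 1) - 1) := by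
  induction x using Nat.binaryRec with
  | zero => exact ⟨0, by simp⟩
  | bit b x ih =>
    cases b with
    | false => exact ⟨0, by simp, by simp, by simp⟩
    | true =>
      obtain ⟨j, hlow, hj, hx⟩ := ih
      refine ⟨j + 1, fun i hi => ?_, by rwa [Nat.testBit_bit_succ], ?_⟩
      · cases i with
        | zero => simp
        | succ i => rw [Nat.testBit_bit_succ, hlow i (by lia)]
      · have h : 2 ^ (j + 1 + 1) - 1 = Nat.bit true (2 ^ (j + 1) - 1) := by
          have := Nat.one_le_two_pow (n := j + 1)
          simp only [Nat.bit_true]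
          lia
        rw [h, Nat.xor_bit, ← hx]
        simp only [Nat.bit_true, bne_self_eq_false, Nat.bit_false]
        lia

/-- The symbol that stores a bit; the letter `a` stands for `1`, and the blank for `0`. -/
def bitSym {Λ : Type u} (a : Λ) (b : Bool) : TapeSym Λ := bif b then .letter a else .blank

/-- The tape that stores `T` numbers in binary on interleaved tracks: bit `j` of the number `v r`
is in cell `T * j + r + 1`. -/
def tracks {Λ : Type u} (a : Λ) {T : ℕ} [NeZero T] (v : Fin T → ℕ) : ℕ → TapeSym Λ
  | 0 => .marker
  | i + 1 => bitSym a ((v (Fin.ofNat T i)).testBit (i / T))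

section Tracks

variable {Λ : Type u} {a : Λ} {T : ℕ} [NeZero T] {v : Fin T → ℕ}

theorem bitSym_ne_marker (b : Bool) : bitSym a b ≠ .marker := by cases b <;> nofun

theorem bitSym_eq_letter_iff {b : Bool} : bitSym a b = .letter a ↔ b = true := by
  cases b <;> simp [bitSym]

theorem tracks_eq_marker_iff (i : ℕ) : tracks a v i = .marker ↔ i = 0 := by
  cases i with
  | zero => simp [tracks]
  | succ i => simp [tracks, bitSym_ne_marker]

theorem tracks_cell (j : ℕ) (r : Fin T) :
    tracks a v (T * j + r + 1) = bitSym a ((v r).testBit j) := by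
  have hr : Fin.ofNat T (T * j + r) = r := by
    ext
    simp [Fin.ofNat, Nat.mod_eq_of_lt r.isLt]
  have hj : (T * j + r) / T = j := by
    rw [Nat.mul_add_div (Nat.pos_of_neZero T), Nat.div_eq_of_lt r.isLt, Nat.add_zero]
  rw [tracks, hr, hj]

theorem tracks_update {r : Fin T} {j x : ℕ} {b : Bool}
    (hx : ∀ i, x.testBit i = if i = j then b else (v r).testBit i) :
    tracks a (Function.update v r x) =
      Function.update (tracks a v) (T * j + r + 1) (bitSym a b) := by
  funext c
  cases c with
  | zero => rw [Function.update_of_ne (by lia), tracks, tracks]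
  | succ i =>
    obtain ⟨k, s, rfl⟩ : ∃ (k : ℕ) (s : Fin T), T * k + s = i :=
      ⟨i / T, Fin.ofNat T i, Nat.div_add_mod i T⟩
    by_cases hs : s = r
    · subst hs
      by_cases hk : k = j
      · subst hk
        rw [Function.update_self, tracks_cell, Function.update_self, hx, if_pos rfl]
      · have : T * k ≠ T * j := fun h => hk (Nat.eq_of_mul_eq_mul_left (Nat.pos_of_neZero T) h)
        rw [Function.update_of_ne (by lia), tracks_cell, tracks_cell, Function.update_self, hx,
          if_neg hk]
    · have : T * k + s ≠ T * j + r := by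
        intro h
        have := congrArg (· % T) h
        simp only [Nat.mul_add_mod, Nat.mod_eq_of_lt s.isLt, Nat.mod_eq_of_lt r.isLt] at this
        exact hs (Fin.ext this)
      rw [Function.update_of_ne (by lia), tracks_cell, tracks_cell, Function.update_of_ne hs]

end Tracks

namespace Prog

variable {Λ : Type u} {a : Λ} {w : List Λ} {S i : ℕ}

section Bits

variable {T : ℕ} [NeZero T] {v : Fin T → ℕ} {r : Fin T} {j x : ℕ}

open Classical in
/-- Apply `f` to the scanned bit, and exit with the old bit. -/
noncomputable def modifyBit (a : Λ) (f : Bool → Bool) : Prog Λ Bool :=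
  act fun _ β => (decide (β = .letter a), .stay, .stay, bitSym a (f (decide (β = .letter a))))

theorem exec_modifyBit {f : Bool → Bool} (hS : T * j + r + 1 ≤ S)
    (hx : ∀ i, x.testBit i = if i = j then f ((v r).testBit j) else (v r).testBit i) :
    Exec w S (modifyBit a f) ⟨tracks a v, i, T * j + r + 1⟩ ((v r).testBit j)
      ⟨tracks a (Function.update v r x), i, T * j + r + 1⟩ := by
  rw [tracks_update hx]
  refine exec_act (r := (.stay, .stay, bitSym a (f ((v r).testBit j)))) hS ?_ ?_
  · simp [tracks_cell, bitSym_eq_letter_iff]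
  · simp [LegalAction, tracks_cell, bitSym_ne_marker]

theorem exec_modifyBit_id (hS : T * j + r + 1 ≤ S) :
    Exec w S (modifyBit a id) ⟨tracks a v, i, T * j + r + 1⟩ ((v r).testBit j)
      ⟨tracks a v, i, T * j + r + 1⟩ := by
  have := exec_modifyBit (w := w) (a := a) (v := v) (i := i) (f := id) (x := v r) hS (by grind)
  rwa [Function.update_eq_self] at this

/-- Flip the bits of one of `T` tracks, from the scanned cell up to and including the first bit
that differs from `c`. -/
noncomputable def carry (a : Λ) (T : ℕ) (c : Bool) : Prog Λ Unit :=
  iter (fun _ : Unit => bind (modifyBit a not) fun b =>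
    if b = c then bind (right T) fun _ => ret (.inl ()) else ret (.inr ())) ()

theorem exec_carry {c : Bool} (hS : T * j + r + 1 ≤ S) (hlow : ∀ i < j, (v r).testBit i = c)
    (hj : (v r).testBit j = !c) :
    Exec w S (carry a T c) ⟨tracks a v, i, r + 1⟩ ()
      ⟨tracks a (Function.update v r (v r ^^^ (2 ^ (j + 1) - 1))), i, T * j + r + 1⟩ := by
  have flip (k : ℕ) (hk : T * k + r + 1 ≤ S) := exec_modifyBit (w := w) (a := a) (i := i)
    (v := Function.update v r (v r ^^^ (2 ^ k - 1))) (x := v r ^^^ (2 ^ (k + 1) - 1)) (f := not) hk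
    (by grind [Function.update_self, Nat.testBit_two_pow_sub_one])
  have flip_spec (k : ℕ) : (Function.update v r (v r ^^^ (2 ^ k - 1)) r).testBit k =
      (v r).testBit k := by
    simp [Nat.testBit_two_pow_sub_one]
  simp only [Function.update_idem, flip_spec] at flip
  have from_bit (n k : ℕ) (hk : k + n = j) :
      Exec w S (carry a T c)
        ⟨tracks a (Function.update v r (v r ^^^ (2 ^ k - 1))), i, T * k + r + 1⟩ ()
        ⟨tracks a (Function.update v r (v r ^^^ (2 ^ (j + 1) - 1))), i, T * j + r + 1⟩ := by
    induction n generalizing k with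
    | zero =>
      obtain rfl : k = j := hk
      refine .iter_exit ((flip k hS).bind ?_)
      rw [if_neg (hj ▸ Bool.not_ne_self c)]
      exact exec_ret hS
    | succ n ih =>
      have hkj : T * (k + 1) ≤ T * j := Nat.mul_le_mul_left T (by lia)
      rw [Nat.mul_add_one] at hkj
      refine .iter_next ((flip k (by lia)).bind ?_) (ih (k + 1) (by lia))
      rw [if_pos (hlow k (by lia)),
        show T * (k + 1) + r + 1 = T * k + r + 1 + T by rw [Nat.mul_add_one]; lia]
      exact (exec_right T (by lia)).bind (exec_ret (m := ⟨_, _, _⟩) (by lia))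
  simpa using from_bit j 0 (Nat.zero_add j)

end Bits

/-- The tape that stores the numbers `v r` on the tracks `r + 1`; track `0` contains `m` ones, where
`m` exceeds the position of every nonzero bit, so that a program can find the end of the tracks. -/
def counterTape (a : Λ) {K : ℕ} (m : ℕ) (v : Fin K → ℕ) : ℕ → TapeSym Λ :=
  tracks a (Fin.cons (α := fun _ => ℕ) (2 ^ m - 1) v)

section Counters

variable {K : ℕ} {v v' v'' : Fin K → ℕ} {m β j : ℕ}

theorem counterTape_zero : counterTape a 0 (0 : Fin K → ℕ) = tapeRead [.marker] := by
  have hzero : (Fin.cons (α := fun _ => ℕ) (2 ^ 0 - 1) (0 : Fin K → ℕ)) = 0 := by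
    ext r
    cases r using Fin.cases <;> rfl
  rw [counterTape, hzero]
  ext (_ | i)
  · rfl
  · simp [tracks, bitSym, tapeRead]

theorem exec_rewind_counterTape (hS : j ≤ S) :
    Exec w S rewind ⟨counterTape a m v, i, j⟩ () ⟨counterTape a m v, i, 0⟩ :=
  exec_rewind hS tracks_eq_marker_iff

theorem exec_carry_counterTape {r : Fin K} {c : Bool} (hS : (K + 1) * j + (r + 1) + 1 ≤ S)
    (hlow : ∀ i < j, (v r).testBit i = c) (hj : (v r).testBit j = !c) :
    Exec w S (bind (right (r + 2)) fun _ => carry a (K + 1) c) ⟨counterTape a m v, i, 0⟩ ()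
      ⟨counterTape a m (Function.update v r (v r ^^^ (2 ^ (j + 1) - 1))), i,
        (K + 1) * j + (r + 1) + 1⟩ := by
  simp only [counterTape, Fin.cons_update]
  refine (exec_right _ (by lia)).bind ?_
  rw [Nat.zero_add]
  exact exec_carry (r := r.succ) (v := Fin.cons (α := fun _ => ℕ) (2 ^ m - 1) v) hS hlow hj

theorem exec_setBit_counterTape (hS : (K + 1) * j + 1 ≤ S) (hj : j ≤ m) :
    ∃ b, Exec w S (modifyBit a fun _ => true) ⟨counterTape a m v, i, (K + 1) * j + 1⟩ b
      ⟨counterTape a (max m (j + 1)) v, i, (K + 1) * j + 1⟩ := by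
  have hv : counterTape a (max m (j + 1)) v =
      tracks a (Function.update (Fin.cons (2 ^ m - 1) v) 0 (2 ^ max m (j + 1) - 1)) := by
    rw [Fin.update_cons_zero, counterTape]
  rw [hv]
  refine ⟨_, exec_modifyBit (r := 0) hS fun i => ?_⟩
  simp only [Fin.cons_zero, Nat.testBit_two_pow_sub_one]
  grind

theorem exec_readMask_counterTape (hS : (K + 1) * j + 1 ≤ S) :
    Exec w S (modifyBit a id) ⟨counterTape a m v, i, (K + 1) * j + 1⟩ (decide (j < m))
      ⟨counterTape a m v, i, (K + 1) * j + 1⟩ := by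
  have := exec_modifyBit_id (w := w) (a := a) (i := i) (r := 0)
    (v := Fin.cons (α := fun _ => ℕ) (2 ^ m - 1) v) hS
  rwa [Fin.cons_zero, Nat.testBit_two_pow_sub_one] at this

theorem exec_readBit_counterTape {r : Fin K} (hS : (K + 1) * j + (r + 1) + 1 ≤ S) :
    Exec w S (modifyBit a id) ⟨counterTape a m v, i, (K + 1) * j + (r + 1) + 1⟩ ((v r).testBit j)
      ⟨counterTape a m v, i, (K + 1) * j + (r + 1) + 1⟩ :=
  exec_modifyBit_id (r := r.succ) (v := Fin.cons (α := fun _ => ℕ) (2 ^ m - 1) v) hS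

/-- Increment the counter `r`. -/
noncomputable def inc (a : Λ) {K : ℕ} (r : Fin K) : Prog Λ Unit :=
  bind (bind (right (r + 2)) fun _ => carry a (K + 1) true) fun _ =>
    bind (left (r + 1)) fun _ => bind (modifyBit a fun _ => true) fun _ => rewind

/-- Read bit `j` of the counter `r`, starting in cell `j` of track `0`. Exit with the answer, if it
is `1` or `j` exceeds the length of the tracks, and otherwise go to cell `j + 1` of track `0`. -/
noncomputable def searchStep (a : Λ) {K : ℕ} (r : Fin K) : Prog Λ (Unit ⊕ Bool) :=
  bind (modifyBit a id) fun inside =>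
    if inside then bind (right (r + 1)) fun _ => bind (modifyBit a id) fun b =>
      if b then ret (.inr true) else bind (right (K - r)) fun _ => ret (.inl ())
    else ret (.inr false)

theorem exec_searchStep_outside {r : Fin K} (hS : (K + 1) * j + 1 ≤ S) (hj : m ≤ j) :
    Exec w S (searchStep a r) ⟨counterTape a m v, i, (K + 1) * j + 1⟩ (.inr false)
      ⟨counterTape a m v, i, (K + 1) * j + 1⟩ := by
  refine (exec_readMask_counterTape hS).bind ?_
  rw [if_neg (by simpa using hj)]
  exact exec_ret hS

theorem exec_searchStep_of_bit {r : Fin K} (hS : (K + 1) * j + (r + 1) + 1 ≤ S) (hj : j < m)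
    (hbit : (v r).testBit j = true) :
    Exec w S (searchStep a r) ⟨counterTape a m v, i, (K + 1) * j + 1⟩ (.inr true)
      ⟨counterTape a m v, i, (K + 1) * j + (r + 1) + 1⟩ := by
  refine (exec_readMask_counterTape (by lia)).bind ?_
  rw [if_pos (by simpa using hj), Nat.add_right_comm _ (r + 1 : ℕ)]
  refine (exec_right _ (by lia)).bind ?_
  rw [Nat.add_right_comm]
  refine (exec_readBit_counterTape hS).bind ?_
  rw [if_pos hbit]
  exact exec_ret hS

theorem exec_searchStep_of_not_bit {r : Fin K} (hS : (K + 1) * (j + 1) + 1 ≤ S) (hj : j < m)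
    (hbit : (v r).testBit j = false) :
    Exec w S (searchStep a r) ⟨counterTape a m v, i, (K + 1) * j + 1⟩ (.inl ())
      ⟨counterTape a m v, i, (K + 1) * (j + 1) + 1⟩ := by
  have hj' : (K + 1) * (j + 1) + 1 = (K + 1) * j + (r + 1) + 1 + (K - r) := by lia
  rw [hj'] at hS ⊢
  refine (exec_readMask_counterTape (by lia)).bind ?_
  rw [if_pos (by simpa using hj)]
  refine (exec_right (r + 1) (by lia)).bind ?_
  rw [Nat.add_right_comm]
  refine (exec_readBit_counterTape (by lia)).bind ?_
  rw [if_neg (by simp [hbit])]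
  exact (exec_right _ hS).bind (exec_ret hS)

/-- Scan the bits of the counter `r` for a `1`, starting in cell `0` of track `0`. -/
noncomputable def search (a : Λ) {K : ℕ} (r : Fin K) : Prog Λ Bool :=
  iter (fun _ : Unit => searchStep a r) ()

theorem exec_search_of_low_bits {r : Fin K} (hS : (K + 1) * (m + 1) ≤ S) (hv : v r < 2 ^ m)
    (hj : j ≤ m) (hlow : ∀ i < j, (v r).testBit i = false) :
    ∃ k ≤ S, Exec w S (search a r) ⟨counterTape a m v, i, (K + 1) * j + 1⟩ (decide (v r ≠ 0))
      ⟨counterTape a m v, i, k⟩ := by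
  induction hn : m - j generalizing j with
  | zero =>
    obtain rfl : j = m := by lia
    have hr : v r = 0 := Nat.zero_of_testBit_eq_false fun i => by
      rcases lt_or_ge i j with hi | hi
      · exact hlow i hi
      · exact Nat.testBit_lt_two_pow (hv.trans_le (Nat.pow_le_pow_right two_pos hi))
    have hS' : (K + 1) * j + 1 ≤ S := by lia
    refine ⟨_, hS', .iter_exit ?_⟩
    simpa [hr] using exec_searchStep_outside hS' le_rfl
  | succ n ih =>
    have hjm : (K + 1) * (j + 1) ≤ (K + 1) * m := Nat.mul_le_mul_left _ (by lia)
    by_cases hbit : (v r).testBit j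
    · have hr : v r ≠ 0 := by
        rintro hr
        simp [hr] at hbit
      have hS' : (K + 1) * j + (r + 1) + 1 ≤ S := by lia
      refine ⟨_, hS', .iter_exit ?_⟩
      simpa [hr] using exec_searchStep_of_bit hS' (by lia) hbit
    · rw [Bool.not_eq_true] at hbit
      obtain ⟨k, hk, h⟩ := ih (j := j + 1) (by lia)
        (fun i hi => (Nat.lt_succ_iff_lt_or_eq.1 hi).elim (hlow i) (by rintro rfl; exact hbit))
        (by lia)
      exact ⟨k, hk, (exec_searchStep_of_not_bit (by lia) (by lia) hbit).iter_next h⟩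

/-- Exit with the truth value of `v r ≠ 0`. -/
noncomputable def nonzero (a : Λ) {K : ℕ} (r : Fin K) : Prog Λ Bool :=
  bind (right 1) fun _ => bind (search a r) fun b => bind rewind fun _ => ret b

theorem exec_nonzero {r : Fin K} (hS : (K + 1) * (m + 1) ≤ S) (hv : v r < 2 ^ m) :
    Exec w S (nonzero a r) ⟨counterTape a m v, i, 0⟩ (decide (v r ≠ 0))
      ⟨counterTape a m v, i, 0⟩ := by
  obtain ⟨k, hk, hsearch⟩ := exec_search_of_low_bits (w := w) (a := a) (i := i) (j := 0) hS hv
    (Nat.zero_le m) nofun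
  rw [Nat.mul_zero] at hsearch
  exact (exec_right 1 (by lia)).bind
    (hsearch.bind ((exec_rewind_counterTape hk).bind (exec_ret (Nat.zero_le S))))

/-- Decrement the counter `r` unless it is zero; exit with the truth value of `v r ≠ 0`. -/
noncomputable def dec (a : Λ) {K : ℕ} (r : Fin K) : Prog Λ Bool :=
  bind (nonzero a r) fun b =>
    if b then bind (bind (right (r + 2)) fun _ => carry a (K + 1) false) fun _ =>
      bind rewind fun _ => ret true
    else ret false

/-- On input `w`, the program turns counters `v` into `v'` and moves the input cursor from `i` to
`i'`, exiting with value `e`; the working cursor starts and ends on the marker, and the counters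
never have more than `β` bits. -/
def CounterExec (a : Λ) (w : List Λ) (β : ℕ) {ε : Type} (p : Prog Λ ε) {K : ℕ} (v : Fin K → ℕ)
    (i : ℕ) (e : ε) (v' : Fin K → ℕ) (i' : ℕ) : Prop :=
  ∀ m ≤ β, (∀ r, v r < 2 ^ m) → ∃ m' ≤ β, (∀ r, v' r < 2 ^ m') ∧
    Exec w ((K + 1) * (β + 1)) p ⟨counterTape a m v, i, 0⟩ e ⟨counterTape a m' v', i', 0⟩

variable {ε δ : Type} {e e' : ε} {d : δ} {i' i'' : ℕ}

theorem CounterExec.bind [Finite ε] {p : Prog Λ ε} {f : ε → Prog Λ δ}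
    (hp : CounterExec a w β p v i e v' i') (hf : CounterExec a w β (f e) v' i' d v'' i'') :
    CounterExec a w β (p.bind f) v i d v'' i'' := by
  intro m hm hv
  obtain ⟨m', hm', hv', hp⟩ := hp m hm hv
  obtain ⟨m'', hm'', hv'', hf⟩ := hf m' hm' hv'
  exact ⟨m'', hm'', hv'', hp.bind hf⟩

theorem CounterExec.iter_exit [Finite ε] {body : ε → Prog Λ (ε ⊕ δ)}
    (h : CounterExec a w β (body e) v i (.inr d) v' i') :
    CounterExec a w β (iter body e) v i d v' i' := by
  intro m hm hv
  obtain ⟨m', hm', hv', h⟩ := h m hm hv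
  exact ⟨m', hm', hv', h.iter_exit⟩

theorem CounterExec.iter_next [Finite ε] {body : ε → Prog Λ (ε ⊕ δ)}
    (h : CounterExec a w β (body e) v i (.inl e') v' i')
    (h' : CounterExec a w β (iter body e') v' i' d v'' i'') :
    CounterExec a w β (iter body e) v i d v'' i'' := by
  intro m hm hv
  obtain ⟨m', hm', hv', h⟩ := h m hm hv
  obtain ⟨m'', hm'', hv'', h'⟩ := h' m' hm' hv'
  exact ⟨m'', hm'', hv'', h.iter_next h'⟩

theorem counterExec_ret : CounterExec a w β (ret e) v i e v i :=
  fun m hm hv => ⟨m, hm, hv, exec_ret (Nat.zero_le _)⟩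

theorem counterExec_rewindInput : CounterExec a w β rewindInput v i () v 0 :=
  fun m hm hv => ⟨m, hm, hv, exec_rewindInput (Nat.zero_le _)⟩

theorem counterExec_readInput {f : TapeSym Λ → ε} :
    CounterExec a w β (readInput f) v i (f (tapeRead (inputTape w) i)) v i :=
  fun m hm hv => ⟨m, hm, hv, exec_readInput (m := ⟨_, _, _⟩) (Nat.zero_le _)⟩

theorem counterExec_moveInput {d : Move} (hleft : i = 0 → d ≠ .left)
    (hright : w.length < i → d ≠ .right) :
    CounterExec a w β (moveInput d) v i () v (d.apply i) :=
  fun m hm hv => ⟨m, hm, hv, exec_moveInput (m := ⟨_, _, _⟩) (Nat.zero_le _) hleft hright⟩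

theorem counterExec_inc {r : Fin K} (hr : v r + 1 < 2 ^ β) :
    CounterExec a w β (inc a r) v i () (Function.update v r (v r + 1)) i := by
  intro m hm hv
  obtain ⟨j, hlow, hj, hsucc⟩ := exists_succ_eq_xor (v r)
  have hj' : (v r + 1).testBit j = true := by
    simp [hsucc, hj, Nat.testBit_two_pow_sub_one]
  have hle : 2 ^ j ≤ v r + 1 := Nat.ge_two_pow_of_testBit hj'
  have hjβ : j < β := (Nat.pow_lt_pow_iff_right one_lt_two).1 (hle.trans_lt hr)
  have hjm : j ≤ m := (Nat.pow_le_pow_iff_right one_lt_two).1 (hle.trans (hv r))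
  have hS : (K + 1) * (j + 1) ≤ (K + 1) * β := Nat.mul_le_mul_left _ hjβ
  have hcarry := exec_carry_counterTape (w := w) (a := a) (i := i) (m := m)
    (S := (K + 1) * (β + 1)) (by lia) hlow hj
  rw [← hsucc, ← Nat.add_right_comm] at hcarry
  obtain ⟨b, hset⟩ := exec_setBit_counterTape (w := w) (a := a) (i := i)
    (v := Function.update v r (v r + 1)) (S := (K + 1) * (β + 1)) (by lia) hjm
  have hm' : 2 ^ m ≤ 2 ^ max m (j + 1) := Nat.pow_le_pow_right two_pos (le_max_left _ _)
  have hr' : v r + 1 < 2 ^ max m (j + 1) := by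
    rcases Nat.lt_or_eq_of_le (hv r) with h | h
    · exact h.trans_le hm'
    · rw [Nat.succ_eq_add_one] at h
      rw [h, Nat.testBit_two_pow, decide_eq_true_iff] at hj'
      rw [h, hj']
      exact Nat.pow_lt_pow_right one_lt_two (by lia)
  refine ⟨max m (j + 1), by lia, fun s => ?_, hcarry.bind
    ((exec_left _ (by lia) tracks_eq_marker_iff).bind
      (hset.bind (exec_rewind_counterTape (by lia))))⟩
  rcases eq_or_ne s r with rfl | hs
  · rwa [Function.update_self]
  · rw [Function.update_of_ne hs]
    exact (hv s).trans_le hm'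

theorem counterExec_dec {r : Fin K} :
    CounterExec a w β (dec a r) v i (decide (v r ≠ 0)) (Function.update v r (v r - 1)) i := by
  intro m hm hv
  have hS : (K + 1) * (m + 1) ≤ (K + 1) * (β + 1) := Nat.mul_le_mul_left _ (by lia)
  have hupdate (s : Fin K) : Function.update v r (v r - 1) s < 2 ^ m := by
    rcases eq_or_ne s r with rfl | hs
    · rw [Function.update_self]
      exact (Nat.sub_le _ 1).trans_lt (hv s)
    · rw [Function.update_of_ne hs]
      exact hv s
  refine ⟨m, hm, hupdate, (exec_nonzero hS (hv r)).bind ?_⟩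
  cases hr : v r with
  | zero =>
    simp only [ne_eq, not_true, decide_false, Bool.false_eq_true, if_false, Nat.zero_sub]
    rw [Function.update_eq_self_iff.2 hr.symm]
    exact exec_ret (Nat.zero_le _)
  | succ x =>
    obtain ⟨j, hlow, hj, hsucc⟩ := exists_succ_eq_xor x
    simp only [ne_eq, Nat.add_one_ne_zero, not_false_eq_true, decide_true, if_true,
      Nat.add_one_sub_one]
    have hbit : (v r).testBit j = true := by
      simp [hr, hsucc, hj, Nat.testBit_two_pow_sub_one]
    have hlow' (i : ℕ) (hi : i < j) : (v r).testBit i = false := by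
      simp [hr, hsucc, hlow i hi, Nat.testBit_two_pow_sub_one]
      lia
    have hjm : j < m := (Nat.pow_lt_pow_iff_right one_lt_two).1
      ((Nat.ge_two_pow_of_testBit hbit).trans_lt (hv r))
    have hS' : (K + 1) * (j + 1) ≤ (K + 1) * m := Nat.mul_le_mul_left _ hjm
    have hcarry := exec_carry_counterTape (w := w) (a := a) (i := i) (m := m) (c := false)
      (S := (K + 1) * (β + 1)) (by lia) hlow' hbit
    rw [hr, hsucc, Nat.xor_assoc, Nat.xor_self, Nat.xor_zero] at hcarry
    exact hcarry.bind ((exec_rewind_counterTape (by lia)).bind (exec_ret (Nat.zero_le _)))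

end Counters

end Prog

/-! ### Arithmetic with counters -/

namespace Prog

section Arithmetic

variable {Λ : Type u} {K : ℕ}

/-- Run `body` once for each successful decrement of the counter `r`. -/
noncomputable def whileDec (a : Λ) (r : Fin K) (body : Prog Λ Unit) : Prog Λ Unit :=
  iter (fun _ : Unit => bind (dec a r) fun b =>
    if b then bind body fun _ => ret (.inl ()) else ret (.inr ())) ()

/-- Set the counter `r` to zero. -/
noncomputable def clear (a : Λ) (r : Fin K) : Prog Λ Unit := whileDec a r (ret ())

/-- Add `k` to the counter `r`. -/
noncomputable def incBy (a : Λ) (r : Fin K) : ℕ → Prog Λ Unit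
  | 0 => ret ()
  | k + 1 => bind (inc a r) fun _ => incBy a r k

/-- Add `k` times the counter `r` to the counter `s`, and set the counter `r` to zero. -/
noncomputable def transfer (a : Λ) (r s : Fin K) (k : ℕ) : Prog Λ Unit :=
  whileDec a r (incBy a s k)

/-- Copy the counter `r` to the zero counter `s`; the zero counter `t` is auxiliary. -/
noncomputable def copy (a : Λ) (r s t : Fin K) : Prog Λ Unit :=
  bind (whileDec a r (bind (inc a s) fun _ => inc a t)) fun _ => transfer a t r 1

/-- Append the digit `c` to the number in the counter `r`, written in base `k + 1`; the zero counter
`t` is auxiliary. -/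
noncomputable def push (a : Λ) (k : ℕ) (t r : Fin K) (c : ℕ) : Prog Λ Unit :=
  bind (transfer a r t (k + 1)) fun _ => bind (transfer a t r 1) fun _ => incBy a r c

/-- Divide the sum of `d` and the counter `r` by `k + 1`: exit with the remainder, add the quotient
to the counter `t`, and set the counter `r` to zero. -/
noncomputable def divide (a : Λ) (k : ℕ) (t r : Fin K) (d : Fin (k + 1)) : Prog Λ (Fin (k + 1)) :=
  iter (fun d : Fin (k + 1) => bind (dec a r) fun b =>
    if b then
      if h : d.val + 1 < k + 1 then ret (.inl ⟨d.val + 1, h⟩)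
      else bind (inc a t) fun _ => ret (.inl 0)
    else ret (.inr d)) d

/-- Remove the last digit of the number in the counter `r`, written in base `k + 1`, and exit with
this digit; the zero counter `t` is auxiliary. -/
noncomputable def pop (a : Λ) (k : ℕ) (t r : Fin K) : Prog Λ (Fin (k + 1)) :=
  bind (divide a k t r 0) fun d => bind (transfer a t r 1) fun _ => ret d

/-- Exit with the last digit of the number in the counter `r`, written in base `k + 1`. -/
noncomputable def peek (a : Λ) (k : ℕ) (t r : Fin K) : Prog Λ (Fin (k + 1)) :=
  bind (pop a k t r) fun d => bind (push a k t r d) fun _ => ret d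

/-- Replace the last digit of the number in the counter `r`, written in base `k + 1`, by `c`. -/
noncomputable def replaceDigit (a : Λ) (k : ℕ) (t r : Fin K) (c : ℕ) : Prog Λ Unit :=
  bind (pop a k t r) fun _ => push a k t r c

/-- Move the last digit of the number in the counter `r` to the end of the number in the counter
`l`, both written in base `k + 1`. -/
noncomputable def moveDigit (a : Λ) (k : ℕ) (t r l : Fin K) : Prog Λ Unit :=
  bind (pop a k t r) fun d => push a k t l d

variable {a : Λ} {w : List Λ} {β i k : ℕ} {v : Fin K → ℕ} {l r s t : Fin K}

theorem counterExec_whileDec {body : Prog Λ Unit} (N : ℕ) (g : ℕ → Fin K → ℕ)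
    (hg : ∀ n ≤ N, g n r = n)
    (hbody : ∀ n < N, CounterExec a w β body (Function.update (g (n + 1)) r n) i () (g n) i) :
    CounterExec a w β (whileDec a r body) (g N) i () (g 0) i := by
  induction N with
  | zero =>
    refine (counterExec_dec.bind ?_).iter_exit
    rw [hg 0 le_rfl, Function.update_eq_self_iff.2 (hg 0 le_rfl).symm, if_neg (by simp)]
    exact counterExec_ret
  | succ N ih =>
    refine CounterExec.iter_next (e' := ()) (counterExec_dec.bind ?_)
      (ih (fun n hn => hg n (by lia)) fun n hn => hbody n (by lia))
    rw [hg (N + 1) le_rfl, if_pos (by simp), Nat.add_sub_cancel]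
    exact (hbody N (Nat.lt_succ_self N)).bind counterExec_ret

theorem counterExec_clear : CounterExec a w β (clear a r) v i () (Function.update v r 0) i := by
  have := counterExec_whileDec (a := a) (w := w) (β := β) (body := ret ()) (i := i) (r := r) (v r)
    (Function.update v r) (by simp) fun n _ => by
      rw [Function.update_idem]
      exact counterExec_ret
  rwa [Function.update_eq_self] at this

theorem counterExec_incBy (hβ : v r + k < 2 ^ β) :
    CounterExec a w β (incBy a r k) v i () (Function.update v r (v r + k)) i := by
  induction k generalizing v with
  | zero =>
    rw [Nat.add_zero, Function.update_eq_self]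
    exact counterExec_ret
  | succ k ih =>
    have := ih (v := Function.update v r (v r + 1)) (by rw [Function.update_self]; lia)
    rw [Function.update_self, Function.update_idem, Nat.add_right_comm] at this
    exact (counterExec_inc (by lia)).bind this

theorem counterExec_transfer (hrs : r ≠ s) (hβ : v s + k * v r < 2 ^ β) :
    CounterExec a w β (transfer a r s k) v i ()
      (Function.update (Function.update v r 0) s (v s + k * v r)) i := by
  have := counterExec_whileDec (a := a) (w := w) (β := β) (i := i) (body := incBy a s k) (v r)
    (fun n => Function.update (Function.update v r n) s (v s + k * (v r - n)))
    (fun n _ => by rw [Function.update_of_ne hrs, Function.update_self]) fun n hn => by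
      have hk : k * (v r - n) = k * (v r - (n + 1)) + k := by
        rw [← Nat.mul_succ, Nat.succ_eq_add_one]
        congr 1
        lia
      have hle : k * (v r - n) ≤ k * v r := Nat.mul_le_mul_left k (Nat.sub_le _ _)
      convert counterExec_incBy (k := k) (r := s) ?_ using 1 <;> grind
  simpa [transfer] using this

theorem counterExec_copy (hrs : r ≠ s) (hrt : r ≠ t) (hst : s ≠ t) (hs : v s = 0) (ht : v t = 0)
    (hβ : v r < 2 ^ β) :
    CounterExec a w β (copy a r s t) v i () (Function.update v s (v r)) i := by
  have := counterExec_whileDec (a := a) (w := w) (β := β) (i := i) (r := r)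
    (body := bind (inc a s) fun _ => inc a t) (v r)
    (fun n => Function.update (Function.update (Function.update v r n) s (v r - n)) t (v r - n))
    (by grind) fun n hn => by
      refine (counterExec_inc (by grind)).bind ?_
      convert counterExec_inc (r := t) ?_ using 1 <;> grind
  have hv : Function.update (Function.update (Function.update v r (v r)) s (v r - v r)) t
    (v r - v r) = v := by grind
  rw [hv] at this
  refine this.bind ?_
  convert counterExec_transfer (k := 1) hrt.symm ?_ using 1 <;> grind

theorem counterExec_push {c : ℕ} (hrt : r ≠ t) (ht : v t = 0) (hβ : (k + 1) * v r + c < 2 ^ β) :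
    CounterExec a w β (push a k t r c) v i () (Function.update v r ((k + 1) * v r + c)) i := by
  refine (counterExec_transfer hrt (by lia)).bind
    ((counterExec_transfer hrt.symm (by grind)).bind ?_)
  convert counterExec_incBy (r := r) ?_ using 1 <;> grind

theorem counterExec_divide {q : ℕ} {d e : Fin (k + 1)} (hrt : r ≠ t)
    (hq : v r + d = (k + 1) * q + e) (hβ : v t + (v r + d) < 2 ^ β) :
    CounterExec a w β (divide a k t r d) v i e
      (Function.update (Function.update v r 0) t (v t + q)) i := by
  induction hN : v r generalizing v d q with
  | zero =>
    obtain rfl : q = 0 := by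
      by_contra hq0
      have := Nat.le_mul_of_pos_right (k + 1) (Nat.pos_of_ne_zero hq0)
      lia
    obtain rfl : d = e := by
      ext
      lia
    refine (counterExec_dec.bind ?_).iter_exit
    rw [if_neg (by simp [hN])]
    convert counterExec_ret using 1
    grind
  | succ N ih =>
    by_cases hd : d.val + 1 < k + 1
    · refine CounterExec.iter_next (e' := ⟨d.val + 1, hd⟩)
        (counterExec_dec.bind (v'' := Function.update v r N) (i'' := i) ?_) ?_
      · rw [if_pos (by simp [hN]), dif_pos hd, hN]
        exact counterExec_ret
      · change CounterExec a w β (divide a k t r _) _ _ _ _ _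
        convert ih (v := Function.update v r N) (d := ⟨d.val + 1, hd⟩) (q := q) ?_ ?_ ?_
          using 1 <;> grind
    · obtain ⟨q, rfl⟩ : ∃ q', q = q' + 1 := Nat.exists_eq_succ_of_ne_zero <| by
        rintro rfl
        lia
      refine CounterExec.iter_next (e' := 0) (counterExec_dec.bind (i'' := i)
        (v'' := Function.update (Function.update v r N) t (v t + 1)) ?_) ?_
      · rw [if_pos (by simp [hN]), dif_neg hd, hN, Nat.add_sub_cancel,
          ← Function.update_of_ne hrt.symm N v]
        exact (counterExec_inc (by grind)).bind counterExec_ret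
      · change CounterExec a w β (divide a k t r _) _ _ _ _ _
        convert ih (v := Function.update (Function.update v r N) t (v t + 1)) (d := 0) (q := q)
          ?_ ?_ ?_ using 1 <;> grind

theorem counterExec_pop {q : ℕ} {d : Fin (k + 1)} (hrt : r ≠ t) (ht : v t = 0)
    (hq : v r = (k + 1) * q + d) (hβ : v r < 2 ^ β) :
    CounterExec a w β (pop a k t r) v i d (Function.update v r q) i := by
  have : q ≤ v r := by
    rw [hq, Nat.add_mul]
    lia
  refine (counterExec_divide (q := q) hrt (by simpa) (by simpa [ht])).bind
    ((counterExec_transfer hrt.symm (by grind)).bind ?_)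
  convert counterExec_ret using 1
  grind

theorem counterExec_peek {q : ℕ} {d : Fin (k + 1)} (hrt : r ≠ t) (ht : v t = 0)
    (hq : v r = (k + 1) * q + d) (hβ : v r < 2 ^ β) :
    CounterExec a w β (peek a k t r) v i d v i := by
  refine (counterExec_pop hrt ht hq hβ).bind ((counterExec_push hrt (by grind) (by grind)).bind ?_)
  convert counterExec_ret using 1
  grind

theorem counterExec_replaceDigit {q c : ℕ} {d : Fin (k + 1)} (hrt : r ≠ t) (ht : v t = 0)
    (hq : v r = (k + 1) * q + d) (hβ : v r < 2 ^ β) (hc : (k + 1) * q + c < 2 ^ β) :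
    CounterExec a w β (replaceDigit a k t r c) v i ()
      (Function.update v r ((k + 1) * q + c)) i := by
  refine (counterExec_pop hrt ht hq hβ).bind ?_
  convert counterExec_push (r := r) hrt ?_ ?_ using 1 <;> grind

theorem counterExec_moveDigit {q : ℕ} {d : Fin (k + 1)} (hrt : r ≠ t) (hlt : l ≠ t) (hrl : r ≠ l)
    (ht : v t = 0) (hq : v r = (k + 1) * q + d) (hβ : v r < 2 ^ β)
    (hl : (k + 1) * v l + d < 2 ^ β) :
    CounterExec a w β (moveDigit a k t r l) v i ()
      (Function.update (Function.update v r q) l ((k + 1) * v l + d)) i := by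
  refine (counterExec_pop hrt ht hq hβ).bind ?_
  convert counterExec_push (r := l) hlt ?_ ?_ using 1 <;> grind

end Arithmetic

end Prog

/-! ### Tapes as pairs of numbers -/

section Tape

variable {A : Type u} {y z : List (TapeSym A)} {p q : ℕ} {b : TapeSym A}

theorem length_tapeWrite : (tapeWrite y p b).length = max y.length (p + 1) := by
  simp only [tapeWrite, List.length_set, List.length_append, List.length_replicate]
  lia

theorem tapeRead_tapeWrite :
    tapeRead (tapeWrite y p b) q = if q = p then b else tapeRead y q := by
  simp only [tapeRead, tapeWrite, List.getD_eq_getElem?_getD]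
  grind

theorem tapeRead_tapeWrite_zero (hy : tapeRead y 0 = .marker)
    (hb : b = .marker ↔ tapeRead y p = .marker) : tapeRead (tapeWrite y p b) 0 = .marker := by
  grind [tapeRead_tapeWrite]

end Tape

/-- A coding of the machine alphabet over `A` by the digits of base `top + 1`. The blank is the
digit `0`, so that appending blanks to a tape does not change the number it stands for. -/
structure SymCode (A : Type u) where
  top : ℕ
  code : TapeSym A → Fin (top + 1)
  decode : Fin (top + 1) → TapeSym A
  code_blank : code .blank = 0
  decode_code : ∀ s, decode (code s) = s

namespace SymCode

variable {A : Type u} (c : SymCode A)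

/-- The cells from `p` on as a number whose last digit is cell `p`. -/
def rightNum (y : List (TapeSym A)) (p : ℕ) : ℕ :=
  Nat.ofDigits (c.top + 1) ((y.drop p).map fun s => (c.code s : ℕ))

/-- The cells before `p` as a number whose last digit is cell `p - 1`. -/
def leftNum (y : List (TapeSym A)) : ℕ → ℕ
  | 0 => 0
  | p + 1 => (c.top + 1) * leftNum y p + c.code (tapeRead y p)

variable {c} {y z : List (TapeSym A)} {p : ℕ} {b : TapeSym A}

theorem rightNum_eq :
    c.rightNum y p = (c.top + 1) * c.rightNum y (p + 1) + c.code (tapeRead y p) := by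
  rcases lt_or_ge p y.length with hp | hp
  · rw [rightNum, rightNum, tapeRead, List.drop_eq_getElem_cons hp, List.map_cons,
      Nat.ofDigits_cons, add_comm, List.getD_eq_getElem _ _ hp]
  · rw [rightNum, rightNum, tapeRead, List.drop_eq_nil_of_le hp,
      List.drop_eq_nil_of_le (hp.trans p.le_succ), List.getD_eq_default _ _ hp, c.code_blank]
    rfl

theorem rightNum_tapeWrite : c.rightNum (tapeWrite y p b) (p + 1) = c.rightNum y (p + 1) := by
  rw [rightNum, rightNum, tapeWrite, List.drop_set_of_lt p.lt_succ_self, List.drop_append]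
  simp

theorem leftNum_congr (h : ∀ q < p, tapeRead y q = tapeRead z q) :
    c.leftNum y p = c.leftNum z p := by
  induction p with
  | zero => rfl
  | succ p ih => rw [leftNum, leftNum, ih fun q hq => h q (by lia), h p p.lt_succ_self]

theorem leftNum_tapeWrite : c.leftNum (tapeWrite y p b) p = c.leftNum y p :=
  leftNum_congr fun q hq => by rw [tapeRead_tapeWrite, if_neg hq.ne]

theorem leftNum_lt : c.leftNum y p < (c.top + 1) ^ p := by
  induction p with
  | zero => exact Nat.one_pos
  | succ p ih =>
    have := Nat.mul_le_mul_left (c.top + 1) (Nat.succ_le_of_lt ih)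
    rw [leftNum, pow_succ']
    lia

theorem rightNum_lt : c.rightNum y p < (c.top + 1) ^ (y.length - p) := by
  induction hn : y.length - p generalizing p with
  | zero => simp [rightNum, List.drop_eq_nil_of_le (Nat.le_of_sub_eq_zero hn)]
  | succ n ih =>
    have := Nat.mul_le_mul_left (c.top + 1) (Nat.succ_le_of_lt (ih (p := p + 1) (by lia)))
    rw [rightNum_eq, pow_succ']
    lia

end SymCode

namespace Prog

/-- Move the cursor of the tape in the counters `l` and `r`; the zero counter `t` is auxiliary. -/
noncomputable def moveTape {Λ : Type u} {K : ℕ} (a : Λ) (k : ℕ) (t l r : Fin K) :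
    Move → Prog Λ Unit
  | .left => moveDigit a k t l r
  | .stay => ret ()
  | .right => moveDigit a k t r l

/-- Write `b` on the tape in the counters `l` and `r` and move its cursor; the zero counter `t` is
auxiliary. -/
noncomputable def writeMove {Λ : Type u} {A : Type v} {K : ℕ} (a : Λ) (c : SymCode A)
    (t l r : Fin K) (b : TapeSym A) (d : Move) : Prog Λ Unit :=
  bind (replaceDigit a c.top t r (c.code b)) fun _ => moveTape a c.top t l r d

section TapeCounters

variable {Λ : Type u} {A : Type v} {K : ℕ} {a : Λ} {w : List Λ} {β i p : ℕ} {v : Fin K → ℕ}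
  {l r t : Fin K} {c : SymCode A} {y : List (TapeSym A)} {b : TapeSym A} {d : Move}

theorem counterExec_peek_rightNum (hrt : r ≠ t) (ht : v t = 0) (hr : v r = c.rightNum y p)
    (hβ : (c.top + 1) ^ y.length ≤ 2 ^ β) :
    CounterExec a w β (peek a c.top t r) v i (c.code (tapeRead y p)) v i := by
  refine counterExec_peek hrt ht (hr.trans SymCode.rightNum_eq) (hr ▸ ?_)
  exact SymCode.rightNum_lt.trans_le
    ((Nat.pow_le_pow_right (Nat.succ_pos _) (Nat.sub_le _ _)).trans hβ)

theorem counterExec_moveTape (hlt : l ≠ t) (hrt : r ≠ t) (hlr : l ≠ r) (ht : v t = 0)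
    (hl : v l = c.leftNum y p) (hr : v r = c.rightNum y p) (hp : p < y.length)
    (hβ : (c.top + 1) ^ y.length ≤ 2 ^ β) (hd : d = .left → 0 < p) :
    CounterExec a w β (moveTape a c.top t l r d) v i ()
      (Function.update (Function.update v l (c.leftNum y (d.apply p))) r
        (c.rightNum y (d.apply p))) i := by
  have hleft {q : ℕ} (hq : q ≤ y.length) : c.leftNum y q < 2 ^ β :=
    SymCode.leftNum_lt.trans_le ((Nat.pow_le_pow_right (Nat.succ_pos _) hq).trans hβ)
  have hright (q : ℕ) : c.rightNum y q < 2 ^ β :=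
    SymCode.rightNum_lt.trans_le
      ((Nat.pow_le_pow_right (Nat.succ_pos _) (Nat.sub_le _ _)).trans hβ)
  cases d with
  | left =>
    obtain ⟨q, rfl⟩ := Nat.exists_eq_succ_of_ne_zero (hd rfl).ne'
    have hq := SymCode.rightNum_eq (c := c) (y := y) (p := q)
    have := counterExec_moveDigit (a := a) (w := w) (i := i) hlt hrt hlr ht hl
      (hl ▸ hleft hp.le) (hr ▸ hq ▸ hright q)
    rwa [hr, ← hq] at this
  | stay =>
    simp only [Move.apply, ← hl, ← hr, Function.update_eq_self]
    exact counterExec_ret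
  | right =>
    have := counterExec_moveDigit (a := a) (w := w) (i := i) hrt hlt hlr.symm ht
      (hr.trans SymCode.rightNum_eq) (hr ▸ hright p) (hl ▸ hleft hp)
    rw [hl, Function.update_comm hlr.symm] at this
    exact this

theorem counterExec_writeMove (hlt : l ≠ t) (hrt : r ≠ t) (hlr : l ≠ r) (ht : v t = 0)
    (hl : v l = c.leftNum y p) (hr : v r = c.rightNum y p)
    (hβ : (c.top + 1) ^ (tapeWrite y p b).length ≤ 2 ^ β) (hd : d = .left → 0 < p) :
    CounterExec a w β (writeMove a c t l r b d) v i ()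
      (Function.update (Function.update v l (c.leftNum (tapeWrite y p b) (d.apply p))) r
        (c.rightNum (tapeWrite y p b) (d.apply p))) i := by
  have hlen : p < (tapeWrite y p b).length := by
    rw [length_tapeWrite]
    lia
  have hwrite : c.rightNum (tapeWrite y p b) p =
      (c.top + 1) * c.rightNum y (p + 1) + c.code b := by
    rw [SymCode.rightNum_eq, SymCode.rightNum_tapeWrite, tapeRead_tapeWrite, if_pos rfl]
  have hlt_pow {z : List (TapeSym A)} (hz : z.length ≤ (tapeWrite y p b).length) :
      c.rightNum z p < 2 ^ β :=
    SymCode.rightNum_lt.trans_le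
      ((Nat.pow_le_pow_right (Nat.succ_pos _) ((Nat.sub_le _ _).trans hz)).trans hβ)
  have hreplace := counterExec_replaceDigit (a := a) (w := w) (i := i) (c := c.code b) hrt ht
    (hr.trans SymCode.rightNum_eq) (hr ▸ hlt_pow (by simp [length_tapeWrite]))
    (hwrite ▸ hlt_pow le_rfl)
  refine hreplace.bind ?_
  rw [← hwrite]
  convert counterExec_moveTape (c := c) (y := tapeWrite y p b) (p := p) (d := d) hlt hrt hlr ?_ ?_
    ?_ hlen hβ hd using 1
  all_goals grind [SymCode.leftNum_tapeWrite]

end TapeCounters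

end Prog

/-! ### Recomputing the output of a transducer -/

instance : Finite Move :=
  Finite.of_surjective (![.left, .stay, .right] : Fin 3 → Move) fun
    | .left => ⟨0, rfl⟩
    | .stay => ⟨1, rfl⟩
    | .right => ⟨2, rfl⟩

instance {Λ : Type u} [Finite Λ] : Finite (TapeSym Λ) :=
  Finite.of_surjective
    (fun x : Option (Option Λ) => x.elim TapeSym.blank fun y => y.elim .marker .letter) fun
    | .blank => ⟨none, rfl⟩
    | .marker => ⟨some none, rfl⟩
    | .letter a => ⟨some (some a), rfl⟩

namespace Transducer

variable {Λ₁ : Type u} {Λ₂ : Type v} {N : Transducer Λ₁ Λ₂} {w : List Λ₁} {C X Y : N.Config}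

theorem tapeRead_work_zero (h : N.Reaches w C) : tapeRead C.work 0 = .marker := by
  induction h with
  | refl => rfl
  | tail _ hstep ih =>
    obtain ⟨t, ht, rfl⟩ := Option.map_eq_some_iff.1 hstep
    exact tapeRead_tapeWrite_zero ih (N.δ_marker _ _ _ t ht)

theorem isPrefix_output (h : Relation.ReflTransGen (fun C₁ C₂ => N.step w C₁ = some C₂) X Y) :
    X.output <+: Y.output := by
  induction h with
  | refl => exact List.prefix_rfl
  | tail _ hstep ih =>
    obtain ⟨t, -, rfl⟩ := Option.map_eq_some_iff.1 hstep
    exact ih.trans (List.prefix_append _ _)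

end Transducer

/-- The counters used to simulate a machine `M` on the output of a transducer `N`: the position of
the input cursor of `M`, the number of output letters to be skipped, the working tapes of `M` and
`N` left and right of the cursor, and an auxiliary counter. -/
def registers (i j ml mr nl nr : ℕ) : Fin 7 → ℕ := ![i, j, ml, mr, nl, nr, 0]

section Registers

variable {i j ml mr nl nr x y : ℕ}

theorem update_registers_zero :
    Function.update (registers i j ml mr nl nr) 0 x = registers x j ml mr nl nr := by
  ext r
  fin_cases r <;> rfl

theorem update_registers_one :
    Function.update (registers i j ml mr nl nr) 1 x = registers i x ml mr nl nr := by
  ext r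
  fin_cases r <;> rfl

theorem update_registers_two_three :
    Function.update (Function.update (registers i j ml mr nl nr) 2 x) 3 y =
      registers i j x y nl nr := by
  ext r
  fin_cases r <;> rfl

theorem update_registers_four :
    Function.update (registers i j ml mr nl nr) 4 x = registers i j ml mr x nr := by
  ext r
  fin_cases r <;> rfl

theorem update_registers_five :
    Function.update (registers i j ml mr nl nr) 5 x = registers i j ml mr nl x := by
  ext r
  fin_cases r <;> rfl

end Registers

namespace Prog

variable {Λ₁ : Type u} {Λ₂ : Type v} (a : Λ₁) (N : Transducer Λ₁ Λ₂) (cN : SymCode N.Work)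
  (cM : SymCode Λ₂)

/-- Exit with the letter produced by the transducer, if it is the one looked for. -/
noncomputable def emit (q : N.State) : Option (Fin (cM.top + 1)) →
    Prog Λ₁ (N.State ⊕ Fin (cM.top + 1))
  | none => ret (.inl q)
  | some x => bind (dec a (1 : Fin 7)) fun b => ret (if b then .inl q else .inr x)

/-- Execute a transition of the transducer; exit with a blank, if there is none. -/
noncomputable def transition :
    Option (N.State × Move × Move × TapeSym N.Work × Option (Fin (cM.top + 1))) →
    Prog Λ₁ (N.State ⊕ Fin (cM.top + 1))
  | none => ret (.inr (cM.code .blank))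
  | some t => bind (writeMove a cN (6 : Fin 7) 4 5 t.2.2.2.1 t.2.2.1) fun _ =>
      bind (moveInput t.2.1) fun _ => emit a N cM t.1 t.2.2.2.2

/-- Simulate a step of the transducer in the state `q`. -/
noncomputable def produceStep (q : N.State) : Prog Λ₁ (N.State ⊕ Fin (cM.top + 1)) :=
  have := N.finite_state
  have := N.finite_work
  bind (peek a cN.top (6 : Fin 7) 5) fun x =>
    bind (readInput fun α => (N.δ q α (cN.decode x)).map fun t =>
      (t.1, t.2.1, t.2.2.1, t.2.2.2.1, t.2.2.2.2.map fun o => cM.code (.letter o)))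
    (transition a N cN cM)

/-- Simulate the transducer from the state `q` on, and exit with the letter it produces after
skipping as many letters as counter `1` tells. -/
noncomputable def produce (q : N.State) : Prog Λ₁ (Fin (cM.top + 1)) :=
  have := N.finite_state
  iter (produceStep a N cN cM) q

/-- Exit with the symbol in cell `i` of the input tape of `M`, where `i` is the value of counter
`0`. -/
noncomputable def fetchInput : Prog Λ₁ (Fin (cM.top + 1)) :=
  bind (copy a (0 : Fin 7) 1 6) fun _ => bind (dec a (1 : Fin 7)) fun b =>
    if b then
      bind (incBy a (5 : Fin 7) (cN.code .marker)) fun _ =>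
      bind (produce a N cN cM N.init) fun x =>
      bind (clear a (1 : Fin 7)) fun _ => bind (clear a (4 : Fin 7)) fun _ =>
      bind (clear a (5 : Fin 7)) fun _ => bind rewindInput fun _ => ret x
    else ret (cM.code .marker)

/-- Exit with the symbols scanned by `M`. -/
noncomputable def fetch : Prog Λ₁ (Fin (cM.top + 1) × Fin (cM.top + 1)) :=
  bind (fetchInput a N cN cM) fun x => bind (peek a cM.top (6 : Fin 7) 3) fun y => ret (x, y)

section Transducer

variable {a N cN cM} {β i j ml mr p : ℕ} {w : List Λ₁} {X Y : N.Config} {y : List (TapeSym Λ₂)}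

/-- The counters when the transducer is in the configuration `X`. -/
def transducerRegisters (cN : SymCode N.Work) (i j ml mr : ℕ) (X : N.Config) : Fin 7 → ℕ :=
  registers i j ml mr (cN.leftNum X.work X.workPos) (cN.rightNum X.work X.workPos)

theorem counterExec_produceStep_of_halt
    (hβ : ∀ C, N.Reaches w C → (cN.top + 1) ^ C.work.length ≤ 2 ^ β)
    (hX : N.Reaches w X) (hhalt : N.step w X = none) :
    CounterExec a w β (produceStep a N cN cM X.state) (transducerRegisters cN i j ml mr X)
      X.inputPos (.inr (cM.code .blank)) (transducerRegisters cN i j ml mr X) X.inputPos := by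
  have := N.finite_state
  have := N.finite_work
  refine (counterExec_peek_rightNum (p := X.workPos) (by decide) rfl rfl (hβ X hX)).bind
    (counterExec_readInput.bind ?_)
  rw [cN.decode_code, Option.map_eq_none_iff.1 hhalt]
  exact counterExec_ret

theorem counterExec_produceStep_of_step
    (hβ : ∀ C, N.Reaches w C → (cN.top + 1) ^ C.work.length ≤ 2 ^ β)
    (hX : N.Reaches w X) (hstep : N.step w X = some Y) :
    ∃ o : Option Λ₂, Y.output = X.output ++ o.toList ∧ ∀ j e v,
      CounterExec a w β (emit a N cM Y.state (o.map fun x => cM.code (.letter x)))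
        (transducerRegisters cN i j ml mr Y) Y.inputPos e v Y.inputPos →
      CounterExec a w β (produceStep a N cN cM X.state)
        (transducerRegisters cN i j ml mr X) X.inputPos e v Y.inputPos := by
  have := N.finite_state
  have := N.finite_work
  have hY : N.Reaches w Y := hX.tail hstep
  obtain ⟨t, ht, rfl⟩ := Option.map_eq_some_iff.1 hstep
  refine ⟨t.2.2.2.2, rfl, fun j e v hemit => ?_⟩
  have hwork (hd : t.2.2.1 = .left) : 0 < X.workPos := Nat.pos_of_ne_zero fun h0 =>
    N.δ_work _ _ t (by rwa [h0, Transducer.tapeRead_work_zero hX] at ht) hd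
  have hleft (h0 : X.inputPos = 0) : t.2.1 ≠ .left :=
    N.δ_input_left _ _ t (by rwa [tapeRead_inputTape_eq_marker_iff.2 h0] at ht)
  have hright (hlt : w.length < X.inputPos) : t.2.1 ≠ .right :=
    N.δ_input_right _ _ t (by rwa [tapeRead_inputTape_eq_blank_iff.2 hlt] at ht)
  refine (counterExec_peek_rightNum (p := X.workPos) (by decide) rfl rfl (hβ X hX)).bind
    (counterExec_readInput.bind ?_)
  rw [cN.decode_code, ht]
  have hwrite := counterExec_writeMove (a := a) (w := w) (i := X.inputPos) (c := cN)
    (v := transducerRegisters cN i j ml mr X) (l := 4) (r := 5) (t := 6) (by decide) (by decide)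
    (by decide) rfl rfl rfl (hβ _ hY) hwork
  rw [transducerRegisters, update_registers_four, update_registers_five] at hwrite
  exact hwrite.bind ((counterExec_moveInput hleft hright).bind hemit)

theorem counterExec_produce
    (hβ : ∀ C, N.Reaches w C → (cN.top + 1) ^ C.work.length ≤ 2 ^ β) {Z : N.Config}
    (hX : N.Reaches w X) (hhalt : N.step w Z = none)
    (hXZ : Relation.ReflTransGen (fun C₁ C₂ => N.step w C₁ = some C₂) X Z) :
    ∃ j' nl nr i', CounterExec a w β (produce a N cN cM X.state)
      (transducerRegisters cN i j ml mr X) X.inputPos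
      (cM.code (tapeRead (inputTape Z.output) (X.output.length + j + 1)))
      (registers i j' ml mr nl nr) i' := by
  have := N.finite_state
  induction hXZ using Relation.ReflTransGen.head_induction_on generalizing j with
  | refl =>
    have hblank : tapeRead (inputTape Z.output) (Z.output.length + j + 1) = .blank :=
      tapeRead_inputTape_eq_blank_iff.2 (by lia)
    rw [hblank]
    exact ⟨j, _, _, _, (counterExec_produceStep_of_halt hβ hX hhalt).iter_exit⟩
  | @head X Y hstep hYZ ih =>
    have hY : N.Reaches w Y := hX.tail hstep
    obtain ⟨o, hout, hprod⟩ := counterExec_produceStep_of_step (a := a) (cM := cM) (i := i)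
      (ml := ml) (mr := mr) hβ hX hstep
    cases o with
    | none =>
      obtain ⟨j', nl, nr, i', hrest⟩ := ih hY (j := j)
      rw [hout, Option.toList_none, List.append_nil] at hrest
      exact ⟨j', nl, nr, i', (hprod j _ _ counterExec_ret).iter_next hrest⟩
    | some x =>
      have hdec := counterExec_dec (a := a) (w := w) (β := β) (i := Y.inputPos) (r := 1)
        (v := transducerRegisters cN i j ml mr Y)
      rw [transducerRegisters, update_registers_one, ← transducerRegisters] at hdec
      have hstep := hprod j _ _ (hdec.bind counterExec_ret)
      cases j with
      | zero =>
        have hx : tapeRead (inputTape Z.output) (X.output.length + 0 + 1) = .letter x := by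
          obtain ⟨s, hs⟩ := Transducer.isPrefix_output hYZ
          simp [tapeRead_inputTape_succ, ← hs, hout]
        rw [hx]
        exact ⟨_, _, _, _, hstep.iter_exit⟩
      | succ j =>
        obtain ⟨j', nl, nr, i', hrest⟩ := ih hY (j := j)
        rw [hout, Option.toList_some, List.length_append, List.length_singleton,
          Nat.add_right_comm _ 1, Nat.add_assoc _ j] at hrest
        exact ⟨j', nl, nr, i', hstep.iter_next hrest⟩

theorem counterExec_fetchInput
    (hβ : ∀ C, N.Reaches w C → (cN.top + 1) ^ C.work.length ≤ 2 ^ β) {Z : N.Config}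
    (hZ : N.Reaches w Z) (hhalt : N.step w Z = none) (hi : i < 2 ^ β) :
    CounterExec a w β (fetchInput a N cN cM) (registers i 0 ml mr 0 0) 0
      (cM.code (tapeRead (inputTape Z.output) i)) (registers i 0 ml mr 0 0) 0 := by
  have hcopy := counterExec_copy (a := a) (w := w) (i := 0) (r := 0) (s := 1) (t := 6)
    (v := registers i 0 ml mr 0 0) (by decide) (by decide) (by decide) rfl rfl hi
  have hdec := counterExec_dec (a := a) (w := w) (β := β) (i := 0) (r := 1)
    (v := registers i i ml mr 0 0)
  rw [update_registers_one] at hcopy hdec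
  refine hcopy.bind (hdec.bind ?_)
  cases i with
  | zero => exact counterExec_ret
  | succ j =>
    obtain ⟨j', nl, nr, i', hproduce⟩ := counterExec_produce (a := a) (cM := cM) (i := j + 1)
      (j := j) (ml := ml) (mr := mr) hβ .refl hhalt hZ
    have hlt : (cN.code .marker : ℕ) < 2 ^ β :=
      (cN.code .marker).isLt.trans_le ((pow_one _).symm.trans_le (hβ N.initial .refl))
    have hmarker := counterExec_incBy (a := a) (w := w) (β := β) (i := 0) (r := 5)
      (k := cN.code .marker) (v := registers (j + 1) j ml mr 0 0) (by simpa [registers] using hlt)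
    rw [update_registers_five] at hmarker
    have hclear₁ := counterExec_clear (a := a) (w := w) (β := β) (i := i') (r := 1)
      (v := registers (j + 1) j' ml mr nl nr)
    have hclear₄ := counterExec_clear (a := a) (w := w) (β := β) (i := i') (r := 4)
      (v := registers (j + 1) 0 ml mr nl nr)
    have hclear₅ := counterExec_clear (a := a) (w := w) (β := β) (i := i') (r := 5)
      (v := registers (j + 1) 0 ml mr 0 nr)
    rw [update_registers_one] at hclear₁
    rw [update_registers_four] at hclear₄
    rw [update_registers_five] at hclear₅
    rw [if_pos (by simp [registers])]
    refine hmarker.bind (CounterExec.bind ?_ (hclear₁.bind (hclear₄.bind (hclear₅.bind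
      (counterExec_rewindInput.bind counterExec_ret)))))
    simpa [transducerRegisters, Transducer.initial, SymCode.leftNum, SymCode.rightNum, registers]
      using hproduce

theorem counterExec_fetch
    (hβ : ∀ C, N.Reaches w C → (cN.top + 1) ^ C.work.length ≤ 2 ^ β) {Z : N.Config}
    (hZ : N.Reaches w Z) (hhalt : N.step w Z = none) (hi : i < 2 ^ β)
    (hy : (cM.top + 1) ^ y.length ≤ 2 ^ β) :
    CounterExec a w β (fetch a N cN cM) (registers i 0 ml (cM.rightNum y p) 0 0) 0
      (cM.code (tapeRead (inputTape Z.output) i), cM.code (tapeRead y p))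
      (registers i 0 ml (cM.rightNum y p) 0 0) 0 :=
  (counterExec_fetchInput hβ hZ hhalt hi).bind
    ((counterExec_peek_rightNum (by decide) rfl rfl hy).bind counterExec_ret)

end Transducer

end Prog

/-! ### Deterministic steps -/

/-- `Trace r l x y`: there are steps of `r` from `x` to `y`, and `l` lists the elements before
`y`. -/
inductive Trace {α : Type u} (r : α → α → Prop) : List α → α → α → Prop
  | nil (x : α) : Trace r [] x x
  | cons {x y z : α} {l : List α} : r x y → Trace r l y z → Trace r (x :: l) x z

namespace Trace

variable {α : Type u} {r : α → α → Prop} {l : List α} {x y z : α}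

theorem exists_suffix (h : Trace r l x y) (hz : z ∈ l) : ∃ l', Trace r l' z y ∧ l' <:+ l := by
  induction h with
  | nil => simp at hz
  | @cons x _ _ l hstep hrest ih =>
    rcases List.mem_cons.1 hz with rfl | hz
    · exact ⟨_, .cons hstep hrest, List.suffix_rfl⟩
    · obtain ⟨l', hl', hsuff⟩ := ih hz
      exact ⟨l', hl', hsuff.trans (List.suffix_cons x l)⟩

theorem exists_nodup (h : Relation.ReflTransGen r x y) : ∃ l, Trace r l x y ∧ l.Nodup := by
  induction h using Relation.ReflTransGen.head_induction_on with
  | refl => exact ⟨[], .nil y, List.nodup_nil⟩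
  | @head x _ hstep _ ih =>
    obtain ⟨l, hl, hnodup⟩ := ih
    by_cases hx : x ∈ l
    · obtain ⟨l', hl', hsuff⟩ := hl.exists_suffix hx
      exact ⟨l', hl', hnodup.sublist hsuff.sublist⟩
    · exact ⟨x :: l, .cons hstep hl, hnodup.cons hx⟩

theorem forall_mem {P : α → Prop} (hP : ∀ x y, r x y → P x) (h : Trace r l x y) : ∀ z ∈ l, P z := by
  induction h with
  | nil => simp
  | cons hstep _ ih => exact List.forall_mem_cons.2 ⟨hP _ _ hstep, ih⟩

theorem mono {s : α → α → Prop} (hrs : ∀ x y, r x y → s x y) (h : Trace r l x y) :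
    Trace s l x y := by
  induction h with
  | nil x => exact .nil x
  | cons hstep _ ih => exact .cons (hrs _ _ hstep) ih

end Trace

namespace LTree

variable {L : Type u}

/-- The tree `t` with the path `l` put above its root. -/
def wrap (l : List L) (t : LTree L) : LTree L := l.foldr (fun a t => node a [t]) t

theorem wrap_cons (a : L) (l : List L) (t : LTree L) : wrap (a :: l) t = node a [wrap l t] := rfl

theorem nodes_wrap (l : List L) (t : LTree L) : (wrap l t).nodes = l ++ t.nodes := by
  induction l with
  | nil => rfl
  | cons a l ih => simp [wrap_cons, nodes_node, ih]

theorem size_wrap (l : List L) (t : LTree L) : (wrap l t).size = l.length + t.size := by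
  simp [size, nodes_wrap]

theorem leaves_wrap (l : List L) (t : LTree L) : (wrap l t).leaves = t.leaves := by
  induction l with
  | nil => rfl
  | cons a l ih => simp [wrap_cons, leaves_node, ih]

end LTree

namespace ATO

variable {Λ : Type u} {M : ATO Λ} {C D E : M.Config} {k : ℕ}
  {l Cs : List M.Config} {t T : LTree M.Config} {ts : List (LTree M.Config)}

theorem not_universal_of_existential {s : M.State} (h : s ∈ M.existential) : s ∉ M.universal :=
  Set.disjoint_left.1 M.disjoint h

theorem existential_iff_not_universal {s : M.State} (h : ¬(s = M.accept ∨ s = M.reject)) :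
    s ∈ M.existential ↔ s ∉ M.universal :=
  ⟨not_universal_of_existential, (mem_existential_or_universal_iff.2 (not_or.1 h)).resolve_right⟩

variable (M) in
/-- The configurations `Cs` may be the labels of the children of an inner node of a run that is
labelled with `C`. -/
def IsChoice (C : M.Config) (Cs : List M.Config) : Prop :=
  (C.state ∈ M.existential ∧ ∃ C' ∈ M.next C, Cs = [C']) ∨
    (C.state ∈ M.universal ∧ Cs ≠ [] ∧ Cs.Nodup ∧ ∀ C', C' ∈ Cs ↔ C' ∈ M.next C)

theorem IsChoice.not_halting (h : M.IsChoice C Cs) :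
    ¬(C.state = M.accept ∨ C.state = M.reject) :=
  h.elim (fun h => not_halting_of_existential h.1) fun h => not_halting_of_universal h.1

theorem IsChoice.ne_nil (h : M.IsChoice C Cs) : Cs ≠ [] := by
  rcases h with ⟨-, C', -, rfl⟩ | ⟨-, hne, -⟩
  · exact List.cons_ne_nil _ _
  · exact hne

theorem IsChoice.mem_next (h : M.IsChoice C Cs) : ∀ C' ∈ Cs, C' ∈ M.next C := by
  rcases h with ⟨-, C', hC', rfl⟩ | ⟨-, -, -, hnext⟩
  · exact List.forall_mem_singleton.2 hC'
  · exact fun C' => (hnext C').1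

theorem isChoice_map_iff {Λ' : Type v} {M' : ATO Λ'} {D : M'.Config} {φ : M.Config → M'.Config}
    (hex : D.state ∈ M'.existential ↔ C.state ∈ M.existential)
    (huniv : D.state ∈ M'.universal ↔ C.state ∈ M.universal)
    (hφ : Set.BijOn φ (M.next C) (M'.next D)) (hCs : ∀ C' ∈ Cs, C' ∈ M.next C) :
    M'.IsChoice D (Cs.map φ) ↔ M.IsChoice C Cs := by
  have hsingle : (∃ D' ∈ M'.next D, Cs.map φ = [D']) ↔ ∃ C' ∈ M.next C, Cs = [C'] := by
    constructor
    · rintro ⟨D', -, h⟩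
      obtain ⟨C', rfl, -⟩ := List.map_eq_singleton_iff.1 h
      exact ⟨C', hCs C' (List.mem_singleton_self C'), rfl⟩
    · rintro ⟨C', hC', rfl⟩
      exact ⟨φ C', hφ.mapsTo hC', rfl⟩
  have hnodup : (Cs.map φ).Nodup ↔ Cs.Nodup :=
    ⟨List.Nodup.of_map φ, fun h => h.map_on fun x hx y hy hxy =>
      hφ.injOn (hCs x hx) (hCs y hy) hxy⟩
  have hall : (∀ D', D' ∈ Cs.map φ ↔ D' ∈ M'.next D) ↔ ∀ C', C' ∈ Cs ↔ C' ∈ M.next C := by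
    refine ⟨fun h C' => ⟨hCs C', fun hC' => ?_⟩, fun h D' => ?_⟩
    · obtain ⟨C'', hC'', heq⟩ := List.mem_map.1 ((h _).2 (hφ.mapsTo hC'))
      rwa [← hφ.injOn (hCs _ hC'') hC' heq]
    · rw [← hφ.image_eq, List.mem_map, Set.mem_image]
      simp only [h]
  rw [IsChoice, IsChoice, hex, huniv, hsingle, hnodup, hall, ne_eq, List.map_eq_nil_iff]

theorem isRun_node_iff : M.IsRun (.node C ts) ↔
    (C.state = M.accept ∨ C.state = M.reject) ∧ ts = [] ∨
      M.IsChoice C (ts.map LTree.root) ∧ ∀ t ∈ ts, M.IsRun t := by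
  constructor
  · intro h
    cases h with
    | halt _ hC => exact .inl ⟨hC, rfl⟩
    | existential _ t hC ht hrun =>
      exact .inr ⟨.inl ⟨hC, _, ht, rfl⟩, List.forall_mem_singleton.2 hrun⟩
    | universal _ _ hC hts hnodup hnext hrun =>
      exact .inr ⟨.inr ⟨hC, List.map_eq_nil_iff.not.2 hts, hnodup, hnext⟩, hrun⟩
  · rintro (⟨hC, rfl⟩ | ⟨⟨hC, C', hC', hts⟩ | ⟨hC, hts, hnodup, hnext⟩, hrun⟩)
    · exact .halt C hC
    · obtain ⟨t, rfl, rfl⟩ := List.map_eq_singleton_iff.1 hts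
      exact .existential C t hC hC' (hrun t (List.mem_singleton_self t))
    · exact .universal C ts hC (List.map_eq_nil_iff.not.1 hts) hnodup hnext hrun

variable (M) in
/-- A deterministic step from a configuration that does not contribute to the output. -/
def Det (C D : M.Config) : Prop :=
  C.state ∈ M.existential ∧ C.state ∉ M.labeling ∧ M.next C = {D}

theorem outputForest_wrap (hl : ∀ C ∈ l, C.state ∉ M.labeling) (t : LTree M.Config) :
    M.outputForest (.wrap l t) = M.outputForest t := by
  induction l with
  | nil => rfl
  | cons C l ih =>
    rw [List.forall_mem_cons] at hl
    rw [LTree.wrap_cons, outputForest_of_not_labeling hl.1, List.flatMap_singleton, ih hl.2]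

theorem isAccepting_node (h : ts ≠ []) :
    M.IsAccepting (.node C ts) ↔ ∀ t ∈ ts, M.IsAccepting t := by
  simp only [IsAccepting, LTree.leaves_node C h, List.forall_mem_flatMap]

theorem isAccepting_wrap : M.IsAccepting (.wrap l t) ↔ M.IsAccepting t := by
  simp only [IsAccepting, LTree.leaves_wrap]

theorem IsRun.exists_child (hT : M.IsRun T) (h : T.root.state ∈ M.existential)
    (hD : M.next T.root = {D}) : ∃ t, T = .node T.root [t] ∧ M.IsRun t ∧ t.root = D := by
  obtain ⟨C, ts⟩ := T
  rcases isRun_node_iff.1 hT with ⟨hC, -⟩ | ⟨⟨-, C', hC', hts⟩ | ⟨huniv, -⟩, hrun⟩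
  · exact (not_halting_of_existential h hC).elim
  · obtain ⟨t, rfl, rfl⟩ := List.map_eq_singleton_iff.1 hts
    exact ⟨t, rfl, hrun t (List.mem_singleton_self t), (hD.subset hC' :)⟩
  · exact (not_universal_of_existential h huniv).elim

theorem IsRun.exists_eq_wrap (h : Trace M.Det l D E) (hT : M.IsRun T) (hroot : T.root = D) :
    ∃ t, T = .wrap l t ∧ M.IsRun t ∧ t.root = E := by
  induction h generalizing T with
  | nil => exact ⟨T, rfl, hT, hroot⟩
  | cons hstep _ ih =>
    subst hroot
    obtain ⟨t, hTt, ht, htroot⟩ := hT.exists_child hstep.1 hstep.2.2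
    obtain ⟨u, rfl, hu⟩ := ih ht htroot
    exact ⟨u, hTt, hu⟩

theorem root_wrap (h : Trace M.Det l D E) (ht : t.root = E) : (LTree.wrap l t).root = D := by
  cases h with
  | nil => exact ht
  | cons => rfl

theorem IsRun.wrap (h : Trace M.Det l D E) (ht : M.IsRun t) (hroot : t.root = E) :
    M.IsRun (.wrap l t) := by
  induction h with
  | nil => exact ht
  | cons hstep hrest ih =>
    refine .existential _ (.wrap _ t) hstep.1 ?_ (ih hroot)
    rw [hstep.2.2, root_wrap hrest hroot]
    rfl

/-! ### Universal nodes on paths -/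

open Classical in
variable (M) in
/-- Paths from the root without labelling nodes have at most `k` universal nodes. -/
def RootBound (k : ℕ) (T : LTree M.Config) : Prop :=
  ∀ p : List M.Config, T.RootPath p → (∀ C ∈ p, C.state ∉ M.labeling) →
    p.countP (fun C => decide (C.state ∈ M.universal)) ≤ k

open Classical in
variable (M) in
/-- Paths without labelling nodes have at most `k` universal nodes. -/
def PathBound (k : ℕ) (T : LTree M.Config) : Prop :=
  ∀ p : List M.Config, T.IsPath p → (∀ C ∈ p, C.state ∉ M.labeling) →
    p.countP (fun C => decide (C.state ∈ M.universal)) ≤ k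

theorem RootBound.mono {m : ℕ} (hmk : m ≤ k) (h : M.RootBound m T) : M.RootBound k T :=
  fun p hp hlab => (h p hp hlab).trans hmk

theorem rootBound_of_labeling (h : C.state ∈ M.labeling) : M.RootBound k (.node C ts) := by
  intro p hp hlab
  cases hp <;> exact (hlab C List.mem_cons_self h).elim

theorem rootBound_node_iff (hC : C.state ∉ M.labeling) (hC' : C.state ∉ M.universal) :
    M.RootBound k (.node C ts) ↔ ∀ t ∈ ts, M.RootBound k t := by
  constructor
  · intro h t ht p hp hlab
    simpa [hC'] using h (C :: p) (.cons C ts t p ht hp) (List.forall_mem_cons.2 ⟨hC, hlab⟩)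
  · intro h p hp hlab
    cases hp with
    | single => simp [hC']
    | cons _ _ t p ht hp => simpa [hC'] using h t ht p hp (List.forall_mem_cons.1 hlab).2

theorem rootBound_node_universal_iff (hC : C.state ∉ M.labeling) (hC' : C.state ∈ M.universal) :
    M.RootBound k (.node C ts) ↔ 1 ≤ k ∧ ∀ t ∈ ts, M.RootBound (k - 1) t := by
  constructor
  · intro h
    have hk : 1 ≤ k := by
      simpa [hC'] using h [C] (.single C ts) (List.forall_mem_singleton.2 hC)
    refine ⟨hk, fun t ht p hp hlab => Nat.le_sub_of_add_le ?_⟩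
    simpa [hC'] using h (C :: p) (.cons C ts t p ht hp) (List.forall_mem_cons.2 ⟨hC, hlab⟩)
  · rintro ⟨hk, h⟩ p hp hlab
    cases hp with
    | single => simpa [hC'] using hk
    | cons _ _ t p ht hp =>
      have := h t ht p hp (List.forall_mem_cons.1 hlab).2
      rw [List.countP_cons_of_pos (by simpa using hC')]
      lia

theorem rootBound_succ_node (h : ∀ t ∈ ts, M.RootBound k t) : M.RootBound (k + 1) (.node C ts) := by
  by_cases hC : C.state ∈ M.labeling
  · exact rootBound_of_labeling hC
  by_cases hC' : C.state ∈ M.universal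
  · exact (rootBound_node_universal_iff hC hC').2 ⟨Nat.le_add_left 1 k, h⟩
  · exact (rootBound_node_iff hC hC').2 fun t ht => (h t ht).mono k.le_succ

theorem pathBound_node_iff :
    M.PathBound k (.node C ts) ↔ M.RootBound k (.node C ts) ∧ ∀ t ∈ ts, M.PathBound k t := by
  constructor
  · exact fun h => ⟨fun p hp => h p (.here _ p hp), fun t ht p hp => h p (.inside C ts t p ht hp)⟩
  · rintro ⟨hroot, h⟩ p hp
    cases hp with
    | here _ _ hp => exact hroot p hp
    | inside _ _ t p ht hp => exact h t ht p hp

theorem PathBound.rootBound (h : M.PathBound k T) : M.RootBound k T :=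
  fun p hp => h p (.here T p hp)

theorem rootBound_wrap (h : Trace M.Det l D E) :
    M.RootBound k (.wrap l t) ↔ M.RootBound k t := by
  induction h with
  | nil => rfl
  | cons hstep _ ih =>
    rw [LTree.wrap_cons, rootBound_node_iff hstep.2.1 (not_universal_of_existential hstep.1),
      List.forall_mem_singleton, ih]

theorem PathBound.wrap (h : Trace M.Det l D E) (ht : M.PathBound k t) :
    M.PathBound k (.wrap l t) := by
  induction h with
  | nil => exact ht
  | cons hstep hrest ih =>
    exact pathBound_node_iff.2 ⟨(rootBound_wrap (.cons hstep hrest)).2 ht.rootBound,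
      List.forall_mem_singleton.2 ih⟩

end ATO

/-! ### Simulations between alternating machines -/

namespace ATO

variable {Λ : Type u} {Λ' : Type v} {M : ATO Λ} {M' : ATO Λ'}

/-- The deterministic steps along `l` lead from `D` to `E`; there are at most `k` of them, and they
stay within `b`. -/
structure Passage (b : Set M'.Config) (k : ℕ) (l : List M'.Config) (D E : M'.Config) : Prop where
  trace : Trace M'.Det l D E
  length_le : l.length ≤ k
  mem : ∀ X ∈ l, X ∈ b

theorem Passage.not_labeling {b : Set M'.Config} {k : ℕ} {l : List M'.Config} {D E : M'.Config}
    (h : Passage b k l D E) : ∀ X ∈ l, X.state ∉ M'.labeling :=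
  h.trace.forall_mem fun _ _ hstep => hstep.2.1

variable (M M') in
/-- The data of a simulation of `M` by `M'`. Its relation between configurations is graded by space
bounds: `need C` is the space for simulating steps from or to `C`, and with space `m` the
simulation of a step takes up to two passages of at most `steps m` steps within `bounded m`. -/
structure Correspondence where
  encode : List (TapeSym Λ) → List (TapeSym Λ')
  Rel : ℕ → M.Config → M'.Config → Prop
  need : M.Config → ℕ
  bounded : ℕ → Set M'.Config
  steps : ℕ → ℕ

namespace Correspondence

variable (S : Correspondence M M')

/-- The steps of `M'` that simulate a step from `C`: the configuration `E` is determined first, then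
a choice of `M` is copied by means of `φ`, and its effect is computed. -/
structure Round (m : ℕ) (C : M.Config) (D D₁ E : M'.Config) (l : List M'.Config)
    (φ : M.Config → M'.Config) : Prop where
  existential : D.state ∈ M'.existential
  next_eq : M'.next D = {D₁}
  passage : Passage (S.bounded m) (S.steps m) l D₁ E
  mem_bounded : E ∈ S.bounded m
  not_labeling : E.state ∉ M'.labeling
  existential_iff : E.state ∈ M'.existential ↔ C.state ∈ M.existential
  universal_iff : E.state ∈ M'.universal ↔ C.state ∈ M.universal
  bijOn : Set.BijOn φ (M.next C) (M'.next E)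
  exists_passage : ∀ C' ∈ M.next C, ∃ l' D',
    Passage (S.bounded (max m (S.need C'))) (S.steps (max m (S.need C'))) l' (φ C') D' ∧
      S.Rel (max m (S.need C')) C' D'

/-- Related configurations agree up to the encoding of labels, and `M'` simulates the steps of `M`
from them. -/
structure IsSimulation : Prop where
  monotone_bounded : Monotone S.bounded
  monotone_steps : Monotone S.steps
  mem_bounded {m C D} : S.Rel m C D → D ∈ S.bounded m
  labeling_iff {m C D} : S.Rel m C D → (D.state ∈ M'.labeling ↔ C.state ∈ M.labeling)
  label_eq {m C D} : S.Rel m C D → D.label = S.encode C.label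
  accept_iff {m C D} : S.Rel m C D → (D.state = M'.accept ↔ C.state = M.accept)
  reject_iff {m C D} : S.Rel m C D → (D.state = M'.reject ↔ C.state = M.reject)
  exists_round {m C D} : S.Rel m C D → ¬(C.state = M.accept ∨ C.state = M.reject) →
    ∃ D₁ E l φ, S.Round m C D D₁ E l φ

/-- The run `T'` of `M'` simulates the run `T` of `M`. In the case of an inner node, the members
`(t, l', t')` of `L` are the subtrees `t` of `T`, each with the passage `l'` to the tree `t'` that
simulates it. -/
inductive Simulates : ℕ → LTree M.Config → LTree M'.Config → Prop
  | halt {m : ℕ} {C : M.Config} {D : M'.Config} :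
      S.Rel m C D → C.state = M.accept ∨ C.state = M.reject → Simulates m (.node C []) (.node D [])
  | node {m : ℕ} {C : M.Config} {D D₁ E : M'.Config} {l : List M'.Config}
      {φ : M.Config → M'.Config} (L : List (LTree M.Config × List M'.Config × LTree M'.Config)) :
      S.Rel m C D → S.Round m C D D₁ E l φ → M.IsChoice C (L.map fun x => x.1.root) →
      (∀ x ∈ L, Passage (S.bounded (max m (S.need x.1.root))) (S.steps (max m (S.need x.1.root)))
        x.2.1 (φ x.1.root) x.2.2.root) →
      (∀ x ∈ L, Simulates (max m (S.need x.1.root)) x.1 x.2.2) →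
      Simulates m (.node C (L.map fun x => x.1))
        (.node D [.wrap l (.node E (L.map fun x => .wrap x.2.1 x.2.2))])

variable {S} {m β k : ℕ} {C : M.Config} {D D₁ E : M'.Config} {l : List M'.Config}
  {φ : M.Config → M'.Config} {T : LTree M.Config} {T' : LTree M'.Config}

theorem Round.isChoice_map_iff (h : S.Round m C D D₁ E l φ) {Cs : List M.Config}
    (hCs : ∀ C' ∈ Cs, C' ∈ M.next C) : M'.IsChoice E (Cs.map φ) ↔ M.IsChoice C Cs :=
  ATO.isChoice_map_iff h.existential_iff h.universal_iff h.bijOn hCs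

namespace Simulates

theorem isRun (h : S.Simulates m T T') : M.IsRun T := by
  induction h with
  | halt _ hC => exact .halt _ hC
  | node L _ _ hchoice _ _ ih =>
    refine isRun_node_iff.2 (.inr ⟨by rwa [List.map_map], ?_⟩)
    simpa only [List.forall_mem_map] using ih

theorem isRun' (hS : S.IsSimulation) (h : S.Simulates m T T') : M'.IsRun T' := by
  induction h with
  | halt hR hC =>
    exact .halt _ (hC.imp (hS.accept_iff hR).2 (hS.reject_iff hR).2)
  | @node _ _ _ _ E _ φ L _ hround hchoice hpass _ ih =>
    have hroots : (L.map fun x => LTree.wrap x.2.1 x.2.2).map LTree.root =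
        (L.map fun x => x.1.root).map φ := by
      rw [List.map_map, List.map_map]
      exact List.map_congr_left fun x hx => root_wrap (hpass x hx).trace rfl
    have hE : M'.IsRun (.node E (L.map fun x => .wrap x.2.1 x.2.2)) := by
      refine isRun_node_iff.2 (.inr ⟨?_, List.forall_mem_map.2 fun x hx =>
        (ih x hx).wrap (hpass x hx).trace rfl⟩)
      rw [hroots]
      exact (hround.isChoice_map_iff hchoice.mem_next).2 hchoice
    refine .existential _ _ hround.existential ?_ (hE.wrap hround.passage.trace rfl)
    rw [hround.next_eq, root_wrap hround.passage.trace rfl]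
    rfl

theorem isAccepting_iff (hS : S.IsSimulation) (h : S.Simulates m T T') :
    M'.IsAccepting T' ↔ M.IsAccepting T := by
  induction h with
  | halt hR => simpa [IsAccepting, LTree.leaves] using hS.accept_iff hR
  | node L _ _ hchoice _ _ ih =>
    have hL : L ≠ [] := by simpa using hchoice.ne_nil
    rw [isAccepting_node (List.cons_ne_nil _ _), List.forall_mem_singleton, isAccepting_wrap,
      isAccepting_node (by simpa), isAccepting_node (by simpa), List.forall_mem_map,
      List.forall_mem_map]
    exact forall₂_congr fun x hx => isAccepting_wrap.trans (ih x hx)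

theorem outputForest_node (hS : S.IsSimulation) (hR : S.Rel m C D) {ts : List (LTree M.Config)}
    {ts' : List (LTree M'.Config)}
    (hts : ts'.flatMap M'.outputForest = (ts.flatMap M.outputForest).map (.map S.encode)) :
    M'.outputForest (.node D ts') = (M.outputForest (.node C ts)).map (.map S.encode) := by
  by_cases hC : C.state ∈ M.labeling
  · rw [outputForest_of_labeling ((hS.labeling_iff hR).2 hC), outputForest_of_labeling hC, hts,
      hS.label_eq hR, List.map_singleton, LTree.map, LTree.mapList_eq_map]
  · rw [outputForest_of_not_labeling ((hS.labeling_iff hR).not.2 hC),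
      outputForest_of_not_labeling hC, hts]

theorem outputForest_eq (hS : S.IsSimulation) (h : S.Simulates m T T') :
    M'.outputForest T' = (M.outputForest T).map (.map S.encode) := by
  induction h with
  | halt hR => exact outputForest_node hS hR rfl
  | node L hR hround _ hpass _ ih =>
    refine outputForest_node hS hR ?_
    rw [List.flatMap_singleton, outputForest_wrap hround.passage.not_labeling,
      outputForest_of_not_labeling hround.not_labeling, List.flatMap_map, List.flatMap_map,
      List.map_flatMap]
    exact List.flatMap_congr fun x hx =>
      (outputForest_wrap (hpass x hx).not_labeling _).trans (ih x hx)

theorem rootBound (hS : S.IsSimulation) (h : S.Simulates m T T') (hT : M.RootBound k T) :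
    M'.RootBound k T' := by
  induction h generalizing k with
  | @halt _ C D hR hC =>
    have hD : D.state ∉ M'.universal := fun hD => not_halting_of_universal hD
      (hC.imp (hS.accept_iff hR).2 (hS.reject_iff hR).2)
    by_cases hlab : D.state ∈ M'.labeling
    · exact rootBound_of_labeling hlab
    · exact (rootBound_node_iff hlab hD).2 (by simp)
  | @node _ C D _ E _ _ L hR hround _ hpass _ ih =>
    have hchild (x) (hx : x ∈ L) {k : ℕ} (hk : M.RootBound k x.1) :
        M'.RootBound k (.wrap x.2.1 x.2.2) := (rootBound_wrap (hpass x hx).trace).2 (ih x hx hk)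
    by_cases hlab : C.state ∈ M.labeling
    · exact rootBound_of_labeling ((hS.labeling_iff hR).2 hlab)
    rw [rootBound_node_iff ((hS.labeling_iff hR).not.2 hlab)
      (not_universal_of_existential hround.existential), List.forall_mem_singleton,
      rootBound_wrap hround.passage.trace]
    by_cases huniv : C.state ∈ M.universal
    · rw [rootBound_node_universal_iff hlab huniv, List.forall_mem_map] at hT
      rw [rootBound_node_universal_iff hround.not_labeling (hround.universal_iff.2 huniv),
        List.forall_mem_map]
      exact ⟨hT.1, fun x hx => hchild x hx (hT.2 x hx)⟩
    · rw [rootBound_node_iff hlab huniv, List.forall_mem_map] at hT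
      rw [rootBound_node_iff hround.not_labeling (hround.universal_iff.not.2 huniv),
        List.forall_mem_map]
      exact fun x hx => hchild x hx (hT x hx)

/-- The bound grows by one since a path may start at the universal configuration in the middle of a
round, whereas the configuration at the beginning of the round is labelling. -/
theorem pathBound (hS : S.IsSimulation) (h : S.Simulates m T T') (hT : M.PathBound k T) :
    M'.PathBound (k + 1) T' := by
  have hroot := (h.rootBound hS hT.rootBound).mono k.le_succ
  induction h with
  | halt => exact pathBound_node_iff.2 ⟨hroot, by simp⟩
  | @node _ C D _ E _ _ L _ hround _ hpass hsim ih =>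
    have hsub := (pathBound_node_iff.1 hT).2
    rw [List.forall_mem_map] at hsub
    have hchild (x) (hx : x ∈ L) : M'.RootBound k x.2.2 :=
      (hsim x hx).rootBound hS (hsub x hx).rootBound
    refine pathBound_node_iff.2 ⟨hroot, List.forall_mem_singleton.2
      (.wrap hround.passage.trace (pathBound_node_iff.2
        ⟨rootBound_succ_node (List.forall_mem_map.2 fun x hx =>
          (rootBound_wrap (hpass x hx).trace).2 (hchild x hx)),
        List.forall_mem_map.2 fun x hx => .wrap (hpass x hx).trace
          (ih x hx (hsub x hx) ((hchild x hx).mono k.le_succ))⟩))⟩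

theorem need_le_of_mem {L : List (LTree M.Config × List M'.Config × LTree M'.Config)}
    (hneed : ∀ C' ∈ (LTree.node C (L.map fun x => x.1)).nodes, S.need C' ≤ β) :
    ∀ x ∈ L, ∀ C' ∈ x.1.nodes, S.need C' ≤ β := by
  intro x hx C' hC'
  refine hneed C' ?_
  rw [LTree.nodes_node]
  exact List.mem_cons_of_mem _ (List.mem_flatMap.2 ⟨_, List.mem_map_of_mem hx, hC'⟩)

theorem mem_bounded (hS : S.IsSimulation) (h : S.Simulates m T T') (hm : m ≤ β)
    (hneed : ∀ C ∈ T.nodes, S.need C ≤ β) : ∀ X ∈ T'.nodes, X ∈ S.bounded β := by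
  induction h with
  | halt hR =>
    rw [LTree.nodes_node, List.flatMap_nil, List.forall_mem_singleton]
    exact hS.monotone_bounded hm (hS.mem_bounded hR)
  | node L hR hround _ hpass _ ih =>
    have hneed' := need_le_of_mem hneed
    have hm' (x) (hx : x ∈ L) := max_le hm (hneed' x hx _ x.1.root_mem_nodes)
    have hE := hS.monotone_bounded hm hround.mem_bounded
    simp only [LTree.nodes_node, LTree.nodes_wrap, List.flatMap_singleton, List.flatMap_map,
      List.forall_mem_cons, List.forall_mem_append, List.forall_mem_flatMap]
    exact ⟨hS.monotone_bounded hm (hS.mem_bounded hR),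
      fun X hX => hS.monotone_bounded hm (hround.passage.mem X hX), hE, fun x hx =>
      ⟨fun X hX => hS.monotone_bounded (hm' x hx) ((hpass x hx).mem X hX),
        ih x hx (hm' x hx) (hneed' x hx)⟩⟩

theorem size_add_le (hS : S.IsSimulation) (h : S.Simulates m T T') (hm : m ≤ β)
    (hneed : ∀ C ∈ T.nodes, S.need C ≤ β) :
    T'.size + S.steps β ≤ (2 * S.steps β + 2) * T.size := by
  induction h with
  | halt =>
    simp only [LTree.size_node, List.map_nil, List.sum_nil]
    lia
  | node L _ hround _ hpass _ ih =>
    have hneed' := need_le_of_mem hneed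
    have hm' (x) (hx : x ∈ L) := max_le hm (hneed' x hx _ x.1.root_mem_nodes)
    have hchildren : (L.map fun x => (LTree.wrap x.2.1 x.2.2).size).sum ≤
        (2 * S.steps β + 2) * (L.map fun x => x.1.size).sum := by
      rw [← List.sum_map_mul_left]
      refine List.sum_le_sum fun x hx => ?_
      have := ih x hx (hm' x hx) (hneed' x hx)
      have := (hpass x hx).length_le.trans (hS.monotone_steps (hm' x hx))
      rw [LTree.size_wrap]
      lia
    have hlength := hround.passage.length_le.trans (hS.monotone_steps hm)
    rw [LTree.size_node, List.map_singleton, List.sum_singleton, LTree.size_wrap]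
    simp only [LTree.size_node, List.map_map, Function.comp_def]
    lia

end Simulates

end Correspondence

theorem IsRun.induction {P : LTree M.Config → Prop}
    (halt : ∀ C : M.Config, C.state = M.accept ∨ C.state = M.reject → P (.node C []))
    (node : ∀ C ts, M.IsChoice C (ts.map LTree.root) → (∀ t ∈ ts, P t) → P (.node C ts))
    {T : LTree M.Config} (hT : M.IsRun T) : P T := by
  induction hT with
  | halt C hC => exact halt C hC
  | existential C t hC hnext _ ih =>
    exact node C [t] (.inl ⟨hC, _, hnext, rfl⟩) (List.forall_mem_singleton.2 ih)
  | universal C ts hC hts hnodup hnext _ ih =>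
    exact node C ts (.inr ⟨hC, List.map_eq_nil_iff.not.2 hts, hnodup, hnext⟩) ih

namespace Correspondence

variable {S : Correspondence M M'} {m : ℕ} {C : M.Config} {D D₁ E : M'.Config}
  {l : List M'.Config} {φ : M.Config → M'.Config} {T : LTree M.Config} {T' : LTree M'.Config}
  {u : List Λ} {w : List Λ'}

theorem exists_simulates_of_isRun (hS : S.IsSimulation) (hT : M.IsRun T) (hR : S.Rel m T.root D) :
    ∃ T', T'.root = D ∧ S.Simulates m T T' := by
  have : Nonempty M'.Config := ⟨D⟩
  have : Nonempty (LTree M'.Config) := ⟨.node D []⟩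
  revert m D
  refine hT.induction (P := fun T => ∀ {m D}, S.Rel m T.root D → ∃ T', T'.root = D ∧
    S.Simulates m T T') (fun C hC m D hR => ⟨.node D [], rfl, .halt hR hC⟩) ?_
  intro C ts hchoice ih m D hR
  obtain ⟨D₁, E, l, φ, hround⟩ := hS.exists_round hR hchoice.not_halting
  choose! passage target hpass hR' using hround.exists_passage
  have hnext (t) (ht : t ∈ ts) := hchoice.mem_next t.root (List.mem_map_of_mem ht)
  choose! F hFroot hF using fun t ht => ih t ht (hR' t.root (hnext t ht))
  let L := ts.map fun t => (t, passage t.root, F t)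
  have hL : L.map (fun x => x.1) = ts := by
    rw [List.map_map]
    exact ts.map_id
  refine ⟨_, rfl, hL ▸ Simulates.node L hR hround ?_ ?_ ?_⟩
  · rwa [← hL, List.map_map] at hchoice
  · refine List.forall_mem_map.2 fun t ht => ?_
    rw [hFroot t ht]
    exact hpass t.root (hnext t ht)
  · exact List.forall_mem_map.2 hF

theorem Round.exists_child (h : S.Round m C D D₁ E l φ) (hT' : M'.IsRun T')
    (hroot : T'.root ∈ M'.next E) : ∃ C' ∈ M.next C, ∃ l' t',
      φ C' = T'.root ∧ T' = .wrap l' t' ∧ M'.IsRun t' ∧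
      Passage (S.bounded (max m (S.need C'))) (S.steps (max m (S.need C'))) l' (φ C') t'.root ∧
        S.Rel (max m (S.need C')) C' t'.root := by
  obtain ⟨C', hC', hφ⟩ := h.bijOn.surjOn hroot
  obtain ⟨l', D', hpass, hR⟩ := h.exists_passage C' hC'
  obtain ⟨t', hT't', ht', rfl⟩ := IsRun.exists_eq_wrap hpass.trace hT' hφ.symm
  exact ⟨C', hC', l', t', hφ, hT't', ht', hpass, hR⟩

theorem Round.exists_eq_node (h : S.Round m C D D₁ E l φ) (hT' : M'.IsRun T') (hroot : T'.root = D)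
    (hC : ¬(C.state = M.accept ∨ C.state = M.reject)) :
    ∃ us, T' = .node D [.wrap l (.node E us)] ∧ M'.IsChoice E (us.map LTree.root) ∧
      ∀ u ∈ us, M'.IsRun u := by
  subst hroot
  obtain ⟨t, hT't, ht, htroot⟩ := hT'.exists_child h.existential h.next_eq
  obtain ⟨⟨E, us⟩, rfl, hE, rfl⟩ := IsRun.exists_eq_wrap h.passage.trace ht htroot
  refine ⟨us, hT't, (isRun_node_iff.1 hE).resolve_left fun hhalt => ?_⟩
  have hC' := mem_existential_or_universal_iff.2 (not_or.1 hC)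
  rw [← h.existential_iff, ← h.universal_iff] at hC'
  exact not_or.2 (mem_existential_or_universal_iff.1 hC') hhalt.1

theorem exists_isRun_simulates (hS : S.IsSimulation) (hT' : M'.IsRun T')
    (hR : S.Rel m C T'.root) : ∃ T, T.root = C ∧ S.Simulates m T T' := by
  have : Nonempty (LTree M.Config) := ⟨.node C []⟩
  have : Nonempty (LTree M'.Config) := ⟨T'⟩
  induction hsize : T'.size using Nat.strong_induction_on generalizing T' m C with
  | _ n ih =>
  subst hsize
  by_cases hC : C.state = M.accept ∨ C.state = M.reject
  · obtain ⟨D, ts⟩ := T'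
    rcases isRun_node_iff.1 hT' with ⟨-, rfl⟩ | ⟨hchoice, -⟩
    · exact ⟨.node C [], rfl, .halt hR hC⟩
    · exact (hchoice.not_halting (hC.imp (hS.accept_iff hR).2 (hS.reject_iff hR).2)).elim
  obtain ⟨D₁, E, l, φ, hround⟩ := hS.exists_round hR hC
  obtain ⟨us, hT'us, hchoice, hus⟩ := hround.exists_eq_node hT' rfl hC
  have hchild : ∀ u ∈ us, ∃ x : LTree M.Config × List M'.Config × LTree M'.Config,
      u = .wrap x.2.1 x.2.2 ∧ φ x.1.root = u.root ∧ x.1.root ∈ M.next C ∧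
      Passage (S.bounded (max m (S.need x.1.root))) (S.steps (max m (S.need x.1.root))) x.2.1
        (φ x.1.root) x.2.2.root ∧ S.Simulates (max m (S.need x.1.root)) x.1 x.2.2 := by
    intro u hu
    obtain ⟨C', hC', l', t', hφ, hut', ht', hpass, hR'⟩ :=
      hround.exists_child (hus u hu) (hchoice.mem_next _ (List.mem_map_of_mem hu))
    have hlt : t'.size < T'.size := by
      have := List.le_sum_of_mem (List.mem_map_of_mem (f := LTree.size) hu)
      rw [hut', LTree.size_wrap] at this
      rw [hT'us, LTree.size_node, List.map_singleton, List.sum_singleton, LTree.size_wrap,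
        LTree.size_node]
      lia
    obtain ⟨t, rfl, ht⟩ := ih _ hlt ht' hR' rfl
    exact ⟨(t, l', t'), hut', hφ, hC', hpass, ht⟩
  choose! F hwrap hroot hnext hpass hsim using hchild
  have hus_eq : (us.map F).map (fun x => LTree.wrap x.2.1 x.2.2) = us := by
    rw [List.map_map]
    exact (List.map_congr_left fun u hu => (hwrap u hu).symm).trans us.map_id
  have hroots : ((us.map F).map fun x => x.1.root).map φ = us.map LTree.root := by
    rw [List.map_map, List.map_map]
    exact List.map_congr_left hroot
  refine ⟨.node C ((us.map F).map fun x => x.1), rfl, ?_⟩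
  have hsimulates := Simulates.node (us.map F) hR hround
    (by rwa [← hround.isChoice_map_iff (by simpa using hnext), hroots])
    (List.forall_mem_map.2 hpass) (List.forall_mem_map.2 hsim)
  rwa [hus_eq, ← hT'us] at hsimulates

theorem IsSimulation.exists_simulates_of_isComputation (hS : S.IsSimulation)
    (hR : S.Rel m (M.initial u) (M'.initial w)) (hT' : M'.IsComputation w T') :
    ∃ T, M.IsComputation u T ∧ S.Simulates m T T' := by
  obtain ⟨T, hroot, hsim⟩ := exists_isRun_simulates hS hT'.2 (hT'.1 ▸ hR)
  exact ⟨T, ⟨hroot, hsim.isRun⟩, hsim⟩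

theorem IsSimulation.validOutputs_eq (hS : S.IsSimulation)
    (hR : S.Rel m (M.initial u) (M'.initial w)) :
    M'.validOutputs w = UTree.map S.encode '' M.validOutputs u := by
  ext O
  constructor
  · rintro ⟨T', hT', hacc, O', hO', rfl⟩
    obtain ⟨T, hT, hsim⟩ := hS.exists_simulates_of_isComputation hR hT'
    rw [hsim.outputForest_eq hS, List.map_eq_singleton_iff] at hO'
    obtain ⟨t, ht, rfl⟩ := hO'
    exact ⟨_, ⟨T, hT, (hsim.isAccepting_iff hS).1 hacc, t, ht, rfl⟩, rfl⟩
  · rintro ⟨_, ⟨T, ⟨hroot, hT⟩, hacc, t, ht, rfl⟩, rfl⟩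
    obtain ⟨T', hroot', hsim⟩ := exists_simulates_of_isRun hS hT (hroot ▸ hR)
    refine ⟨T', ⟨hroot', hsim.isRun' hS⟩, (hsim.isAccepting_iff hS).2 hacc, t.map S.encode, ?_, rfl⟩
    rw [hsim.outputForest_eq hS, ht, List.map_singleton]

theorem IsSimulation.span_eq (hS : S.IsSimulation) (hinj : S.encode.Injective)
    (hR : S.Rel m (M.initial u) (M'.initial w)) : M'.span w = M.span u := by
  rw [span, hS.validOutputs_eq hR, (UTree.map_injective hinj).encard_image, span]

end Correspondence

end ATO

/-! ### Reachable configurations -/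

theorem length_le_of_nodup_of_bounded {Q : Type u} {A : Type v} [Finite Q] [Finite A] {L I P : ℕ}
    {l : List (Q × List A × ℕ × ℕ)} (hl : l.Nodup)
    (h : ∀ x ∈ l, x.2.1.length ≤ L ∧ x.2.2.1 ≤ I ∧ x.2.2.2 ≤ P) :
    l.length ≤ Nat.card Q * ((Nat.card A + 1) ^ L * ((I + 1) * (P + 1))) := by
  have := Fintype.ofFinite Q
  have := Fintype.ofFinite A
  let pack (x : Q × List A × ℕ × ℕ) : Q × (Fin L → Option A) × Fin (I + 1) × Fin (P + 1) :=
    (x.1, fun i => x.2.1[i.val]?, Fin.ofNat _ x.2.2.1, Fin.ofNat _ x.2.2.2)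
  have hpack : (l.map pack).Nodup := by
    refine hl.map_on ?_
    rintro ⟨q, y, i, p⟩ hx ⟨q', y', i', p'⟩ hx' hxx'
    obtain ⟨hy, hi, hp⟩ := h _ hx
    obtain ⟨hy', hi', hp'⟩ := h _ hx'
    simp only [pack, Prod.mk.injEq, Fin.ofNat, Fin.mk.injEq] at hxx' hy hi hp hy' hi' hp'
    obtain ⟨rfl, hyy', hii', hpp'⟩ := hxx'
    rw [Nat.mod_eq_of_lt (by lia), Nat.mod_eq_of_lt (by lia)] at hii' hpp'
    have hyy' : y = y' := List.ext_getElem? fun k => by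
      by_cases hk : k < L
      · exact congrFun hyy' ⟨k, hk⟩
      · rw [List.getElem?_eq_none (by lia), List.getElem?_eq_none (by lia)]
    rw [hyy', hii', hpp']
  simpa [Nat.card_eq_fintype_card] using hpack.length_le_card

theorem Move.apply_injective {d d' : Move} {p : ℕ} (hd : d = .left → 0 < p)
    (hd' : d' = .left → 0 < p) (h : d.apply p = d'.apply p) : d = d' := by
  cases d <;> cases d' <;> grind [Move.apply]

namespace Transducer

variable {Λ₁ : Type u} {Λ₂ : Type v} {N : Transducer Λ₁ Λ₂} {w : List Λ₁} {C X Y Z : N.Config}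

theorem workPos_le_length (h : N.Reaches w C) : C.workPos ≤ C.work.length := by
  induction h with
  | refl => exact Nat.zero_le _
  | tail _ hstep ih =>
    obtain ⟨t, -, rfl⟩ := Option.map_eq_some_iff.1 hstep
    cases hd : t.2.2.1 <;> grind [Move.apply, length_tapeWrite]

theorem inputPos_le (h : N.Reaches w C) : C.inputPos ≤ w.length + 1 := by
  induction h with
  | refl => exact Nat.zero_le _
  | @tail X _ _ hstep ih =>
    obtain ⟨t, ht, rfl⟩ := Option.map_eq_some_iff.1 hstep
    have hright (hlt : w.length < X.inputPos) : t.2.1 ≠ .right :=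
      N.δ_input_right _ _ t (by rwa [tapeRead_inputTape_eq_blank_iff.2 hlt] at ht)
    cases hd : t.2.1 <;> grind [Move.apply]

/-- A configuration without the output, which has no influence on the steps. -/
def core (C : N.Config) : N.State × List (TapeSym N.Work) × ℕ × ℕ :=
  (C.state, C.work, C.inputPos, C.workPos)

theorem map_core_step (h : core X = core Y) : (N.step w X).map core = (N.step w Y).map core := by
  simp only [core, Prod.mk.injEq] at h
  obtain ⟨hstate, hwork, hinput, hpos⟩ := h
  simp only [step, hstate, hwork, hinput, hpos, Option.map_map]
  rfl

variable (N w) in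
/-- The steps between reachable configurations, without the output. -/
def CoreStep (x y : N.State × List (TapeSym N.Work) × ℕ × ℕ) : Prop :=
  ∃ X Y, N.Reaches w X ∧ N.step w X = some Y ∧ core X = x ∧ core Y = y

theorem length_output_le_of_trace {l : List (N.State × List (TapeSym N.Work) × ℕ × ℕ)}
    {x z : N.State × List (TapeSym N.Work) × ℕ × ℕ} (h : Trace (N.CoreStep w) l x z)
    (hX : core X = x) (hZ : core Z = z) (hhalt : N.step w Z = none)
    (hXZ : Relation.ReflTransGen (fun C₁ C₂ => N.step w C₁ = some C₂) X Z) :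
    Z.output.length ≤ X.output.length + l.length := by
  induction h generalizing X with
  | nil =>
    rcases hXZ.cases_head with rfl | ⟨Y, hXY, -⟩
    · exact le_rfl
    · have := map_core_step (w := w) (hX.trans hZ.symm)
      rw [hXY, hhalt] at this
      cases this
  | cons hstep _ ih =>
    obtain ⟨X', Y', -, hX'Y', hX', hY'⟩ := hstep
    have hcore := map_core_step (w := w) (hX.trans hX'.symm)
    rw [hX'Y'] at hcore
    obtain ⟨Y, hXY, hY⟩ := Option.map_eq_some_iff.1 hcore
    rcases hXZ.cases_head with rfl | ⟨Y₁, hXY₁, hYZ⟩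
    · rw [hhalt] at hXY
      cases hXY
    obtain rfl := Option.some.inj (hXY.symm.trans hXY₁)
    obtain ⟨t, -, rfl⟩ := Option.map_eq_some_iff.1 hXY
    have hout := ih (hY.trans hY') hZ hYZ
    have : t.2.2.2.2.toList.length ≤ 1 := by cases t.2.2.2.2 <;> simp
    simp only [List.length_append, List.length_cons] at hout ⊢
    lia

theorem length_output_le {L : ℕ} (hL : ∀ X, N.Reaches w X → X.work.length ≤ L)
    (hZ : N.Reaches w Z) (hhalt : N.step w Z = none) :
    Z.output.length ≤ Nat.card N.State * ((Nat.card (TapeSym N.Work) + 1) ^ L *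
      ((w.length + 1 + 1) * (L + 1))) := by
  have := N.finite_state
  have := N.finite_work
  have hcore : ∀ {Y}, N.Reaches w Y →
      Relation.ReflTransGen (N.CoreStep w) (core N.initial) (core Y) := by
    intro Y hY
    induction hY with
    | refl => exact .refl
    | tail hX hXY ih => exact ih.tail ⟨_, _, hX, hXY, rfl, rfl⟩
  obtain ⟨l, htrace, hnodup⟩ := Trace.exists_nodup (hcore hZ)
  refine (length_output_le_of_trace htrace rfl rfl hhalt hZ).trans ?_
  rw [show N.initial.output.length = 0 from rfl, zero_add]
  refine length_le_of_nodup_of_bounded hnodup (htrace.forall_mem ?_)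
  rintro _ _ ⟨X, _, hX, -, rfl, -⟩
  exact ⟨hL X hX, inputPos_le hX, (workPos_le_length hX).trans (hL X hX)⟩

end Transducer

namespace ATO

variable {Λ : Type u} {M : ATO Λ} {u : List Λ} {C D : M.Config} {T : LTree M.Config}
  {t t' : M.State × Move × Move × TapeSym Λ × List (TapeSym Λ)}

variable (M) in
/-- The properties of the reachable configurations on input `u` by which the cursors never move
left of cell `0`. -/
structure Invariant (u : List Λ) (C : M.Config) : Prop where
  input : C.input = inputTape u
  marker : tapeRead C.work 0 = .marker

theorem invariant_initial : M.Invariant u (M.initial u) := ⟨rfl, rfl⟩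

theorem Invariant.input_left (h : M.Invariant u C)
    (ht : t ∈ M.δ C.state (tapeRead C.input C.inputPos) (tapeRead C.work C.workPos))
    (hd : t.2.1 = .left) : 0 < C.inputPos := by
  refine Nat.pos_of_ne_zero fun h0 => ?_
  rw [h0, h.input, tapeRead_inputTape_zero] at ht
  exact M.δ_input _ _ t ht hd

theorem Invariant.work_left (h : M.Invariant u C)
    (ht : t ∈ M.δ C.state (tapeRead C.input C.inputPos) (tapeRead C.work C.workPos))
    (hd : t.2.2.1 = .left) : 0 < C.workPos := by
  refine Nat.pos_of_ne_zero fun h0 => ?_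
  rw [h0, h.marker] at ht
  exact M.δ_work _ _ t ht hd

theorem Invariant.move (h : M.Invariant u C)
    (ht : t ∈ M.δ C.state (tapeRead C.input C.inputPos) (tapeRead C.work C.workPos)) :
    M.Invariant u (M.move C t) where
  input := h.input
  marker := tapeRead_tapeWrite_zero h.marker (M.δ_marker _ _ _ t ht)

theorem Invariant.move_injOn (h : M.Invariant u C) : Set.InjOn (M.move C)
    (M.δ C.state (tapeRead C.input C.inputPos) (tapeRead C.work C.workPos)) := by
  intro t ht t' ht' heq
  obtain ⟨hstate, -, hwork, hlabel, hinputPos, hworkPos⟩ := Config.mk.inj heq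
  have hd := Move.apply_injective (h.input_left ht) (h.input_left ht') hinputPos
  have hd' := Move.apply_injective (h.work_left ht) (h.work_left ht') hworkPos
  have hb : t.2.2.2.1 = t'.2.2.2.1 := by
    simpa only [tapeRead_tapeWrite, if_true] using congrArg (tapeRead · C.workPos) hwork
  have hz : t.2.2.2.2 = t'.2.2.2.2 := by
    split_ifs at hlabel
    · exact hlabel
    · exact List.append_cancel_left hlabel
  exact Prod.ext hstate (Prod.ext hd (Prod.ext hd' (Prod.ext hb hz)))

theorem inputPos_le_of_mem_next (h : D ∈ M.next C) : D.inputPos ≤ C.inputPos + 1 := by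
  obtain ⟨t, -, rfl⟩ := h
  cases hd : t.2.1 <;> grind [move, Move.apply]

theorem IsRun.inputPos_lt (hT : M.IsRun T) :
    ∀ C ∈ T.nodes, C.inputPos < T.root.inputPos + T.size := by
  refine hT.induction (P := fun T => ∀ C ∈ T.nodes, C.inputPos < T.root.inputPos + T.size) ?_ ?_
  · simp [LTree.nodes_node, LTree.size_node, LTree.root]
  intro C ts hchoice ih D hD
  rw [LTree.nodes_node, List.mem_cons, List.mem_flatMap] at hD
  rw [LTree.size_node, LTree.root]
  rcases hD with rfl | ⟨t, ht, hD⟩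
  · lia
  · have hlt := ih t ht D hD
    have hroot := inputPos_le_of_mem_next (hchoice.mem_next _ (List.mem_map_of_mem ht))
    have hsize := List.le_sum_of_mem (List.mem_map_of_mem (f := LTree.size) ht)
    lia

theorem span_eq_of_halting_init (h : M.init = M.accept ∨ M.init = M.reject) (w w' : List Λ) :
    M.span w = M.span w' := by
  have hsub (w w' : List Λ) : M.validOutputs w ⊆ M.validOutputs w' := by
    rintro _ ⟨⟨C, ts⟩, ⟨rfl, hrun⟩, hacc, O, hO, rfl⟩
    rcases isRun_node_iff.1 hrun with ⟨-, rfl⟩ | ⟨hchoice, -⟩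
    · refine ⟨.node (M.initial w') [], ⟨rfl, .halt _ h⟩, ?_, O, ?_, rfl⟩
      · exact List.forall_mem_singleton.2 (hacc (M.initial w) (List.mem_singleton_self _))
      · rwa [outputForest_of_labeling M.init_labeling] at hO ⊢
    · exact (hchoice.not_halting h).elim
  rw [span, span, (hsub w w').antisymm (hsub w' w)]

variable (M) in
open Classical in
/-- The part of the label of `C` that remains when `C` is left. -/
noncomputable def keptLabel (C : M.Config) : List (TapeSym Λ) :=
  if C.state ∈ M.labeling then [] else C.label

theorem keptLabel_of_not_labeling (h : C.state ∉ M.labeling) : M.keptLabel C = C.label :=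
  if_neg h

theorem label_move (C : M.Config)
    (t : M.State × Move × Move × TapeSym Λ × List (TapeSym Λ)) :
    (M.move C t).label = M.keptLabel C ++ t.2.2.2.2 := by
  by_cases h : C.state ∈ M.labeling <;> simp [move, keptLabel, h]

/-- The working tape and the cursors of a configuration. -/
def mem (C : M.Config) : Mem Λ where
  tape := tapeRead C.work
  inputPos := C.inputPos
  workPos := C.workPos

theorem mem_move (C : M.Config)
    (t : M.State × Move × Move × TapeSym Λ × List (TapeSym Λ)) :
    mem (M.move C t) = (mem C).update (t.2.1, t.2.2.1, t.2.2.2.1) := by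
  simp only [mem, move, Mem.update, Mem.mk.injEq, and_self, and_true]
  ext q
  rw [tapeRead_tapeWrite, Function.update_apply]

end ATO

/-! ### Composing a machine with a transducer -/

/-- The data of the composition: a machine `M`, a transducer `N` that produces the inputs of `M`,
codings of their working alphabets by digits, and a letter `a` for the bits of the counters in which
the composed machine stores their configurations. -/
structure Reduction (Λ₁ : Type u) (Λ₂ : Type v) where
  a : Λ₁
  M : ATO Λ₂
  N : Transducer Λ₁ Λ₂
  init_not_halting : ¬(M.init = M.accept ∨ M.init = M.reject)
  cN : SymCode N.Work
  cM : SymCode Λ₂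

namespace Reduction

variable {Λ₁ : Type u} {Λ₂ : Type v} (r : Reduction Λ₁ Λ₂)

/-- The unary code of a symbol by a block of length `r.cM.top + 1`. -/
def block (s : TapeSym Λ₂) : List (TapeSym Λ₁) :=
  List.ofFn fun i : Fin (r.cM.top + 1) => if i = r.cM.code s then .marker else .blank

/-- The code of a labelling tape of `M`. It is the same for every machine with the coding `r.cM`,
and all symbols have codes of the same length. -/
def encode (z : List (TapeSym Λ₂)) : List (TapeSym Λ₁) := z.flatMap r.block

theorem block_injective : Function.Injective r.block := by
  intro s t h
  have hst := congrFun (List.ofFn_injective h) (r.cM.code s)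
  have hcode : r.cM.code s = r.cM.code t := by
    by_contra hne
    simp [hne] at hst
  rw [← r.cM.decode_code s, hcode, r.cM.decode_code]

theorem length_encode (z : List (TapeSym Λ₂)) :
    (r.encode z).length = (r.cM.top + 1) * z.length := by
  simp [encode, block, mul_comm]

theorem encode_injective : Function.Injective r.encode := by
  intro z
  induction z with
  | nil =>
    rintro (_ | ⟨s', z'⟩) h
    · rfl
    · simp [encode, block] at h
  | cons s z ih =>
    rintro (_ | ⟨s', z'⟩) h
    · simp [encode, block] at h
    · obtain ⟨hblock, hrest⟩ := List.append_inj (s₁ := r.block s) (s₂ := r.block s')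
        (t₁ := r.encode z) (t₂ := r.encode z') h (by simp [block])
      rw [r.block_injective hblock, ih hrest]

/-- The states of the composed machine between two programs: `node s` stands for the state `s` of
`M`, and in `choose s x y` the digits `x` and `y` of the symbols scanned by `M` are known. -/
inductive Hub : Type
  | init
  | node (s : r.M.State)
  | choose (s : r.M.State) (x y : Fin (r.cM.top + 1))

/-- The programs run by the composed machine: `scan s` determines the symbols scanned by `M`,
`start` does the same after preparing the initial configuration of `M`, and `execute s d d' b` has
the effect of a transition of `M` into the state `s`. -/
inductive Task : Type
  | start
  | scan (s : r.M.State)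
  | execute (s : r.M.State) (d d' : Move) (b : Fin (r.cM.top + 1))

instance : Finite r.Hub := by
  have := r.M.finite_state
  refine Finite.of_surjective
    (fun x : Option (r.M.State ⊕ r.M.State × Fin (r.cM.top + 1) × Fin (r.cM.top + 1)) =>
      x.elim Hub.init (Sum.elim .node fun x => .choose x.1 x.2.1 x.2.2)) ?_
  rintro (_ | s | ⟨s, x, y⟩)
  exacts [⟨none, rfl⟩, ⟨some (.inl s), rfl⟩, ⟨some (.inr (s, x, y)), rfl⟩]

instance : Finite r.Task := by
  have := r.M.finite_state
  refine Finite.of_surjective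
    (fun x : Option (r.M.State ⊕ r.M.State × Move × Move × Fin (r.cM.top + 1)) =>
      x.elim Task.start (Sum.elim .scan fun x => .execute x.1 x.2.1 x.2.2.1 x.2.2.2)) ?_
  rintro (_ | s | ⟨s, d, d', b⟩)
  exacts [⟨none, rfl⟩, ⟨some (.inl s), rfl⟩, ⟨some (.inr (s, d, d', b)), rfl⟩]

/-- The program that determines the symbols scanned by `M` in the state `s`. -/
noncomputable def scanProg (s : r.M.State) : Prog Λ₁ r.Hub :=
  .bind (.fetch r.a r.N r.cN r.cM) fun e => .ret (.choose s e.1 e.2)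

/-- Move the input cursor of `M`, whose position is the value of counter `0`. -/
noncomputable def cursorProg : Move → Prog Λ₁ Unit
  | .stay => .ret ()
  | .right => .inc r.a (0 : Fin 7)
  | .left => .bind (.dec r.a (0 : Fin 7)) fun _ => .ret ()

/-- The program of a task. -/
noncomputable def prog : r.Task → Prog Λ₁ r.Hub
  | .start => .bind (.incBy r.a (3 : Fin 7) (r.cM.code .marker)) fun _ => r.scanProg r.M.init
  | .scan s => r.scanProg s
  | .execute s d d' b => .bind (.writeMove r.a r.cM (6 : Fin 7) 2 3 (r.cM.decode b) d') fun _ =>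
      .bind (r.cursorProg d) fun _ => .ret (.node s)

/-- The states of the composed machine. -/
abbrev State : Type := r.Hub ⊕ Σ k, (r.prog k).Loc

/-- The task that copies a transition of `M`, together with the string to append to the label. -/
def taskOf (t : r.M.State × Move × Move × TapeSym Λ₂ × List (TapeSym Λ₂)) :
    r.Task × List (TapeSym Λ₁) :=
  (.execute t.1 t.2.1 t.2.2.1 (r.cM.code t.2.2.2.1), r.encode t.2.2.2.2)

/-- The tasks that may be started between two programs, together with the strings to append to the
label. -/
def tasks : r.Hub → Set (r.Task × List (TapeSym Λ₁))
  | .init => {(.start, [])}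
  | .node s => {x | ¬(s = r.M.accept ∨ s = r.M.reject) ∧ x = (.scan s, [])}
  | .choose s x y => r.taskOf '' r.M.δ s (r.cM.decode x) (r.cM.decode y)

/-- The transition that starts a task when `β` is scanned on the working tape. -/
noncomputable def startTask (β : TapeSym Λ₁) (x : r.Task × List (TapeSym Λ₁)) :
    r.State × Move × Move × TapeSym Λ₁ × List (TapeSym Λ₁) :=
  (.inr ⟨x.1, (r.prog x.1).entry⟩, .stay, .stay, β, x.2)

/-- The state of the composed machine for a location or an exit of the program of `k`. -/
def stateOf (k : r.Task) : (r.prog k).Loc ⊕ r.Hub → r.State :=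
  Sum.elim (fun l => .inr ⟨k, l⟩) .inl

/-- The transitions of the composed machine. -/
noncomputable def transitions : r.State → TapeSym Λ₁ → TapeSym Λ₁ →
    Set (r.State × Move × Move × TapeSym Λ₁ × List (TapeSym Λ₁))
  | .inl q, _, β => r.startTask β '' r.tasks q
  | .inr ⟨k, l⟩, α, β => {(r.stateOf k ((r.prog k).step l α β).1,
      ((r.prog k).step l α β).2.1, ((r.prog k).step l α β).2.2.1,
      ((r.prog k).step l α β).2.2.2, [])}

variable {r}

theorem finite_tasks (q : r.Hub) : (r.tasks q).Finite := by
  cases q with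
  | init => exact Set.finite_singleton _
  | node s => exact (Set.finite_singleton _).subset fun x hx => hx.2
  | choose s x y => exact (Finset.finite_toSet _).image _

theorem finite_transitions : ∀ (q : r.State) (α β : TapeSym Λ₁), (r.transitions q α β).Finite
  | .inl q, _, _ => (finite_tasks q).image _
  | .inr _, _, _ => Set.finite_singleton _

theorem legalAction_of_mem_transitions {q : r.State} {α β : TapeSym Λ₁}
    {t : r.State × Move × Move × TapeSym Λ₁ × List (TapeSym Λ₁)} (ht : t ∈ r.transitions q α β) :
    LegalAction α β (t.2.1, t.2.2.1, t.2.2.2.1) := by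
  match q, ht with
  | .inl _, ⟨x, _, hx⟩ => exact hx ▸ legalAction_stay α β
  | .inr ⟨k, l⟩, ht => exact (Set.mem_singleton_iff.1 ht) ▸ (r.prog k).legal l α β

variable (r) in
/-- The universal states of the composed machine. -/
def universalStates : Set r.State :=
  {q | ∃ s x y, q = .inl (.choose s x y) ∧ s ∈ r.M.universal}

variable (r) in
/-- The composed machine: `M` on the output of `N`. -/
noncomputable def machine : ATO Λ₁ where
  State := r.State
  finite_state := by
    have := fun k => (r.prog k).finite_loc
    infer_instance
  init := .inl .init
  accept := .inl (.node r.M.accept)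
  reject := .inl (.node r.M.reject)
  existential := {.inl (.node r.M.accept), .inl (.node r.M.reject)}ᶜ \ r.universalStates
  universal := r.universalStates
  labeling := {q | q = .inl .init ∨ ∃ s ∈ r.M.labeling, q = .inl (.node s)}
  disjoint := Set.disjoint_sdiff_left
  partition := by
    refine Set.sdiff_union_of_subset ?_
    rintro _ ⟨s, x, y, rfl, -⟩
    simp
  init_labeling := .inl rfl
  δ q α β := (finite_transitions q α β).toFinset
  δ_accept α β := by simp [transitions, tasks]
  δ_reject α β := by simp [transitions, tasks]
  δ_input _ _ _ ht :=
    (legalAction_of_mem_transitions ((Set.Finite.mem_toFinset _).1 ht)).1 rfl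
  δ_work _ _ _ ht :=
    (legalAction_of_mem_transitions ((Set.Finite.mem_toFinset _).1 ht)).2.2.1 rfl
  δ_marker _ _ _ _ ht :=
    (legalAction_of_mem_transitions ((Set.Finite.mem_toFinset _).1 ht)).2.2.2

theorem next_machine (D : r.machine.Config) : r.machine.next D = r.machine.move D ''
    r.transitions D.state (tapeRead D.input D.inputPos) (tapeRead D.work D.workPos) := by
  ext X
  constructor
  · rintro ⟨t, ht, rfl⟩
    exact ⟨t, (Set.Finite.mem_toFinset _).1 ht, rfl⟩
  · rintro ⟨t, ht, rfl⟩
    exact ⟨t, (Set.Finite.mem_toFinset _).2 ht, rfl⟩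

theorem existential_of_program {q : Σ k, (r.prog k).Loc} :
    (.inr q : r.State) ∈ r.machine.existential :=
  ⟨by rintro (h | h) <;> exact Sum.inr_ne_inl h, fun ⟨_, _, _, h, _⟩ => Sum.inr_ne_inl h⟩

theorem not_labeling_of_program {q : Σ k, (r.prog k).Loc} :
    (.inr q : r.State) ∉ r.machine.labeling := by
  rintro (h | ⟨_, _, h⟩) <;> exact Sum.inr_ne_inl h

section Execution

/-- The label is `z`, and at most `S + 1` cells of the working tape and the cells up to the first
blank of the input tape have been used. -/
structure Confined (w : List Λ₁) (z : List (TapeSym Λ₁)) (S : ℕ) (D : r.machine.Config) :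
    Prop where
  input : D.input = inputTape w
  label : D.label = z
  length_le : D.work.length ≤ S + 1
  inputPos_le : D.inputPos ≤ w.length + 1

/-- A confined configuration in the state `q` with the memory `m`. -/
structure Holds (w : List Λ₁) (z : List (TapeSym Λ₁)) (S : ℕ) (D : r.machine.Config)
    (q : r.State) (m : Mem Λ₁) : Prop extends Confined w z S D where
  state : D.state = q
  mem : ATO.mem D = m

/-- A step of a program from a confined configuration. -/
structure ProgStep (w : List Λ₁) (z : List (TapeSym Λ₁)) (S : ℕ) (D E : r.machine.Config) :
    Prop extends Confined w z S D where
  exists_state : ∃ q : Σ k, (r.prog k).Loc, D.state = .inr q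
  next_eq : r.machine.next D = {E}
  workPos_le : D.workPos ≤ S

variable {w : List Λ₁} {z : List (TapeSym Λ₁)} {S : ℕ} {D E : r.machine.Config} {k : r.Task}
  {q : r.State} {m : Mem Λ₁}

theorem ProgStep.det (h : ProgStep w z S D E) : r.machine.Det D E := by
  obtain ⟨q, hq⟩ := h.exists_state
  exact ⟨hq ▸ existential_of_program, hq ▸ not_labeling_of_program, h.next_eq⟩

theorem Holds.exists_progStep {a b : ((r.prog k).Loc ⊕ r.Hub) × Mem Λ₁}
    (hD : Holds w z S D (r.stateOf k a.1) a.2) (h : (r.prog k).Step w S a b) :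
    ∃ E, ProgStep w z S D E ∧ Holds w z S E (r.stateOf k b.1) b.2 := by
  obtain ⟨q, m⟩ := a
  obtain ⟨hS, l, rfl, rfl⟩ := h
  obtain rfl := hD.mem
  have hstate : D.state = .inr ⟨k, l⟩ := hD.state
  set s := (r.prog k).step l (tapeRead (inputTape w) D.inputPos) (tapeRead D.work D.workPos)
  have hlegal : LegalAction (tapeRead (inputTape w) D.inputPos) (tapeRead D.work D.workPos) s.2 :=
    (r.prog k).legal _ _ _
  refine ⟨r.machine.move D (r.stateOf k s.1, s.2.1, s.2.2.1, s.2.2.2, []), ⟨hD.toConfined,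
    ⟨_, hstate⟩, ?_, hS⟩, ⟨hD.input, ?_, ?_, ?_⟩, rfl, ATO.mem_move _ _⟩
  · rw [next_machine, hstate, hD.input]
    exact Set.image_singleton
  · have hlab : D.state ∉ r.machine.labeling := hstate ▸ not_labeling_of_program
    simp only [ATO.move, if_neg hlab, List.append_nil, hD.label]
  · have := hD.length_le
    simp only [ATO.move, length_tapeWrite]
    exact max_le this (Nat.succ_le_succ hS)
  · have := hD.inputPos_le
    have hright (h : w.length < D.inputPos) : s.2.1 ≠ .right :=
      hlegal.2.1 (tapeRead_inputTape_eq_blank_iff.2 h)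
    cases hd : s.2.1 <;> grind [ATO.move, Move.apply]

theorem Holds.exists_reflTransGen {a b : ((r.prog k).Loc ⊕ r.Hub) × Mem Λ₁}
    (hD : Holds w z S D (r.stateOf k a.1) a.2)
    (h : Relation.ReflTransGen ((r.prog k).Step w S) a b) :
    ∃ E, Relation.ReflTransGen (ProgStep w z S) D E ∧ Holds w z S E (r.stateOf k b.1) b.2 := by
  induction h with
  | refl => exact ⟨D, .refl, hD⟩
  | tail _ hstep ih =>
    obtain ⟨E, hDE, hE⟩ := ih
    obtain ⟨F, hEF, hF⟩ := hE.exists_progStep hstep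
    exact ⟨F, hDE.tail hEF, hF⟩

end Execution

end Reduction

/-! ### Counters on the tape of the composed machine -/

namespace Reduction

variable {Λ₁ : Type u} {Λ₂ : Type v} {r : Reduction Λ₁ Λ₂}

section Storage

/-- The space for counters with `β` bits: there are `7` counters, interleaved with a track that
marks the used cells, hence the factor `8`. -/
def space (β : ℕ) : ℕ := 8 * (β + 1)

variable (r) in
/-- The configurations of the composed machine that fit into the space given by `β`. -/
def bounded (β : ℕ) : Set r.machine.Config :=
  {D | D.work.length ≤ space β + 1 ∧ D.label.length ≤ (r.cM.top + 1) * β}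

variable (r) in
/-- A bound for the number of configurations that can occur in a terminating program when `β` limits
the space. -/
noncomputable def steps (w : List Λ₁) (β : ℕ) : ℕ :=
  Nat.card r.State * ((Nat.card (TapeSym Λ₁) + 1) ^ (space β + 1) *
    ((w.length + 1 + 1) * (space β + 1)))

/-- A configuration in the state `q` whose working tape stores the values `v` of the counters, of at
most `β` bits each. -/
def Stores (w : List Λ₁) (z : List (TapeSym Λ₁)) (β : ℕ) (D : r.machine.Config) (q : r.State)
    (v : Fin 7 → ℕ) : Prop :=
  ∃ m ≤ β, (∀ i, v i < 2 ^ m) ∧ Holds w z (space β) D q ⟨Prog.counterTape r.a m v, 0, 0⟩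

variable {w : List Λ₁} {z : List (TapeSym Λ₁)} {β β' : ℕ} {D E : r.machine.Config} {k : r.Task}
  {q : r.State} {h : r.Hub} {v v' : Fin 7 → ℕ}

theorem space_mono : Monotone space := fun _ _ hβ =>
  Nat.mul_le_mul_left 8 (Nat.succ_le_succ hβ)

theorem bounded_mono : Monotone r.bounded := fun _ _ hβ _ hD =>
  ⟨hD.1.trans (Nat.succ_le_succ (space_mono hβ)), hD.2.trans (Nat.mul_le_mul_left _ hβ)⟩

theorem steps_mono : Monotone (r.steps w) := fun _ _ hβ => by
  have := space_mono hβ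
  unfold steps
  gcongr
  lia

theorem exists_passage_of_reflTransGen [Finite Λ₁] (hz : z.length ≤ (r.cM.top + 1) * β)
    (h : Relation.ReflTransGen (ProgStep w z (space β)) D E) :
    ∃ l, ATO.Passage (r.bounded β) (r.steps w β) l D E := by
  have := r.machine.finite_state
  obtain ⟨l, htrace, hnodup⟩ := Trace.exists_nodup h
  have hstep : ∀ X ∈ l, Confined w z (space β) X ∧ X.workPos ≤ space β :=
    htrace.forall_mem fun _ _ hX => ⟨hX.toConfined, hX.workPos_le⟩
  refine ⟨l, htrace.mono fun _ _ => ProgStep.det, ?_, fun X hX =>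
    ⟨(hstep X hX).1.length_le, (hstep X hX).1.label.symm ▸ hz⟩⟩
  let core (X : r.machine.Config) := (X.state, X.work, X.inputPos, X.workPos)
  have hcore : (l.map core).Nodup := by
    refine hnodup.map_on fun X hX Y hY hXY => ?_
    obtain ⟨hstate, hwork, hinputPos, hworkPos⟩ := by simpa only [core, Prod.mk.injEq] using hXY
    have hlabel := (hstep X hX).1.label.trans (hstep Y hY).1.label.symm
    have hinput := (hstep X hX).1.input.trans (hstep Y hY).1.input.symm
    cases X
    cases Y
    simp_all only
  have hlength := length_le_of_nodup_of_bounded hcore (List.forall_mem_map.2 fun X hX =>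
    ⟨(hstep X hX).1.length_le, (hstep X hX).1.inputPos_le, (hstep X hX).2⟩)
  rwa [List.length_map] at hlength

namespace Stores

theorem mono (hβ : β ≤ β') (h : Stores w z β D q v) : Stores w z β' D q v := by
  obtain ⟨m, hm, hv, hD⟩ := h
  exact ⟨m, hm.trans hβ, hv, { hD with
    length_le := hD.length_le.trans (Nat.succ_le_succ (space_mono hβ)) }⟩

theorem state (h : Stores w z β D q v) : D.state = q := h.choose_spec.2.2.state

theorem label (h : Stores w z β D q v) : D.label = z := h.choose_spec.2.2.label

theorem mem_bounded (h : Stores w z β D q v) (hz : z.length ≤ (r.cM.top + 1) * β) :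
    D ∈ r.bounded β := by
  obtain ⟨m, -, -, hD⟩ := h
  exact ⟨hD.length_le, hD.label.symm ▸ hz⟩

theorem exists_passage [Finite Λ₁] (hD : Stores w z β D (.inr ⟨k, (r.prog k).entry⟩) v)
    (hz : z.length ≤ (r.cM.top + 1) * β) (hexec : Prog.CounterExec r.a w β (r.prog k) v 0 h v' 0) :
    ∃ l E, ATO.Passage (r.bounded β) (r.steps w β) l D E ∧ Stores w z β E (.inl h) v' := by
  obtain ⟨m, hm, hv, hD⟩ := hD
  obtain ⟨m', hm', hv', hexec⟩ := hexec m hm hv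
  obtain ⟨E, hDE, hE⟩ := Holds.exists_reflTransGen (a := (.inl (r.prog k).entry, _)) hD hexec
  obtain ⟨l, hl⟩ := exists_passage_of_reflTransGen hz hDE
  exact ⟨l, E, hl, m', hm', hv', hE⟩

theorem move_startTask (hD : Stores w z β D q v) (x : r.Task × List (TapeSym Λ₁)) :
    Stores w (r.machine.keptLabel D ++ x.2) β
      (r.machine.move D (r.startTask (tapeRead D.work D.workPos) x))
      (.inr ⟨x.1, (r.prog x.1).entry⟩) v := by
  obtain ⟨m, hm, hv, hD⟩ := hD
  have hpos : D.workPos = 0 := congrArg Mem.workPos hD.mem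
  refine ⟨m, hm, hv, ⟨hD.input, ATO.label_move D _, ?_, hD.inputPos_le⟩, rfl, ?_⟩
  · simp only [ATO.move, startTask, length_tapeWrite, hpos]
    exact max_le hD.length_le (Nat.le_add_left _ _)
  · refine (ATO.mem_move D _).trans (.trans ?_ hD.mem)
    simp only [Mem.update, startTask, Move.apply, ATO.mem, Function.update_eq_self]

end Stores

end Storage

end Reduction

/-! ### Configurations as values of counters -/

namespace Reduction

variable {Λ₁ : Type u} {Λ₂ : Type v} {r : Reduction Λ₁ Λ₂}

section Representation

variable (r) in
/-- The values of the counters that represent a configuration of `M`. -/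
def configRegisters (C : r.M.Config) : Fin 7 → ℕ :=
  registers C.inputPos 0 (r.cM.leftNum C.work C.workPos) (r.cM.rightNum C.work C.workPos) 0 0

variable (r) in
/-- Between two programs, the state `h` and the values `v` of the counters represent a configuration
of `M` on input `u`. -/
inductive Represents (u : List Λ₂) : r.Hub → (Fin 7 → ℕ) → r.M.Config → Prop
  | init : Represents u .init 0 (r.M.initial u)
  | node (C : r.M.Config) : Represents u (.node C.state) (r.configRegisters C) C

variable (r) in
/-- The transducer `N` halts on input `w` in the configuration `Z`, and its working tapes fit into
counters with `β₀` bits. -/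
structure HaltsWithin (w : List Λ₁) (β₀ : ℕ) (Z : r.N.Config) : Prop where
  reaches : r.N.Reaches w Z
  halts : r.N.step w Z = none
  pow_le : ∀ X, r.N.Reaches w X → (r.cN.top + 1) ^ X.work.length ≤ 2 ^ β₀

variable (r) in
/-- A number of bits with which the counters can store `C`, once `β₀` bits suffice for the working
tapes of the transducer. The label is added since it bounds the label of the composed machine. -/
def need (β₀ : ℕ) (C : r.M.Config) : ℕ :=
  β₀ + (r.cM.top + 1) * C.work.length + Nat.size C.inputPos + C.label.length

variable {u : List Λ₂} {w : List Λ₁} {β β₀ i : ℕ} {h : r.Hub} {v : Fin 7 → ℕ} {C : r.M.Config}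
  {Z : r.N.Config} {t : r.M.State × Move × Move × TapeSym Λ₂ × List (TapeSym Λ₂)}

theorem pow_length_le (hβ : r.need β₀ C ≤ β) : (r.cM.top + 1) ^ C.work.length ≤ 2 ^ β :=
  calc (r.cM.top + 1) ^ C.work.length ≤ (2 ^ (r.cM.top + 1)) ^ C.work.length :=
        Nat.pow_le_pow_left Nat.lt_two_pow_self.le _
    _ = 2 ^ ((r.cM.top + 1) * C.work.length) := (pow_mul _ _ _).symm
    _ ≤ 2 ^ β := Nat.pow_le_pow_right two_pos (by unfold need at hβ; lia)

theorem inputPos_lt (hβ : r.need β₀ C ≤ β) : C.inputPos < 2 ^ β :=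
  C.inputPos.lt_size_self.trans_le (Nat.pow_le_pow_right two_pos (by unfold need at hβ; lia))

theorem HaltsWithin.counterExec_scanProg (hZ : r.HaltsWithin w β₀ Z)
    (hC : r.M.Invariant Z.output C) (hβ : r.need β₀ C ≤ β) (s : r.M.State) :
    Prog.CounterExec r.a w β (r.scanProg s) (r.configRegisters C) 0
      (.choose s (r.cM.code (tapeRead C.input C.inputPos))
        (r.cM.code (tapeRead C.work C.workPos))) (r.configRegisters C) 0 := by
  have hβ₀ : β₀ ≤ β := by
    unfold need at hβ
    lia
  rw [hC.input]
  exact (Prog.counterExec_fetch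
    (fun X hX => (hZ.pow_le X hX).trans (Nat.pow_le_pow_right two_pos hβ₀)) hZ.reaches hZ.halts
    (inputPos_lt hβ) (pow_length_le hβ)).bind Prog.counterExec_ret

theorem HaltsWithin.counterExec_start (hZ : r.HaltsWithin w β₀ Z)
    (hβ : r.need β₀ (r.M.initial Z.output) ≤ β) :
    Prog.CounterExec r.a w β (r.prog .start) 0 0
      (.choose r.M.init (r.cM.code .marker) (r.cM.code .marker))
      (r.configRegisters (r.M.initial Z.output)) 0 := by
  have hmarker : (r.cM.code .marker : ℕ) < 2 ^ β :=
    (r.cM.code .marker).isLt.trans_le (by simpa [ATO.initial] using pow_length_le hβ)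
  have hregisters : Function.update (0 : Fin 7 → ℕ) 3 (r.cM.code .marker) =
      r.configRegisters (r.M.initial Z.output) := by
    ext i
    fin_cases i <;> simp [configRegisters, registers, ATO.initial, SymCode.leftNum,
      SymCode.rightNum]
  have hinc := Prog.counterExec_incBy (a := r.a) (w := w) (β := β) (i := 0) (r := (3 : Fin 7))
    (k := r.cM.code .marker) (v := 0) (by simpa using hmarker)
  rw [Pi.zero_apply, zero_add, hregisters] at hinc
  exact hinc.bind (hZ.counterExec_scanProg ATO.invariant_initial hβ r.M.init)

theorem counterExec_cursorProg (d : Move) (hi : d.apply (v 0) < 2 ^ β) :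
    Prog.CounterExec r.a w β (r.cursorProg d) v i ()
      (Function.update v 0 (d.apply (v 0))) i := by
  cases d with
  | left => exact Prog.counterExec_dec.bind Prog.counterExec_ret
  | stay =>
    rw [Move.apply, Function.update_eq_self]
    exact Prog.counterExec_ret
  | right => exact Prog.counterExec_inc hi

theorem counterExec_execute (hC : r.M.Invariant u C)
    (ht : t ∈ r.M.δ C.state (tapeRead C.input C.inputPos) (tapeRead C.work C.workPos))
    (hβ : r.need β₀ (r.M.move C t) ≤ β) :
    Prog.CounterExec r.a w β (r.prog (r.taskOf t).1) (r.configRegisters C) 0 (.node t.1)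
      (r.configRegisters (r.M.move C t)) 0 := by
  have hwrite := Prog.counterExec_writeMove (a := r.a) (w := w) (i := 0) (t := (6 : Fin 7))
    (l := 2) (r := 3) (v := r.configRegisters C) (c := r.cM) (y := C.work) (b := t.2.2.2.1)
    (by decide) (by decide) (by decide) rfl rfl rfl (pow_length_le hβ) (hC.work_left ht)
  have hcursor := counterExec_cursorProg (r := r) (w := w) (i := 0) t.2.1
    (v := registers C.inputPos 0 (r.cM.leftNum (r.M.move C t).work (r.M.move C t).workPos)
      (r.cM.rightNum (r.M.move C t).work (r.M.move C t).workPos) 0 0) (inputPos_lt hβ)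
  rw [configRegisters, update_registers_two_three] at hwrite
  rw [update_registers_zero] at hcursor
  rw [taskOf, prog, r.cM.decode_code]
  exact hwrite.bind (hcursor.bind Prog.counterExec_ret)

namespace Represents

theorem labeling_iff (hv : r.Represents u h v C) :
    .inl h ∈ r.machine.labeling ↔ C.state ∈ r.M.labeling := by
  cases hv with
  | init => exact iff_of_true r.machine.init_labeling r.M.init_labeling
  | node =>
    constructor
    · rintro (h | ⟨s, hs, h⟩)
      · cases h
      · cases h
        exact hs
    · exact fun hs => .inr ⟨_, hs, rfl⟩

theorem accept_iff (hv : r.Represents u h v C) :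
    (.inl h : r.State) = r.machine.accept ↔ C.state = r.M.accept := by
  cases hv with
  | init => exact iff_of_false nofun fun h => r.init_not_halting (.inl h)
  | node => simp [machine]

theorem reject_iff (hv : r.Represents u h v C) :
    (.inl h : r.State) = r.machine.reject ↔ C.state = r.M.reject := by
  cases hv with
  | init => exact iff_of_false nofun fun h => r.init_not_halting (.inr h)
  | node => simp [machine]

theorem existential (hv : r.Represents u h v C)
    (hC : ¬(C.state = r.M.accept ∨ C.state = r.M.reject)) :
    .inl h ∈ r.machine.existential := by
  refine ⟨fun hh => hC (hh.imp hv.accept_iff.1 hv.reject_iff.1), ?_⟩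
  rintro ⟨s, x, y, hh, -⟩
  cases hv <;> cases hh

theorem exists_task (hv : r.Represents Z.output h v C) (hZ : r.HaltsWithin w β₀ Z)
    (hC : r.M.Invariant Z.output C) (hβ : r.need β₀ C ≤ β)
    (hhalt : ¬(C.state = r.M.accept ∨ C.state = r.M.reject)) :
    ∃ k, r.tasks h = {(k, [])} ∧ Prog.CounterExec r.a w β (r.prog k) v 0
      (.choose C.state (r.cM.code (tapeRead C.input C.inputPos))
        (r.cM.code (tapeRead C.work C.workPos))) (r.configRegisters C) 0 := by
  cases hv with
  | init => exact ⟨.start, rfl, hZ.counterExec_start hβ⟩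
  | node =>
    refine ⟨.scan C.state, ?_, hZ.counterExec_scanProg hC hβ C.state⟩
    ext x
    simp [tasks, hhalt]

end Represents

end Representation

end Reduction

/-! ### Correctness of the composed machine -/

namespace Reduction

variable {Λ₁ : Type u} {Λ₂ : Type v} {r : Reduction Λ₁ Λ₂}

section Simulation

variable (r) in
/-- The configuration of the composed machine entered from `E` when it copies the transition `t` of
`M`. -/
noncomputable def copy (E : r.machine.Config)
    (t : r.M.State × Move × Move × TapeSym Λ₂ × List (TapeSym Λ₂)) : r.machine.Config :=
  r.machine.move E (r.startTask (tapeRead E.work E.workPos) (r.taskOf t))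

variable (r) in
/-- The configuration `D` of the composed machine on input `w` stands between two programs and
stores the configuration `C` of `M` on input `u` with counters of `β` bits. -/
structure Related (w : List Λ₁) (u : List Λ₂) (β₀ β : ℕ) (C : r.M.Config) (D : r.machine.Config) :
    Prop where
  invariant : r.M.Invariant u C
  need_le : r.need β₀ C ≤ β
  exists_stores : ∃ h v, r.Represents u h v C ∧ Stores w (r.encode C.label) β D (.inl h) v

variable (r) in
/-- The simulation of `M` on input `u` by the composed machine on input `w`. -/
noncomputable def correspondence (w : List Λ₁) (u : List Λ₂) (β₀ : ℕ) :
    ATO.Correspondence r.M r.machine where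
  encode := r.encode
  Rel := r.Related w u β₀
  need := r.need β₀
  bounded := r.bounded
  steps := r.steps w

variable {u : List Λ₂} {w : List Λ₁} {β β₀ : ℕ} {v : Fin 7 → ℕ} {C : r.M.Config}
  {D E : r.machine.Config} {Z : r.N.Config}
  {t : r.M.State × Move × Move × TapeSym Λ₂ × List (TapeSym Λ₂)}

theorem encode_append (z z' : List (TapeSym Λ₂)) :
    r.encode (z ++ z') = r.encode z ++ r.encode z' :=
  List.flatMap_append

theorem length_encode_label_le (hβ : r.need β₀ C ≤ β) :
    (r.encode C.label).length ≤ (r.cM.top + 1) * β := by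
  rw [length_encode]
  exact Nat.mul_le_mul_left _ ((Nat.le_add_left _ _).trans hβ)

theorem length_encode_keptLabel_le (hβ : r.need β₀ C ≤ β) :
    (r.encode (r.M.keptLabel C)).length ≤ (r.cM.top + 1) * β := by
  unfold ATO.keptLabel
  split_ifs
  · exact Nat.zero_le _
  · exact length_encode_label_le hβ

theorem copy_injective (E : r.machine.Config) : Function.Injective (r.copy E) := by
  intro t t' h
  obtain ⟨hstate, -, -, hlabel, -, -⟩ := ATO.Config.mk.inj h
  have htask : (r.taskOf t).1 = (r.taskOf t').1 := congrArg Sigma.fst (Sum.inr.inj hstate)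
  have hencode : r.encode t.2.2.2.2 = r.encode t'.2.2.2.2 := by
    split_ifs at hlabel
    · exact hlabel
    · exact List.append_cancel_left hlabel
  obtain ⟨hs, hd, hd', hb⟩ := Task.execute.inj htask
  have hb : t.2.2.2.1 = t'.2.2.2.1 := by
    rw [← r.cM.decode_code t.2.2.2.1, hb, r.cM.decode_code]
  exact Prod.ext hs (Prod.ext hd (Prod.ext hd' (Prod.ext hb (r.encode_injective hencode))))

theorem next_machine_of_choose (hE : E.state = .inl (.choose C.state
      (r.cM.code (tapeRead C.input C.inputPos)) (r.cM.code (tapeRead C.work C.workPos)))) :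
    r.machine.next E =
      r.copy E '' r.M.δ C.state (tapeRead C.input C.inputPos) (tapeRead C.work C.workPos) := by
  rw [next_machine, hE, transitions, tasks, Set.image_image, r.cM.decode_code, r.cM.decode_code]
  exact Set.image_image _ _ _

theorem exists_bijOn_next (hC : r.M.Invariant u C) (hE : E.state = .inl (.choose C.state
      (r.cM.code (tapeRead C.input C.inputPos)) (r.cM.code (tapeRead C.work C.workPos)))) :
    ∃ φ, Set.BijOn φ (r.M.next C) (r.machine.next E) ∧
      ∀ t ∈ r.M.δ C.state (tapeRead C.input C.inputPos) (tapeRead C.work C.workPos),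
        φ (r.M.move C t) = r.copy E t := by
  have hnext : r.M.next C = r.M.move C ''
      r.M.δ C.state (tapeRead C.input C.inputPos) (tapeRead C.work C.workPos) :=
    Set.ext fun _ => exists_congr fun _ => and_congr_right fun _ => eq_comm
  have : Nonempty (r.M.State × Move × Move × TapeSym Λ₂ × List (TapeSym Λ₂)) :=
    ⟨(C.state, .stay, .stay, .blank, [])⟩
  have hinv := hC.move_injOn.leftInvOn_invFunOn
  rw [hnext, next_machine_of_choose hE]
  exact ⟨r.copy E ∘ Function.invFunOn (r.M.move C) _,
    (r.copy_injective E).injOn.bijOn_image.comp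
      (hC.move_injOn.bijOn_image.symm ⟨hinv.rightInvOn_image, hinv⟩),
    fun t ht => congrArg (r.copy E) (hinv ht)⟩

theorem universal_choose_iff {s : r.M.State} {x y : Fin (r.cM.top + 1)} :
    .inl (.choose s x y) ∈ r.machine.universal ↔ s ∈ r.M.universal := by
  constructor
  · rintro ⟨_, _, _, h, hs⟩
    cases h
    exact hs
  · exact fun hs => ⟨_, _, _, rfl, hs⟩

theorem existential_choose_iff {s : r.M.State} {x y : Fin (r.cM.top + 1)}
    (hs : ¬(s = r.M.accept ∨ s = r.M.reject)) :
    .inl (.choose s x y) ∈ r.machine.existential ↔ s ∈ r.M.existential := by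
  have hhalt : ¬((.inl (.choose s x y) : r.State) = r.machine.accept ∨
      (.inl (.choose s x y) : r.State) = r.machine.reject) := by
    rintro (h | h) <;> cases h
  rw [ATO.existential_iff_not_universal hs]
  exact (ATO.existential_iff_not_universal hhalt).trans universal_choose_iff.not

theorem not_labeling_choose {s : r.M.State} {x y : Fin (r.cM.top + 1)} :
    .inl (.choose s x y) ∉ r.machine.labeling := by
  rintro (h | ⟨_, _, h⟩) <;> cases h

namespace Related

theorem labeling_iff (hR : r.Related w u β₀ β C D) :
    D.state ∈ r.machine.labeling ↔ C.state ∈ r.M.labeling := by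
  obtain ⟨_, _, hv, hD⟩ := hR.exists_stores
  exact hD.state ▸ hv.labeling_iff

theorem label_eq (hR : r.Related w u β₀ β C D) : D.label = r.encode C.label := by
  obtain ⟨_, _, -, hD⟩ := hR.exists_stores
  exact hD.label

theorem keptLabel_eq (hR : r.Related w u β₀ β C D) :
    r.machine.keptLabel D = r.encode (r.M.keptLabel C) := by
  by_cases h : C.state ∈ r.M.labeling
  · rw [ATO.keptLabel, if_pos (hR.labeling_iff.2 h), ATO.keptLabel, if_pos h]
    rfl
  · rw [ATO.keptLabel_of_not_labeling h,
      ATO.keptLabel_of_not_labeling (hR.labeling_iff.not.2 h), hR.label_eq]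

theorem mem_bounded (hR : r.Related w u β₀ β C D) : D ∈ r.bounded β := by
  obtain ⟨_, _, -, hD⟩ := hR.exists_stores
  exact hD.mem_bounded (length_encode_label_le hR.need_le)

theorem exists_passage_choose [Finite Λ₁] (hZ : r.HaltsWithin w β₀ Z)
    (hR : r.Related w Z.output β₀ β C D) (hC : ¬(C.state = r.M.accept ∨ C.state = r.M.reject)) :
    ∃ D₁ l E, D.state ∈ r.machine.existential ∧ r.machine.next D = {D₁} ∧
      ATO.Passage (r.bounded β) (r.steps w β) l D₁ E ∧
      Stores w (r.encode (r.M.keptLabel C)) β E (.inl (.choose C.state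
        (r.cM.code (tapeRead C.input C.inputPos)) (r.cM.code (tapeRead C.work C.workPos))))
        (r.configRegisters C) := by
  obtain ⟨h, v, hv, hD⟩ := hR.exists_stores
  obtain ⟨k, hk, hexec⟩ := hv.exists_task hZ hR.invariant hR.need_le hC
  have hstart := hD.move_startTask (k, [])
  rw [List.append_nil, hR.keptLabel_eq] at hstart
  obtain ⟨l, E, hpass, hE⟩ :=
    hstart.exists_passage (length_encode_keptLabel_le hR.need_le) hexec
  refine ⟨_, l, E, hD.state ▸ hv.existential hC, ?_, hpass, hE⟩
  rw [next_machine, hD.state, transitions, hk, Set.image_singleton]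
  exact Set.image_singleton

theorem exists_passage_execute [Finite Λ₁] (hC : r.M.Invariant u C)
    (hE : Stores w (r.encode (r.M.keptLabel C)) β E (.inl (.choose C.state
        (r.cM.code (tapeRead C.input C.inputPos)) (r.cM.code (tapeRead C.work C.workPos))))
        (r.configRegisters C))
    (ht : t ∈ r.M.δ C.state (tapeRead C.input C.inputPos) (tapeRead C.work C.workPos))
    (hβ : r.need β₀ (r.M.move C t) ≤ β) :
    ∃ l D', ATO.Passage (r.bounded β) (r.steps w β) l (r.copy E t) D' ∧
      r.Related w u β₀ β (r.M.move C t) D' := by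
  have hstart := hE.move_startTask (r.taskOf t)
  rw [ATO.keptLabel_of_not_labeling (hE.state ▸ not_labeling_choose), hE.label, taskOf,
    ← encode_append, ← ATO.label_move] at hstart
  obtain ⟨l, D', hpass, hD'⟩ :=
    hstart.exists_passage (length_encode_label_le hβ) (counterExec_execute hC ht hβ)
  exact ⟨l, D', hpass, hC.move ht, hβ, _, _, .node _, hD'⟩

theorem exists_round [Finite Λ₁] (hZ : r.HaltsWithin w β₀ Z)
    (hR : r.Related w Z.output β₀ β C D) (hC : ¬(C.state = r.M.accept ∨ C.state = r.M.reject)) :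
    ∃ D₁ E l φ, (r.correspondence w Z.output β₀).Round β C D D₁ E l φ := by
  obtain ⟨D₁, l, E, hD, hnext, hpass, hE⟩ := hR.exists_passage_choose hZ hC
  obtain ⟨φ, hφ, hcopy⟩ := exists_bijOn_next hR.invariant hE.state
  refine ⟨D₁, E, l, φ, hD, hnext, hpass,
    hE.mem_bounded (length_encode_keptLabel_le hR.need_le), hE.state ▸ not_labeling_choose,
    hE.state ▸ existential_choose_iff hC, hE.state ▸ universal_choose_iff, hφ, ?_⟩
  rintro _ ⟨t, ht, rfl⟩
  rw [hcopy t ht]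
  exact exists_passage_execute hR.invariant (hE.mono (le_max_left _ _)) ht (le_max_right _ _)

end Related

theorem related_initial :
    r.Related w u β₀ (r.need β₀ (r.M.initial u)) (r.M.initial u) (r.machine.initial w) := by
  refine ⟨ATO.invariant_initial, le_rfl, .init, 0, .init, 0, Nat.zero_le _, fun _ => one_pos,
    ⟨rfl, rfl, Nat.le_add_left _ _, Nat.zero_le _⟩, rfl, ?_⟩
  rw [Prog.counterTape_zero]
  rfl

theorem isSimulation_correspondence [Finite Λ₁] (hZ : r.HaltsWithin w β₀ Z) :
    (r.correspondence w Z.output β₀).IsSimulation where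
  monotone_bounded := bounded_mono
  monotone_steps := steps_mono
  mem_bounded := Related.mem_bounded
  labeling_iff := Related.labeling_iff
  label_eq := Related.label_eq
  accept_iff hR := by
    obtain ⟨_, _, hv, hD⟩ := hR.exists_stores
    exact hD.state ▸ hv.accept_iff
  reject_iff hR := by
    obtain ⟨_, _, hv, hD⟩ := hR.exists_stores
    exact hD.state ▸ hv.reject_iff
  exists_round hR := hR.exists_round hZ

end Simulation

end Reduction

/-! ### Polynomial and logarithmic bounds -/

section Growth

variable {Λ : Type u}

/-- Functions of polynomial growth in the length of a word. The bound is a power of two so that it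
combines well with logarithmic bounds. -/
def PolyBounded (F : List Λ → ℕ) : Prop := ∃ a, ∀ w, F w ≤ 2 ^ (a * logBound w.length)

/-- Functions of logarithmic growth in the length of a word. -/
def LogBounded (F : List Λ → ℕ) : Prop := ∃ a, ∀ w, F w ≤ a * logBound w.length

variable {F G : List Λ → ℕ}

theorem logBound_pos (n : ℕ) : 0 < logBound n := Nat.succ_pos _

namespace LogBounded

theorem const (k : ℕ) : LogBounded fun _ : List Λ => k :=
  ⟨k, fun _ => Nat.le_mul_of_pos_right _ (logBound_pos _)⟩

theorem logBound_length : LogBounded fun w : List Λ => logBound w.length :=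
  ⟨1, fun _ => (one_mul _).ge⟩

theorem add (hF : LogBounded F) (hG : LogBounded G) : LogBounded fun w => F w + G w := by
  obtain ⟨a, ha⟩ := hF
  obtain ⟨b, hb⟩ := hG
  exact ⟨a + b, fun w => by rw [add_mul]; exact Nat.add_le_add (ha w) (hb w)⟩

theorem const_mul (k : ℕ) (hF : LogBounded F) : LogBounded fun w => k * F w := by
  obtain ⟨a, ha⟩ := hF
  exact ⟨k * a, fun w => by rw [mul_assoc]; exact Nat.mul_le_mul_left _ (ha w)⟩

theorem const_pow (k : ℕ) (hF : LogBounded F) : PolyBounded fun w => (k + 1) ^ F w := by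
  obtain ⟨a, ha⟩ := hF
  refine ⟨k * a, fun w => ?_⟩
  calc (k + 1) ^ F w ≤ (2 ^ k) ^ F w := Nat.pow_le_pow_left Nat.lt_two_pow_self _
    _ = 2 ^ (k * F w) := (pow_mul ..).symm
    _ ≤ 2 ^ (k * a * logBound w.length) := by
      rw [mul_assoc]
      exact Nat.pow_le_pow_right two_pos (Nat.mul_le_mul_left _ (ha w))

theorem polyBounded (hF : LogBounded F) : PolyBounded F :=
  hF.imp fun _ ha w => (ha w).trans Nat.lt_two_pow_self.le

end LogBounded

namespace PolyBounded

theorem const (k : ℕ) : PolyBounded fun _ : List Λ => k :=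
  (LogBounded.const k).polyBounded

theorem length : PolyBounded fun w : List Λ => w.length :=
  ⟨1, fun w => by rw [one_mul]; exact (Nat.lt_pow_succ_log_self one_lt_two _).le⟩

theorem mono (hG : PolyBounded G) (h : ∀ w, F w ≤ G w) : PolyBounded F :=
  hG.imp fun _ ha w => (h w).trans (ha w)

theorem mul (hF : PolyBounded F) (hG : PolyBounded G) : PolyBounded fun w => F w * G w := by
  obtain ⟨a, ha⟩ := hF
  obtain ⟨b, hb⟩ := hG
  exact ⟨a + b, fun w => by rw [add_mul, pow_add]; exact Nat.mul_le_mul (ha w) (hb w)⟩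

theorem add (hF : PolyBounded F) (hG : PolyBounded G) : PolyBounded fun w => F w + G w := by
  obtain ⟨a, ha⟩ := hF
  obtain ⟨b, hb⟩ := hG
  have hmul : PolyBounded fun w : List Λ =>
      2 * (2 ^ (a * logBound w.length) * 2 ^ (b * logBound w.length)) :=
    (const 2).mul (mul ⟨a, fun _ => le_rfl⟩ ⟨b, fun _ => le_rfl⟩)
  refine hmul.mono fun w => ?_
  rw [two_mul]
  exact Nat.add_le_add ((ha w).trans (Nat.le_mul_of_pos_right _ (Nat.two_pow_pos _)))
    ((hb w).trans (Nat.le_mul_of_pos_left _ (Nat.two_pow_pos _)))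

theorem pow (hF : PolyBounded F) (k : ℕ) : PolyBounded fun w => F w ^ k := by
  induction k with
  | zero => exact const 1
  | succ k ih => simpa only [pow_succ] using ih.mul hF

theorem eval (hF : PolyBounded F) (p : Polynomial ℕ) : PolyBounded fun w => p.eval (F w) := by
  induction p using Polynomial.induction_on' with
  | add p q hp hq => simpa only [Polynomial.eval_add] using hp.add hq
  | monomial n a => simpa only [Polynomial.eval_monomial] using (const a).mul (hF.pow n)

theorem logBound (hF : PolyBounded F) : LogBounded fun w => logBound (F w) := by
  obtain ⟨a, ha⟩ := hF
  refine ⟨a + 1, fun w => ?_⟩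
  rw [add_mul, one_mul]
  refine Nat.add_le_add ?_ (logBound_pos w.length)
  exact (Nat.log_mono_right (ha w)).trans (Nat.log_pow one_lt_two _).le

theorem size (hF : PolyBounded F) : LogBounded fun w => Nat.size (F w) := by
  obtain ⟨a, ha⟩ := hF
  refine ⟨a + 1, fun w => Nat.size_le.2 ((ha w).trans_lt (Nat.pow_lt_pow_right one_lt_two ?_))⟩
  rw [add_mul, one_mul]
  exact Nat.lt_add_of_pos_right (logBound_pos _)

end PolyBounded

theorem two_pow_logBound_le (n : ℕ) : 2 ^ logBound n ≤ 2 * (n + 1) := by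
  rw [logBound, pow_succ']
  refine Nat.mul_le_mul_left _ ?_
  rcases n.eq_zero_or_pos with rfl | hn
  · rfl
  · exact (Nat.pow_log_le_self 2 hn.ne').trans n.le_succ

theorem PolyBounded.exists_polynomial (hF : PolyBounded F) :
    ∃ p : Polynomial ℕ, ∀ w, F w ≤ p.eval w.length := by
  obtain ⟨a, ha⟩ := hF
  refine ⟨(2 * (Polynomial.X + 1)) ^ a, fun w => (ha w).trans ?_⟩
  rw [mul_comm, pow_mul]
  simpa only [Polynomial.eval_pow, Polynomial.eval_mul, Polynomial.eval_ofNat, Polynomial.eval_add,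
    Polynomial.eval_X, Polynomial.eval_one]
    using Nat.pow_le_pow_left (two_pow_logBound_le w.length) a

theorem ATO.wellBehaved_of_bounds {M : ATO Λ} (k : ℕ) (hF : PolyBounded F) (hG : LogBounded G)
    (h : ∀ w T, M.IsComputation w T → T.size ≤ F w ∧
      (∀ C ∈ T.nodes, C.work.length ≤ G w ∧ C.label.length ≤ G w) ∧ M.PathBound k T) :
    M.WellBehaved := by
  obtain ⟨p, hp⟩ := hF.exists_polynomial
  obtain ⟨c, hc⟩ := hG
  refine ⟨p, c + 1, k, fun w T hT => ?_⟩
  obtain ⟨hsize, hspace, hpath⟩ := h w T hT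
  have hG' : G w ≤ (c + 1) * logBound w.length :=
    (hc w).trans (Nat.mul_le_mul_right _ c.le_succ)
  exact ⟨(hsize.trans (hp w)).trans (Nat.le_mul_of_pos_left _ c.succ_pos),
    fun C hC => ⟨(hspace C hC).1.trans hG', (hspace C hC).2.trans hG'⟩, hpath⟩

theorem LogspaceComputable.polyBounded_length {Λ₂ : Type v} {h : List Λ → List Λ₂}
    (hh : LogspaceComputable h) : PolyBounded fun w => (h w).length := by
  obtain ⟨N, hN, c, hc⟩ := hh
  have hspace : LogBounded fun w : List Λ => c * logBound w.length :=
    LogBounded.logBound_length.const_mul c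
  have hinput : PolyBounded fun w : List Λ => w.length + 1 + 1 :=
    (PolyBounded.length.add (.const 1)).add (.const 1)
  refine ((PolyBounded.const (Nat.card N.State)).mul ((hspace.const_pow
    (Nat.card (TapeSym N.Work))).mul (hinput.mul (hspace.add (.const 1)).polyBounded))).mono
      fun w => ?_
  obtain ⟨Z, hZ, hhalt, houtput⟩ := hN w
  rw [← houtput]
  exact Transducer.length_output_le (hc w) hZ hhalt

end Growth

namespace Reduction

variable {Λ₁ : Type u} {Λ₂ : Type v} {r : Reduction Λ₁ Λ₂} {h : List Λ₁ → List Λ₂}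
  {w : List Λ₁} {Z : r.N.Config} {β β₀ : List Λ₁ → ℕ}

theorem haltsWithin {L : ℕ} (hL : ∀ X, r.N.Reaches w X → X.work.length ≤ L)
    (hZ : r.N.Reaches w Z) (hhalt : r.N.step w Z = none) :
    r.HaltsWithin w ((r.cN.top + 1) * L) Z := by
  refine ⟨hZ, hhalt, fun X hX => ?_⟩
  calc (r.cN.top + 1) ^ X.work.length ≤ (2 ^ (r.cN.top + 1)) ^ X.work.length :=
        Nat.pow_le_pow_left Nat.lt_two_pow_self.le _
    _ ≤ 2 ^ ((r.cN.top + 1) * L) := by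
      rw [← pow_mul]
      exact Nat.pow_le_pow_right two_pos (Nat.mul_le_mul_left _ (hL X hX))

theorem polyBounded_steps (hβ : LogBounded β) : PolyBounded fun w => r.steps w (β w) := by
  have hspace : LogBounded fun w => space (β w) + 1 :=
    ((hβ.add (.const 1)).const_mul 8).add (.const 1)
  have hinput : PolyBounded fun w : List Λ₁ => w.length + 1 + 1 :=
    (PolyBounded.length.add (.const 1)).add (.const 1)
  exact (PolyBounded.const _).mul ((hspace.const_pow _).mul (hinput.mul hspace.polyBounded))

theorem exists_need_le (hM : r.M.WellBehaved) (hh : PolyBounded fun w => (h w).length)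
    (hβ₀ : LogBounded β₀) :
    ∃ β, LogBounded β ∧ ∀ w T, r.M.IsComputation (h w) T → ∀ C ∈ T.nodes,
      r.need (β₀ w) C ≤ β w := by
  obtain ⟨p, c, _, hM⟩ := hM
  have htape : LogBounded fun w => c * logBound (h w).length := hh.logBound.const_mul c
  have hposition : PolyBounded fun w => c * p.eval (h w).length :=
    (PolyBounded.const c).mul (hh.eval p)
  refine ⟨_, ((hβ₀.add (htape.const_mul (r.cM.top + 1))).add hposition.size).add htape,
    fun w T hT C hC => ?_⟩
  obtain ⟨hsize, hspace, -⟩ := hM (h w) T hT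
  have hinputPos : C.inputPos < (r.M.initial (h w)).inputPos + T.size :=
    hT.1 ▸ hT.2.inputPos_lt C hC
  rw [show (r.M.initial (h w)).inputPos = 0 from rfl, zero_add] at hinputPos
  exact Nat.add_le_add (Nat.add_le_add (Nat.add_le_add_left
    (Nat.mul_le_mul_left _ (hspace C hC).1) _) (Nat.size_le_size (hinputPos.le.trans hsize)))
    (hspace C hC).2

variable [Finite Λ₁]

theorem wellBehaved_machine (hM : r.M.WellBehaved) (hh : PolyBounded fun w => (h w).length)
    (hβ₀ : LogBounded β₀) (hN : ∀ w, ∃ Z, r.HaltsWithin w (β₀ w) Z ∧ Z.output = h w) :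
    r.machine.WellBehaved := by
  obtain ⟨β, hβ, hneed⟩ := exists_need_le hM hh hβ₀
  obtain ⟨p, c, k, hM⟩ := hM
  have hsize : PolyBounded fun w => (2 * r.steps w (β w) + 2) * (c * p.eval (h w).length) :=
    (((PolyBounded.const 2).mul (polyBounded_steps hβ)).add (.const 2)).mul
      ((PolyBounded.const c).mul (hh.eval p))
  have hspace : LogBounded fun w => (space (β w) + 1) + (r.cM.top + 1) * β w :=
    (((hβ.add (.const 1)).const_mul 8).add (.const 1)).add (hβ.const_mul _)
  refine ATO.wellBehaved_of_bounds (k + 1) hsize hspace fun w T' hT' => ?_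
  obtain ⟨Z, hZ, hZh⟩ := hN w
  have hS := isSimulation_correspondence hZ
  rw [hZh] at hS
  obtain ⟨T, hT, hsim⟩ := hS.exists_simulates_of_isComputation related_initial hT'
  have hneedT := hneed w T hT
  have hinit : r.need (β₀ w) (r.M.initial (h w)) ≤ β w :=
    hneedT _ (hT.1 ▸ T.root_mem_nodes)
  obtain ⟨hsizeT, -, hpath⟩ := hM (h w) T hT
  refine ⟨?_, fun X hX => ?_, hsim.pathBound hS hpath⟩
  · exact (Nat.le_add_right _ _).trans ((hsim.size_add_le hS hinit hneedT).trans
      (Nat.mul_le_mul_left _ hsizeT))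
  · have hX := hsim.mem_bounded hS hinit hneedT X hX
    exact ⟨hX.1.trans (Nat.le_add_right _ _), hX.2.trans (Nat.le_add_left _ _)⟩

theorem span_machine {b : ℕ} (hZ : r.HaltsWithin w b Z) :
    r.machine.span w = r.M.span Z.output :=
  (isSimulation_correspondence hZ).span_eq r.encode_injective related_initial

end Reduction

theorem nonempty_symCode (A : Type u) [Finite A] : Nonempty (SymCode A) := by
  have : Nonempty (TapeSym A) := ⟨.blank⟩
  obtain ⟨n, hn⟩ := Nat.exists_eq_succ_of_ne_zero (Nat.card_pos (α := TapeSym A)).ne'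
  let e : TapeSym A ≃ Fin (n + 1) := Finite.equivFinOfCardEq hn
  exact ⟨{
    top := n
    code := e.trans (Equiv.swap (e .blank) 0)
    decode := (e.trans (Equiv.swap (e .blank) 0)).symm
    code_blank := Equiv.swap_apply_left _ _
    decode_code := Equiv.symm_apply_apply _ }⟩

theorem comp_mem_SpanTL_of_machine {Λ₁ : Type u} {Λ₂ : Type v} [Finite Λ₁] [Finite Λ₂] [Nonempty Λ₁]
    {M : ATO Λ₂} (hinit : ¬(M.init = M.accept ∨ M.init = M.reject)) (hM : M.WellBehaved)
    {g : List Λ₂ → ℕ} (hg : ∀ u, M.span u = g u) {h : List Λ₁ → List Λ₂}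
    (hh : LogspaceComputable h) : g ∘ h ∈ SpanTL Λ₁ := by
  have hlength := hh.polyBounded_length
  obtain ⟨N, hN, c, hc⟩ := hh
  have := N.finite_work
  obtain ⟨a⟩ := ‹Nonempty Λ₁›
  obtain ⟨cN⟩ := nonempty_symCode N.Work
  obtain ⟨cM⟩ := nonempty_symCode Λ₂
  let r : Reduction Λ₁ Λ₂ := ⟨a, M, N, hinit, cN, cM⟩
  have hZ (w : List Λ₁) :
      ∃ Z, r.HaltsWithin w ((cN.top + 1) * (c * logBound w.length)) Z ∧ Z.output = h w :=
    let ⟨Z, hreach, hhalt, houtput⟩ := hN w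
    ⟨Z, Reduction.haltsWithin (hc w) hreach hhalt, houtput⟩
  have hbits : LogBounded fun w : List Λ₁ => (cN.top + 1) * (c * logBound w.length) :=
    (LogBounded.logBound_length.const_mul c).const_mul _
  refine ⟨r.machine, Reduction.wellBehaved_machine hM hlength hbits hZ, fun w => ?_⟩
  obtain ⟨Z, hhalts, houtput⟩ := hZ w
  rw [Reduction.span_machine hhalts, houtput, hg, Function.comp_apply]

theorem mainTheorem2 {Λ₁ : Type u} {Λ₂ : Type v} [Finite Λ₁] [Finite Λ₂]
    (f : List Λ₁ → ℕ) (g : List Λ₂ → ℕ) (h : List Λ₁ → List Λ₂)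
    (hg : g ∈ SpanTL Λ₂) (hh : LogspaceComputable h) (hf : ∀ w, f w = g (h w)) :
    f ∈ SpanTL Λ₁ := by
  obtain rfl : f = g ∘ h := funext hf
  obtain ⟨M, hM, hspan⟩ := hg
  have hconst (hgh : ∀ w, g (h w) = g (h [])) : g ∘ h ∈ SpanTL Λ₁ := by
    rw [show g ∘ h = fun _ => g (h []) from funext hgh]
    exact const_mem_SpanTL _
  rcases isEmpty_or_nonempty Λ₁ with hΛ | hΛ
  · exact hconst fun w => by rw [Subsingleton.elim w []]
  by_cases hinit : M.init = M.accept ∨ M.init = M.reject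
  · refine hconst fun w => ENat.natCast_inj.1 ?_
    rw [← hspan, ← hspan, ATO.span_eq_of_halting_init hinit]
  · exact comp_mem_SpanTL_of_machine hinit hM hspan hh
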